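/- Let $G$ be a connected compact Lie group with normalized Haar measure, fix a bi-invariant Riemannian metric on $G$ and a basis $X_1,\dots,X_n$ of left-invariant vector fields that is orthonormal at the identity, and let $\nabla f=(X_1f,\dots,X_nf)$ and $\mathcal L_G=-(X_1^2+\dots+X_n^2)$ (the positive Laplace–Beltrami operator). For a continuous irreducible unitary matrix representation $\xi$ of $G$, let $d_\xi$ be its dimension, $\nu_\xi$ the eigenvalue of $\mathcal L_G$ on the coefficient functions of $\xi$, $\langle\xi\rangle=\sqrt{1+\nu_\xi}$, and $\widehat f(\xi)=\int_G f(x)\,\xi(x)^*\,dx$. Let $H^1(G)$ be the space of $f\in L^2(G)$ with $\sum_{[\xi]\in\widehat G}d_\xi\langle\xi\rangle^2\|\widehat f(\xi)\|_{\mathrm{HS}}^2<\infty$, with the inner product $\langle f,g\rangle_{H^1}=\sum_{[\xi]\in\widehat G}d_\xi\langle\xi\rangle^2\operatorname{Tr}(\widehat f(\xi)\widehat g(\xi)^*)$. Let $P:C^\infty(G)\to C^\infty(G)$ be a continuous linear operator that commutes with left translations, and let $\sigma_P(\xi)=\xi(x)^*(P\xi)(x)$ be its symbol (which does not depend on $x$).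 Let $\lambda_{\min}^{>0}[A]$ denote the smallest non-zero singular value of a matrix $A\neq0$. Let $(\ker P|_{H^1(G)})^\perp\subset H^1(G)$ be the orthogonal complement, for $\langle\cdot,\cdot\rangle_{H^1}$, of the space of $u\in H^1(G)$ with $Pu=0$, where $P$ is extended to distributions; put $\|Pf\|_{L^2}=\infty$ if $Pf\notin L^2(G)$. Call $P$ globally solvable if every $f\in C^\infty(G)$ that is annihilated by all distributions $u$ with ${}^tPu=0$ has the form $f=Pv$ with $v\in C^\infty(G)$. Then the following are equivalent: 1. $P$ is globally solvable; 2. $P$ has closed range in $C^\infty(G)$; 3. there exist $C,k>0$ such that $\lambda_{\min}^{>0}[\sigma_P(\xi)]\ge C\langle\xi\rangle^{-k}$ for every $[\xi]\in\widehat G$ with $\sigma_P(\xi)\ne0$; 4. there exist $c>0$ and $\delta\ge1$ such that $$\|\nabla f\|_{L^2(G)}^{\delta-1}\,\|Pf\|_{L^2(G)}\ \ge\ c\,\|f\|_{L^2(G)}^{\delta}\qquad(*)$$ for every $f\in(\ker P|_{H^1(G)})^\perp$ with mean value $\int_G f\,dx=0$. Moreover, if for some $c>0$ and $\delta\ge1$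 the inequality $(*)$ holds for every $f\in(\ker P|_{H^1(G)})^\perp$, then $P$ is globally solvable; and if $P1=0$ (as for vector fields), then, conversely, global solvability of $P$ implies that $(*)$ holds for every $f\in(\ker P|_{H^1(G)})^\perp$, for some $c>0$ and $\delta\ge1$. -/

import Mathlib

open scoped Manifold ContDiff ENNReal NNReal ComplexConjugate

noncomputable section

namespace CompactLie

/-! ### Smooth functions and left-invariant vector fields -/

section Smooth

variable (E : Type*) [NormedAddCommGroup E] [NormedSpace ℝ E]
  (G : Type*) [TopologicalSpace G] [ChartedSpace E G]

/-- `C^∞(G)`: the smooth complex-valued functions on `G`. -/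
abbrev SmoothFn : Type _ := C^∞⟮𝓘(ℝ, E), G; 𝓘(ℝ, ℂ), ℂ⟯

instance smoothFnSMul : SMul ℂ (SmoothFn E G) where
  smul c f := ⟨fun x => c • f x,
    ((ContinuousLinearMap.restrictScalars ℝ
      (c • ContinuousLinearMap.id ℂ ℂ)).contMDiff (n := ∞)).comp f.contMDiff⟩

theorem smoothFn_coe_smul (c : ℂ) (f : SmoothFn E G) : ⇑(c • f) = c • ⇑f := rfl

/-- The complex vector space structure on `C^∞(G)` (pointwise operations). -/
instance smoothFnModule : Module ℂ (SmoothFn E G) :=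
  Function.Injective.module ℂ ContMDiffMap.coeFnAddMonoidHom ContMDiffMap.coe_injective
    (smoothFn_coe_smul E G)

end Smooth

section Group

variable {E : Type*} [NormedAddCommGroup E] [NormedSpace ℝ E]
  {G : Type*} [TopologicalSpace G] [ChartedSpace E G] [Group G]

/-- The derivative of a complex-valued function along the left-invariant vector field which
extends the tangent vector `v` at the identity. -/
def lieDerivFun (v : GroupLieAlgebra 𝓘(ℝ, E) G) (f : G → ℂ) (x : G) : ℂ :=
  (mfderiv 𝓘(ℝ, E) 𝓘(ℝ, ℂ) f x (mulInvariantVectorField v x) : ℂ)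

/-- The operator `-(X₁² + ⋯ + Xₙ²)` of a family of left-invariant vector fields. For an
orthonormal basis with respect to a bi-invariant Riemannian metric, this is the positive
Laplace-Beltrami operator of that metric. -/
def laplacian {n : ℕ} (X : Fin n → GroupLieAlgebra 𝓘(ℝ, E) G) (f : G → ℂ) (x : G) : ℂ :=
  -∑ i, lieDerivFun (X i) (lieDerivFun (X i) f) x

variable [LieGroup 𝓘(ℝ, E) ∞ G]

theorem contMDiff_lieDerivFun (v : GroupLieAlgebra 𝓘(ℝ, E) G) {f : G → ℂ}
    (hf : ContMDiff 𝓘(ℝ, E) 𝓘(ℝ, ℂ) ∞ f) :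
    ContMDiff 𝓘(ℝ, E) 𝓘(ℝ, ℂ) ∞ (lieDerivFun v f) := by
  have hmul : ContMDiff (𝓘(ℝ, E).prod 𝓘(ℝ, E)) 𝓘(ℝ, E) ∞ (fun p : G × G => p.1 * p.2) :=
    contMDiff_mul 𝓘(ℝ, E) ∞
  let F₁ : G → TangentBundle 𝓘(ℝ, E) G × TangentBundle 𝓘(ℝ, E) G :=
    fun g => (Bundle.TotalSpace.mk' E g 0, Bundle.TotalSpace.mk' E 1 v)
  have S₁ : ContMDiff 𝓘(ℝ, E) (𝓘(ℝ, E).tangent.prod 𝓘(ℝ, E).tangent) ∞ F₁ :=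
    (Bundle.contMDiff_zeroSection ℝ _).prodMk contMDiff_const
  have S₂ : ContMDiff (𝓘(ℝ, E).tangent.prod 𝓘(ℝ, E).tangent) (𝓘(ℝ, E).prod 𝓘(ℝ, E)).tangent ∞
      (equivTangentBundleProd 𝓘(ℝ, E) G 𝓘(ℝ, E) G).symm :=
    contMDiff_equivTangentBundleProd_symm
  have S₃ := (hf.comp hmul).contMDiff_tangentMap (m := ∞) le_rfl
  have S := ((contMDiff_snd_tangentBundle_modelSpace ℂ 𝓘(ℝ, ℂ)).comp S₃).comp (S₂.comp S₁)
  refine S.congr fun g => ?_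
  have h1 : MDifferentiableAt 𝓘(ℝ, E) 𝓘(ℝ, E) (fun y : G => g * y) 1 :=
    (contMDiff_mul_left (I := 𝓘(ℝ, E)) (n := ∞)).mdifferentiableAt (by simp)
  have h2 : MDifferentiableAt 𝓘(ℝ, E) 𝓘(ℝ, ℂ) f (g * 1) := hf.mdifferentiableAt (by simp)
  have h3 : MDifferentiableAt (𝓘(ℝ, E).prod 𝓘(ℝ, E)) 𝓘(ℝ, ℂ)
      (f ∘ fun p : G × G => p.1 * p.2) (g, 1) := (hf.comp hmul).mdifferentiableAt (by simp)
  have key := mfderiv_prod_eq_add_apply h3 (v := ((0 : E), (show E from v)))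
  have h4 : mfderiv 𝓘(ℝ, E) 𝓘(ℝ, ℂ) (fun z : G => f (g * z)) 1 =
      (mfderiv 𝓘(ℝ, E) 𝓘(ℝ, ℂ) f (g * 1)).comp
        (mfderiv 𝓘(ℝ, E) 𝓘(ℝ, E) (fun y : G => g * y) 1) := mfderiv_comp (1 : G) h2 h1
  have h5 : ∀ w : E, (mfderiv 𝓘(ℝ, E) 𝓘(ℝ, ℂ) f (g * 1) : E →L[ℝ] ℂ) w =
      (mfderiv 𝓘(ℝ, E) 𝓘(ℝ, ℂ) f g : E →L[ℝ] ℂ) w := by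
    intro w; rw [mul_one]
  refine Eq.symm (Eq.trans key ?_)
  refine (congrArg₂ (fun a b : ℂ => a + b) (ContinuousLinearMap.map_zero _)
    (DFunLike.congr_fun h4 v)).trans ?_
  exact (zero_add _).trans (h5 _)

/-- A left-invariant vector field as an operator on `C^∞(G)`. -/
def lieDeriv (v : GroupLieAlgebra 𝓘(ℝ, E) G) (f : SmoothFn E G) : SmoothFn E G :=
  ⟨lieDerivFun v f, contMDiff_lieDerivFun v f.contMDiff⟩

/-- The Fréchet topology of `C^∞(G)`: uniform convergence of all derivatives, that is, the
coarsest topology for which `f ↦ X_{v₁} ⋯ X_{vₖ} f ∈ C(G)` (with the topology of uniform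
convergence) is continuous for all finite sequences `v₁, …, vₖ` of left-invariant fields. -/
instance smoothFnTopology : TopologicalSpace (SmoothFn E G) :=
  ⨅ w : List (GroupLieAlgebra 𝓘(ℝ, E) G),
    TopologicalSpace.induced (fun f => UniformFun.ofFun (⇑(w.foldr lieDeriv f) : G → ℂ))
      inferInstance

/-- Left translation `x ↦ f (h * x)` of a smooth function. -/
def translate (h : G) (f : SmoothFn E G) : SmoothFn E G :=
  ⟨fun x => f (h * x), f.contMDiff.comp contMDiff_mul_left⟩

/-- A Riemannian metric on `G` is bi-invariant if left and right translations are isometries. -/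
def IsBiinvariant
    (g : Bundle.ContMDiffRiemannianMetric 𝓘(ℝ, E) ∞ E
      (fun x : G => TangentSpace 𝓘(ℝ, E) x)) : Prop :=
  (∀ (h x : G) (v w : TangentSpace 𝓘(ℝ, E) x),
    g.inner (h * x) (mfderiv 𝓘(ℝ, E) 𝓘(ℝ, E) (fun y : G => h * y) x v)
      (mfderiv 𝓘(ℝ, E) 𝓘(ℝ, E) (fun y : G => h * y) x w) = g.inner x v w) ∧
  (∀ (h x : G) (v w : TangentSpace 𝓘(ℝ, E) x),
    g.inner (x * h) (mfderiv 𝓘(ℝ, E) 𝓘(ℝ, E) (fun y : G => y * h) x v)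
      (mfderiv 𝓘(ℝ, E) 𝓘(ℝ, E) (fun y : G => y * h) x w) = g.inner x v w)

end Group

/-! ### The unitary dual and the Fourier coefficients -/

section Dual

variable (G : Type*) [TopologicalSpace G] [Group G]

/-- The linear representation on `ℂ^d` of a homomorphism into the unitary matrices. -/
def matrixRep {G : Type*} [Group G] {d : ℕ} (ρ : G →* Matrix.unitaryGroup (Fin d) ℂ) :
    Representation ℂ G (Fin d → ℂ) :=
  (Matrix.toLinAlgEquiv' : Matrix (Fin d) (Fin d) ℂ ≃ₐ[ℂ] _).toAlgHom.toMonoidHom.comp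
    ((Submonoid.subtype _).comp ρ)

/-- A continuous irreducible unitary matrix representation of `G`. -/
structure Irrep where
  dim : ℕ
  hom : G →* Matrix.unitaryGroup (Fin dim) ℂ
  continuous_hom : Continuous hom
  irreducible : (matrixRep hom).IsIrreducible

variable {G}

/-- The unitary matrix `ξ(x)`. -/
def Irrep.mat (ξ : Irrep G) (x : G) : Matrix (Fin ξ.dim) (Fin ξ.dim) ℂ := (ξ.hom x).1

/-- Unitary equivalence of representations. -/
def Irrep.Equivalent (ξ η : Irrep G) : Prop :=
  ∃ U : Matrix (Fin ξ.dim) (Fin η.dim) ℂ,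
    U * U.conjTranspose = 1 ∧ U.conjTranspose * U = 1 ∧ ∀ x, ξ.mat x * U = U * η.mat x

instance irrepSetoid : Setoid (Irrep G) where
  r := Irrep.Equivalent
  iseqv :=
    { refl := fun ξ => ⟨1, by simp, by simp, by simp⟩
      symm := by
        rintro ξ η ⟨U, h1, h2, h3⟩
        refine ⟨U.conjTranspose, by simpa using h2, by simpa using h1, fun x => ?_⟩
        calc η.mat x * U.conjTranspose
            = (U.conjTranspose * U) * η.mat x * U.conjTranspose := by rw [h2, Matrix.one_mul]
          _ = U.conjTranspose * (ξ.mat x * U) * U.conjTranspose := by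
              rw [h3 x]; simp only [Matrix.mul_assoc]
          _ = U.conjTranspose * ξ.mat x * (U * U.conjTranspose) := by
              simp only [Matrix.mul_assoc]
          _ = U.conjTranspose * ξ.mat x := by rw [h1, Matrix.mul_one]
      trans := by
        rintro ξ η ζ ⟨U, h1, h2, h3⟩ ⟨V, k1, k2, k3⟩
        refine ⟨U * V, ?_, ?_, fun x => ?_⟩
        · rw [Matrix.conjTranspose_mul, Matrix.mul_assoc, ← Matrix.mul_assoc V, k1,
            Matrix.one_mul, h1]
        · rw [Matrix.conjTranspose_mul, Matrix.mul_assoc, ← Matrix.mul_assoc _ U, h2,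
            Matrix.one_mul, k2]
        · rw [← Matrix.mul_assoc, h3, Matrix.mul_assoc, k3, Matrix.mul_assoc] }

variable (G) in
/-- The unitary dual of `G`: equivalence classes of continuous irreducible unitary
representations. The representative of a class `q` is `q.out`. -/
abbrev UnitaryDual : Type _ := Quotient (irrepSetoid (G := G))

/-- The matrix-valued Fourier coefficient `∫ f(x) ξ(x)^* dx`. -/
def fourierCoeff [MeasurableSpace G] (μ : MeasureTheory.Measure G) (f : G → ℂ) (ξ : Irrep G) :
    Matrix (Fin ξ.dim) (Fin ξ.dim) ℂ :=
  Matrix.of fun i j => ∫ x, f x * (ξ.mat x).conjTranspose i j ∂μ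

/-- The square of the Hilbert-Schmidt norm. -/
def hsNormSq {m n : ℕ} (A : Matrix (Fin m) (Fin n) ℂ) : ℝ := ∑ i, ∑ j, ‖A i j‖ ^ 2

/-- The smallest non-zero singular value of a non-zero complex matrix. -/
def minPosSingularValue {m n : ℕ} (A : Matrix (Fin m) (Fin n) ℂ) : ℝ :=
  sInf (Set.range (Matrix.toEuclideanLin A).singularValues \ {0})

end Dual

/-! ### Symbols, weights and Sobolev spaces -/

section Analysis

open MeasureTheory

variable {E : Type*} [NormedAddCommGroup E] [NormedSpace ℝ E]
  {G : Type*} [TopologicalSpace G] [ChartedSpace E G] [Group G]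

/-- The eigenvalue `ν_ξ` of the Laplace-Beltrami operator on the coefficient functions of `ξ`
(the set is a singleton if `X` is an orthonormal basis for a bi-invariant metric). -/
def laplaceEigenvalue {n : ℕ} (X : Fin n → GroupLieAlgebra 𝓘(ℝ, E) G) (ξ : Irrep G) : ℝ :=
  sInf {ν : ℝ | ∀ i j x, laplacian X (fun y => ξ.mat y i j) x = ν * ξ.mat x i j}

/-- The weight `⟨ξ⟩ = √(1 + ν_ξ)`. -/
def weight {n : ℕ} (X : Fin n → GroupLieAlgebra 𝓘(ℝ, E) G) (ξ : Irrep G) : ℝ :=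
  √(1 + laplaceEigenvalue X ξ)

open Classical in
/-- The value of an operator on `C^∞(G)` at a function `G → ℂ` which is smooth. It is applied
to the coefficients of continuous unitary representations, which are always smooth. -/
def applyFun (P : SmoothFn E G → SmoothFn E G) (f : G → ℂ) : G → ℂ :=
  if h : ContMDiff 𝓘(ℝ, E) 𝓘(ℝ, ℂ) ∞ f then P ⟨f, h⟩ else 0

/-- The matrix-valued global symbol `σ_P(x, ξ) = ξ(x)^* (P ξ)(x)`. -/
def symbol (P : SmoothFn E G → SmoothFn E G) (x : G) (ξ : Irrep G) :
    Matrix (Fin ξ.dim) (Fin ξ.dim) ℂ :=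
  (ξ.mat x).conjTranspose * Matrix.of fun i j => applyFun P (fun y => ξ.mat y i j) x

variable [MeasurableSpace G] (μ : Measure G)

/-- The square of the Sobolev norm of order `s`, a sum over the unitary dual. -/
def sobolevNormSq {n : ℕ} (X : Fin n → GroupLieAlgebra 𝓘(ℝ, E) G) (s : ℝ) (f : G → ℂ) : ℝ≥0∞ :=
  ∑' q : UnitaryDual G,
    ENNReal.ofReal (q.out.dim * weight X q.out ^ (2 * s) * hsNormSq (fourierCoeff μ f q.out))

/-- Membership of an `L²` function in the Sobolev space `H^s(G)`, for `s ≥ 0`. -/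
def MemSobolev {n : ℕ} (X : Fin n → GroupLieAlgebra 𝓘(ℝ, E) G) (s : ℝ) (f : Lp ℂ 2 μ) : Prop :=
  sobolevNormSq μ X s f < ⊤

/-- The inner product of `H^s(G)`. -/
def sobolevInner {n : ℕ} (X : Fin n → GroupLieAlgebra 𝓘(ℝ, E) G) (s : ℝ) (f g : G → ℂ) : ℂ :=
  ∑' q : UnitaryDual G, ((q.out.dim * weight X q.out ^ (2 * s) : ℝ) : ℂ) *
    (fourierCoeff μ f q.out * (fourierCoeff μ g q.out).conjTranspose).trace

/-- `IsExtension μ Q f h`: the extension to distributions of the operator `Q` on `C^∞(G)` sends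
`f ∈ L²(G)` to `h ∈ L²(G)`, that is, `⟨h, φ⟩ = ⟨f, ψ⟩` for all test functions `φ`, where
`ψ` is the image of `φ` under the transpose of `Q` on test functions. -/
def IsExtension (Q : SmoothFn E G → SmoothFn E G) (f h : Lp ℂ 2 μ) : Prop :=
  ∀ φ ψ : SmoothFn E G, (∀ u : SmoothFn E G, ∫ x, Q u x * φ x ∂μ = ∫ x, u x * ψ x ∂μ) →
    ∫ x, h x * φ x ∂μ = ∫ x, f x * ψ x ∂μ

/-- The norm `‖Q f‖_{L²(G)} ∈ [0, ∞]`, with value `∞` if `Q f` does not belong to `L²(G)`. -/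
def extensionNorm (Q : SmoothFn E G → SmoothFn E G) (f : Lp ℂ 2 μ) : ℝ≥0∞ :=
  ⨅ (h : Lp ℂ 2 μ) (_ : IsExtension μ Q f h), ‖h‖ₑ

/-- The space `(ker P|_{H^1(G)})^⊥`, the orthogonal complement in `H^1(G)` with respect to the
inner product of `H^1(G)` of the kernel of the extension of `P` to `H^1(G)`. -/
def kerPerp {n : ℕ} (X : Fin n → GroupLieAlgebra 𝓘(ℝ, E) G)
    (P : SmoothFn E G → SmoothFn E G) : Set (Lp ℂ 2 μ) :=
  {f | MemSobolev μ X 1 f ∧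
    ∀ u : Lp ℂ 2 μ, MemSobolev μ X 1 u → IsExtension μ P u 0 → sobolevInner μ X 1 f u = 0}

variable [LieGroup 𝓘(ℝ, E) ∞ G]

/-- The norm `‖∇f‖_{L²(G)}`, where `∇f = (X₁ f, …, Xₙ f)`. -/
def gradNorm {n : ℕ} (X : Fin n → GroupLieAlgebra 𝓘(ℝ, E) G) (f : Lp ℂ 2 μ) : ℝ≥0∞ :=
  (∑ i, extensionNorm μ (lieDeriv (X i)) f ^ 2) ^ (1 / 2 : ℝ)

/-- The directional Poincaré inequality for `P` with exponent `δ` on a set `S` of functions: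
`‖∇f‖^{δ-1} ‖P f‖ ≥ c ‖f‖^δ` for some `c > 0` and all `f ∈ S`, with norms in `L²(G)`. -/
def DirectionalPoincare {n : ℕ} (X : Fin n → GroupLieAlgebra 𝓘(ℝ, E) G)
    (P : SmoothFn E G → SmoothFn E G) (δ : ℝ) (S : Set (Lp ℂ 2 μ)) : Prop :=
  ∃ c : ℝ≥0, 0 < c ∧ ∀ f ∈ S,
    (c : ℝ≥0∞) * ‖f‖ₑ ^ δ ≤ gradNorm μ X f ^ (δ - 1) * extensionNorm μ P f

/-- `P` is globally solvable: every `f ∈ C^∞(G)` annihilated by all distributions in the kernel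
of the transpose of `P` is in the range of `P`. -/
def GloballySolvable (P : SmoothFn E G →L[ℂ] SmoothFn E G) : Prop :=
  ∀ f : SmoothFn E G, (∀ u : SmoothFn E G →L[ℂ] ℂ, u.comp P = 0 → u f = 0) →
    ∃ v : SmoothFn E G, P v = f

/-- `P` commutes with left translations. -/
def IsLeftInvariant (P : SmoothFn E G → SmoothFn E G) : Prop :=
  ∀ (h : G) (f : SmoothFn E G), P (translate h f) = translate h (P f)

end Analysis

end CompactLie

end

set_option linter.unusedSectionVars false

noncomputable section

/-! The Fourier transform on `G` turns `P` into a family of matrices. Left-invariance gives `P ξ = ξ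
σ_P(ξ)` on coefficients, and continuity extends this to the rule that the Fourier coefficient of `P
f` at `ξ` is `σ_P(ξ)` times that of `f` (`fourierCoeff_apply_of_isLeftInvariant`). Smooth functions
correspond exactly to families of matrices decaying faster than every power of the weight
(`rapidDecay_fourierCoeff`, `RapidDecay.exists_hasSum`). The theorem thus becomes a statement about
inverting the symbols on the complements of their kernels with at most polynomial loss in the
weight.

Bound implies solvability (`globallySolvable_of_symbolBound`): if `f` is annihilated by the kernel
of the transpose, each column of each Fourier coefficient lies in the range of the symbol. Solving
column by column orthogonally to the kernel loses only a power of the weight, so rapid decay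
survives. Solvability implies closed range, because the range is then an intersection of kernels of
distributions.

Closed range implies the bound (`symbolBound_of_isClosed_range`): if the bound fails,
superpolynomially small singular values occur. Place unit singular vectors at the offending classes.
Their images under the symbols decay rapidly and sum to a limit of elements of the range, but a
preimage would have coefficients of norm at least one at all these classes, contradicting smoothness
if there are infinitely many of them; finitely many cannot violate the bound.

For the inequality, Parseval expresses the norms of `f`, `∇f` and `Pf` as sums with factors `1`,
`ν_ξ` and the symbol. A bound with an integer exponent `N` gives a termwise inequality, which
Hölder's inequality with exponents `(N+1)/N` and `N+1` sums to the case `δ = N + 1`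
(`directionalPoincare_of_symbolBound`). Conversely, functions concentrated at one class, built from
a minimal singular vector, recover the bound (`symbolBound_of_directionalPoincare`). The eigenvalue
`ν_ξ = 0` is exceptional: on a connected group it belongs to the trivial representation, and it is
removed by the mean-value condition or by `P 1 = 0`.

The harmonic analysis is built from the definitions: smoothness of coefficients, Schur
orthogonality, Peter–Weyl by compact convolution operators, and scalarity of the Casimir matrix,
where bi-invariance is used. Instead of Weyl's law, a covering argument gives a polynomial bound for
the sum of `d_ξ ^ 2` over bounded weight (`exists_sum_dim_sq_le`), enough for all convergence
questions. -/

namespace CompactLie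

/-! ### The chart at the identity and left-invariant frames in it. -/

section LocalFrame

open Set Filter Topology

variable {E : Type*} [NormedAddCommGroup E] [NormedSpace ℝ E]
  {G : Type*} [TopologicalSpace G] [ChartedSpace E G] [Group G] [LieGroup 𝓘(ℝ, E) ∞ G]

variable (E G) in
/-- The inverse of the chart at the identity. -/
def idChartSymm : E → G := (extChartAt 𝓘(ℝ, E) (1 : G)).symm

variable (E G) in
/-- The coordinates of the identity. -/
def idCoord : E := extChartAt 𝓘(ℝ, E) (1 : G) 1

variable (E G) in
/-- The multiplication of `G` in the chart at the identity. -/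
def chartMul (p : E × E) : E :=
  extChartAt 𝓘(ℝ, E) (1 : G) (idChartSymm E G p.1 * idChartSymm E G p.2)

theorem idChartSymm_idCoord : idChartSymm E G (idCoord E G) = 1 :=
  extChartAt_to_inv (I := 𝓘(ℝ, E)) (1 : G)

theorem idCoord_mem_target : idCoord E G ∈ (extChartAt 𝓘(ℝ, E) (1 : G)).target :=
  mem_extChartAt_target (I := 𝓘(ℝ, E)) (1 : G)

theorem isOpen_idChart_target : IsOpen (extChartAt 𝓘(ℝ, E) (1 : G)).target :=
  isOpen_extChartAt_target (I := 𝓘(ℝ, E)) (1 : G)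

theorem contMDiffAt_idChartSymm {u : E} (hu : u ∈ (extChartAt 𝓘(ℝ, E) (1 : G)).target) :
    ContMDiffAt 𝓘(ℝ, E) 𝓘(ℝ, E) ∞ (idChartSymm E G) u := by
  have : IsManifold 𝓘(ℝ, E) ∞ G := inferInstance
  exact (contMDiffOn_extChartAt_symm (n := ∞) (1 : G)).contMDiffAt
    (isOpen_idChart_target.mem_nhds hu)

theorem contDiffAt_chartMul {p : E × E} (h1 : p.1 ∈ (extChartAt 𝓘(ℝ, E) (1 : G)).target)
    (h2 : p.2 ∈ (extChartAt 𝓘(ℝ, E) (1 : G)).target)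
    (h3 : idChartSymm E G p.1 * idChartSymm E G p.2 ∈ (extChartAt 𝓘(ℝ, E) (1 : G)).source) :
    ContDiffAt ℝ ∞ (chartMul E G) p := by
  have : IsManifold 𝓘(ℝ, E) ∞ G := inferInstance
  rw [← contMDiffAt_iff_contDiffAt]
  have a1 : ContMDiffAt 𝓘(ℝ, E × E) 𝓘(ℝ, E) ∞ (fun p : E × E => idChartSymm E G p.1) p :=
    (contMDiffAt_idChartSymm h1).comp p contDiffAt_fst.contMDiffAt
  have a2 : ContMDiffAt 𝓘(ℝ, E × E) 𝓘(ℝ, E) ∞ (fun p : E × E => idChartSymm E G p.2) p :=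
    (contMDiffAt_idChartSymm h2).comp p contDiffAt_snd.contMDiffAt
  have a3 := a1.mul a2
  have a4 : ContMDiffAt 𝓘(ℝ, E) 𝓘(ℝ, E) ∞ (extChartAt 𝓘(ℝ, E) (1 : G))
      (idChartSymm E G p.1 * idChartSymm E G p.2) :=
    contMDiffAt_extChartAt' (by simpa using h3)
  exact a4.comp p a3

/-- The left-invariant field at `x` is the image of `v` under the differential of `y ↦ x * y`, so
the chain rule applies. Derivatives at all points become Fréchet derivatives at the single point
`idCoord E G`, with `x` as a parameter. -/
theorem lieDerivFun_eq_fderiv (v : GroupLieAlgebra 𝓘(ℝ, E) G) {f : G → ℂ} {x : G}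
    (hf : MDifferentiableAt 𝓘(ℝ, E) 𝓘(ℝ, ℂ) f x) :
    lieDerivFun v f x =
      fderiv ℝ (fun z : E => f (x * idChartSymm E G z)) (idCoord E G) (v : E) := by
  have h1 : MDifferentiableAt 𝓘(ℝ, E) 𝓘(ℝ, E) (fun y : G => x * y) 1 :=
    (contMDiff_mul_left (I := 𝓘(ℝ, E)) (n := ∞)).mdifferentiableAt (by simp)
  have hf' : MDifferentiableAt 𝓘(ℝ, E) 𝓘(ℝ, ℂ) f (x * 1) := by rwa [mul_one]
  have h4 : mfderiv 𝓘(ℝ, E) 𝓘(ℝ, ℂ) (fun z : G => f (x * z)) 1 =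
      (mfderiv 𝓘(ℝ, E) 𝓘(ℝ, ℂ) f (x * 1)).comp
        (mfderiv 𝓘(ℝ, E) 𝓘(ℝ, E) (fun y : G => x * y) 1) := mfderiv_comp (1 : G) hf' h1
  -- The tangent spaces at `x * 1` and `x` are both `E` by definition, so the base point can be
  -- rewritten once the derivative is viewed as a map on `E`.
  have h5 : ∀ w : E, (mfderiv 𝓘(ℝ, E) 𝓘(ℝ, ℂ) f (x * 1) : E →L[ℝ] ℂ) w =
      (mfderiv 𝓘(ℝ, E) 𝓘(ℝ, ℂ) f x : E →L[ℝ] ℂ) w := by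
    intro w; rw [mul_one]
  have h6 : MDifferentiableAt 𝓘(ℝ, E) 𝓘(ℝ, ℂ) (fun z : G => f (x * z)) 1 := hf'.comp (1 : G) h1
  have h7 : (mfderiv 𝓘(ℝ, E) 𝓘(ℝ, ℂ) (fun z : G => f (x * z)) 1 : E →L[ℝ] ℂ) =
      fderiv ℝ (fun z : E => f (x * idChartSymm E G z)) (idCoord E G) := by
    refine h6.mfderiv.trans ?_
    simp only [writtenInExtChartAt, ModelWithCorners.range_eq_univ, fderivWithin_univ]
    rfl
  rw [← h7]
  exact ((h5 _).symm.trans (DFunLike.congr_fun h4 v).symm)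

theorem continuousAt_idChartSymm {u : E} (hu : u ∈ (extChartAt 𝓘(ℝ, E) (1 : G)).target) :
    ContinuousAt (idChartSymm E G) u :=
  continuousAt_extChartAt_symm'' hu

theorem differentiableAt_comp_idChartSymm {f : G → ℂ} (hf : MDifferentiable 𝓘(ℝ, E) 𝓘(ℝ, ℂ) f)
    (x : G) {u : E} (hu : u ∈ (extChartAt 𝓘(ℝ, E) (1 : G)).target) :
    DifferentiableAt ℝ (fun u => f (x * idChartSymm E G u)) u := by
  rw [← mdifferentiableAt_iff_differentiableAt]
  have h1 : MDifferentiableAt 𝓘(ℝ, E) 𝓘(ℝ, E) (fun y : G => x * y) (idChartSymm E G u) :=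
    (contMDiff_mul_left (I := 𝓘(ℝ, E)) (n := ∞)).mdifferentiableAt (by simp)
  exact ((hf _).comp _ h1).comp u ((contMDiffAt_idChartSymm hu).mdifferentiableAt (by simp))

/-- The derivative of `z ↦ chartMul (u, z)` in the direction `v` is the coordinate expression, at
the point with coordinate `u`, of the left-invariant field extending `v`. -/
theorem fderiv_comp_chartMul {f : G → ℂ} (hf : MDifferentiable 𝓘(ℝ, E) 𝓘(ℝ, ℂ) f) (x : G) {u : E}
    (hu : u ∈ (extChartAt 𝓘(ℝ, E) (1 : G)).target) (v : E) :
    fderiv ℝ (fun u => f (x * idChartSymm E G u)) u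
      (fderiv ℝ (fun z => chartMul E G (u, z)) (idCoord E G) v) =
    lieDerivFun (show GroupLieAlgebra 𝓘(ℝ, E) G from v) f (x * idChartSymm E G u) := by
  have hsrc : idChartSymm E G u ∈ (extChartAt 𝓘(ℝ, E) (1 : G)).source :=
    (extChartAt 𝓘(ℝ, E) (1 : G)).map_target hu
  have hmul : idChartSymm E G u * idChartSymm E G (idCoord E G) = idChartSymm E G u := by
    rw [idChartSymm_idCoord, mul_one]
  have hM : chartMul E G (u, idCoord E G) = u := by
    simp only [chartMul, hmul]
    exact (extChartAt 𝓘(ℝ, E) (1 : G)).right_inv hu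
  rw [lieDerivFun_eq_fderiv _ (hf _)]
  have hc : ContDiffAt ℝ ∞ (chartMul E G) (u, idCoord E G) :=
    contDiffAt_chartMul hu idCoord_mem_target (by simpa only [hmul] using hsrc)
  have hd : DifferentiableAt ℝ (fun z => chartMul E G (u, z)) (idCoord E G) :=
    (hc.differentiableAt (by simp)).comp (idCoord E G)
      ((differentiableAt_const u).prodMk differentiableAt_id)
  have hg : DifferentiableAt ℝ (fun u => f (x * idChartSymm E G u))
      (chartMul E G (u, idCoord E G)) := by
    rw [hM]; exact differentiableAt_comp_idChartSymm hf x hu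
  have hcomp := fderiv_comp (idCoord E G) hg hd
  rw [hM] at hcomp
  have hev : (fun z : E => f (x * idChartSymm E G u * idChartSymm E G z)) =ᶠ[𝓝 (idCoord E G)]
      (fun u => f (x * idChartSymm E G u)) ∘ fun z => chartMul E G (u, z) := by
    have hcont : ContinuousAt (fun z => idChartSymm E G u * idChartSymm E G z) (idCoord E G) := by
      have : IsTopologicalGroup G := topologicalGroup_of_lieGroup 𝓘(ℝ, E) ∞
      exact continuousAt_const.mul (continuousAt_idChartSymm idCoord_mem_target)
    have hopen := isOpen_extChartAt_source (I := 𝓘(ℝ, E)) (1 : G)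
    filter_upwards [hcont (hopen.mem_nhds (by simpa only [hmul] using hsrc))] with z hz
    have : idChartSymm E G (chartMul E G (u, z)) = idChartSymm E G u * idChartSymm E G z :=
      (extChartAt 𝓘(ℝ, E) (1 : G)).left_inv hz
    simp only [Function.comp_apply, this, mul_assoc]
  rw [hev.fderiv_eq, hcomp]
  rfl

/-- In the chart at the identity, the derivative of a left translate of `f` is expressed through
the derivatives of `f` along left-invariant vector fields, with smooth bounded coefficients. -/
theorem exists_local_frame [CompleteSpace E] : ∃ r > (0 : ℝ), ∃ A : E → E →L[ℝ] E,
    Metric.ball (idCoord E G) r ⊆ (extChartAt 𝓘(ℝ, E) (1 : G)).target ∧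
    (∀ u ∈ Metric.ball (idCoord E G) r, ContDiffAt ℝ ∞ A u) ∧
    (∀ u ∈ Metric.ball (idCoord E G) r, ‖A u‖ ≤ 2) ∧
    A (idCoord E G) = ContinuousLinearMap.id ℝ E ∧
    ∀ (f : G → ℂ), MDifferentiable 𝓘(ℝ, E) 𝓘(ℝ, ℂ) f → ∀ x : G,
      ∀ u ∈ Metric.ball (idCoord E G) r, ∀ w : E,
        fderiv ℝ (fun u => f (x * idChartSymm E G u)) u w =
          lieDerivFun (show GroupLieAlgebra 𝓘(ℝ, E) G from A u w) f (x * idChartSymm E G u) := by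
  -- `B u` expresses the left-invariant frame at `u` in the coordinates of the chart. It is the
  -- identity at the base point, hence invertible nearby, and `A` is its inverse; there also `‖A u‖
  -- < 2`.
  let B : E → E →L[ℝ] E := fun u => fderiv ℝ (fun z => chartMul E G (u, z)) (idCoord E G)
  have hBc : ∀ u ∈ (extChartAt 𝓘(ℝ, E) (1 : G)).target, ContDiffAt ℝ ∞ B u := by
    intro u hu
    have hc : ContDiffAt ℝ ∞ (chartMul E G) (u, idCoord E G) :=
      contDiffAt_chartMul hu idCoord_mem_target (by
        simp only [idChartSymm_idCoord, mul_one]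
        exact (extChartAt 𝓘(ℝ, E) (1 : G)).map_target hu)
    exact ContDiffAt.fderiv (f := fun u z => chartMul E G (u, z)) (g := fun _ => idCoord E G)
      (n := ∞) (m := ∞) hc contDiffAt_const (by simp)
  have hB1 : B (idCoord E G) = ContinuousLinearMap.id ℝ E := by
    have : (fun z => chartMul E G (idCoord E G, z)) =ᶠ[𝓝 (idCoord E G)] id := by
      filter_upwards [isOpen_idChart_target.mem_nhds idCoord_mem_target] with z hz
      simp only [chartMul, idChartSymm_idCoord, one_mul, id]
      exact (extChartAt 𝓘(ℝ, E) (1 : G)).right_inv hz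
    simp only [B]
    rw [this.fderiv_eq, fderiv_id]
  let e1 : E ≃L[ℝ] E := ContinuousLinearEquiv.refl ℝ E
  have he1 : B (idCoord E G) = (e1 : E →L[ℝ] E) := hB1
  have hBcont : ContinuousAt B (idCoord E G) := (hBc _ idCoord_mem_target).continuousAt
  let A : E → E →L[ℝ] E := fun u => ContinuousLinearMap.inverse (B u)
  have hA1 : A (idCoord E G) = ContinuousLinearMap.id ℝ E := by
    simp only [A, hB1]; exact ContinuousLinearMap.inverse_id
  have hev1 : ∀ᶠ u in 𝓝 (idCoord E G), B u ∈ range ((↑) : (E ≃L[ℝ] E) → E →L[ℝ] E) :=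
    hBcont (he1 ▸ ContinuousLinearEquiv.nhds e1)
  have hAt : ∀ u ∈ (extChartAt 𝓘(ℝ, E) (1 : G)).target,
      B u ∈ range ((↑) : (E ≃L[ℝ] E) → E →L[ℝ] E) → ContDiffAt ℝ ∞ A u := by
    rintro u hu ⟨e, he⟩
    have h := contDiffAt_map_inverse (n := ∞) (𝕜 := ℝ) e
    rw [he] at h
    exact h.comp u (hBc u hu)
  have hAcont : ContinuousAt A (idCoord E G) :=
    (hAt _ idCoord_mem_target ⟨e1, he1.symm⟩).continuousAt
  have hev2 : ∀ᶠ u in 𝓝 (idCoord E G), ‖A u‖ < 2 := by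
    apply hAcont.norm.eventually_lt continuousAt_const
    rw [hA1]
    exact ContinuousLinearMap.norm_id_le.trans_lt (by norm_num)
  have hev3 := isOpen_idChart_target.mem_nhds (idCoord_mem_target (E := E) (G := G))
  obtain ⟨r, hr, hball⟩ := Metric.mem_nhds_iff.1 (inter_mem hev3 (inter_mem hev1 hev2))
  refine ⟨r, hr, A, fun u hu => (hball hu).1, fun u hu => hAt u (hball hu).1 (hball hu).2.1,
    fun u hu => le_of_lt (hball hu).2.2, hA1, fun f hf x u hu w => ?_⟩
  rw [← fderiv_comp_chartMul hf x (hball hu).1]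
  obtain ⟨e, he⟩ := (hball hu).2.1
  congr 1
  have : B u (A u w) = w := by
    simp only [A, ← he, ContinuousLinearMap.inverse_equiv]
    exact e.apply_symm_apply w
  exact this.symm

end LocalFrame

/-! ### Integrals of families of smooth functions and differentiation under the integral sign. -/

section Families

open Set Filter Topology MeasureTheory

variable {E : Type*} [NormedAddCommGroup E] [NormedSpace ℝ E]
  {G : Type*} [TopologicalSpace G] [ChartedSpace E G] [Group G] [LieGroup 𝓘(ℝ, E) ∞ G]

theorem lieDerivFun_sum {n : ℕ} (c : Fin n → ℝ) (X : Fin n → GroupLieAlgebra 𝓘(ℝ, E) G)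
    (f : G → ℂ) (x : G) :
    lieDerivFun (∑ i, c i • X i) f x = ∑ i, (c i : ℂ) * lieDerivFun (X i) f x := by
  let L : E →L[ℝ] ℂ := (mfderiv 𝓘(ℝ, E) 𝓘(ℝ, ℂ) f (x * 1) : E →L[ℝ] ℂ).comp
    (mfderiv 𝓘(ℝ, E) 𝓘(ℝ, E) (fun y : G => x * y) 1 : E →L[ℝ] E)
  have hL : ∀ v : E, lieDerivFun (show GroupLieAlgebra 𝓘(ℝ, E) G from v) f x = L v := by
    intro v
    have h5 : ∀ w : E, (mfderiv 𝓘(ℝ, E) 𝓘(ℝ, ℂ) f (x * 1) : E →L[ℝ] ℂ) w =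
        (mfderiv 𝓘(ℝ, E) 𝓘(ℝ, ℂ) f x : E →L[ℝ] ℂ) w := by
      intro w; rw [mul_one]
    exact (h5 _).symm
  refine (hL _).trans ?_
  refine (map_sum L _ _).trans ?_
  refine Finset.sum_congr rfl fun i _ => ?_
  refine (L.map_smul (c i) (X i : E)).trans ?_
  rw [Complex.real_smul]
  exact congrArg _ (hL _).symm

/-- Local coframe: the derivative of a left translate of `f` in the chart at the identity. -/
theorem exists_local_coframe [FiniteDimensional ℝ E] {n : ℕ}
    (b : Module.Basis (Fin n) ℝ (GroupLieAlgebra 𝓘(ℝ, E) G)) :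
    ∃ r > (0 : ℝ), ∃ K > (0 : ℝ), ∃ c : Fin n → E → E →L[ℝ] ℝ,
    Metric.ball (idCoord E G) r ⊆ (extChartAt 𝓘(ℝ, E) (1 : G)).target ∧
    (∀ i, ∀ u ∈ Metric.ball (idCoord E G) r, ContDiffAt ℝ ∞ (c i) u) ∧
    (∀ i, ∀ u ∈ Metric.ball (idCoord E G) r, ‖c i u‖ ≤ K) ∧
    ∀ (f : G → ℂ), MDifferentiable 𝓘(ℝ, E) 𝓘(ℝ, ℂ) f → ∀ x : G,
      ∀ u ∈ Metric.ball (idCoord E G) r,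
        HasFDerivAt (fun u => f (x * idChartSymm E G u))
          (∑ i, (c i u).smulRight (lieDerivFun (b i) f (x * idChartSymm E G u))) u := by
  have : CompleteSpace E := FiniteDimensional.complete ℝ E
  obtain ⟨r, hr, A, h1, h2, h3, -, h5⟩ := exists_local_frame (E := E) (G := G)
  let b' : Module.Basis (Fin n) ℝ E := b
  let co : Fin n → E →L[ℝ] ℝ := fun i => LinearMap.toContinuousLinearMap (b'.coord i)
  -- The coframe is the dual basis of `b` composed with `A`. The factor 2 bounds `‖A u‖`, and the
  -- summand 1 keeps the constant positive.
  refine ⟨r, hr, (∑ i, ‖co i‖ * 2) + 1, by positivity, fun i u => (co i).comp (A u), h1,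
    fun i u hu => ?_, fun i u hu => ?_, fun f hf x u hu => ?_⟩
  · exact contDiffAt_const.clm_comp (h2 u hu)
  · refine ((co i).opNorm_comp_le (A u)).trans ?_
    have := Finset.single_le_sum (f := fun i => ‖co i‖ * 2) (fun i _ => by positivity)
      (Finset.mem_univ i)
    have h6 : ‖co i‖ * ‖A u‖ ≤ ‖co i‖ * 2 := by gcongr; exact h3 u hu
    linarith
  · have hd := (differentiableAt_comp_idChartSymm hf x (h1 hu)).hasFDerivAt
    convert hd using 1
    ext w
    rw [h5 f hf x u hu w]
    have hw : (A u w : E) = ∑ i, (co i (A u w)) • b' i := (b'.sum_repr (A u w)).symm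
    have := lieDerivFun_sum (fun i => co i (A u w)) b f (x * idChartSymm E G u)
    simp only [_root_.sum_apply, ContinuousLinearMap.smulRight_apply,
      ContinuousLinearMap.comp_apply, Complex.real_smul]
    rw [← this]
    exact congrArg (fun v => lieDerivFun v f (x * idChartSymm E G u)) hw.symm

/-- Near `x` every function factors through the chart at the identity translated to `x`, so its
regularity at `x` may be tested in that chart. -/
theorem eventuallyEq_comp_idChart {F : G → ℂ} (x : G) :
    F =ᶠ[𝓝 x] (fun u => F (x * idChartSymm E G u)) ∘
      fun y => extChartAt 𝓘(ℝ, E) (1 : G) (x⁻¹ * y) := by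
  have : IsTopologicalGroup G := topologicalGroup_of_lieGroup 𝓘(ℝ, E) ∞
  have hcont : ContinuousAt (fun y => x⁻¹ * y) x := by fun_prop
  have hmem : (extChartAt 𝓘(ℝ, E) (1 : G)).source ∈ 𝓝 (x⁻¹ * x) := by
    rw [inv_mul_cancel]
    exact extChartAt_source_mem_nhds 1
  filter_upwards [hcont hmem] with y hy
  have : idChartSymm E G (extChartAt 𝓘(ℝ, E) (1 : G) (x⁻¹ * y)) = x⁻¹ * y :=
    (extChartAt 𝓘(ℝ, E) (1 : G)).left_inv hy
  simp only [Function.comp_apply, this, mul_inv_cancel_left]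

theorem contMDiffAt_idChart_translate (x : G) :
    ContMDiffAt 𝓘(ℝ, E) 𝓘(ℝ, E) ∞ (fun y => extChartAt 𝓘(ℝ, E) (1 : G) (x⁻¹ * y)) x := by
  have : IsManifold 𝓘(ℝ, E) ∞ G := inferInstance
  refine ContMDiffAt.comp (I' := 𝓘(ℝ, E)) x
    (g := extChartAt 𝓘(ℝ, E) (1 : G)) (f := fun y => x⁻¹ * y) ?_
    (contMDiff_mul_left (I := 𝓘(ℝ, E)) (n := ∞)).contMDiffAt
  rw [inv_mul_cancel]
  exact contMDiffAt_extChartAt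

theorem mdifferentiableAt_of_comp_idChartSymm {F : G → ℂ} {x : G}
    (h : DifferentiableAt ℝ (fun u => F (x * idChartSymm E G u)) (idCoord E G)) :
    MDifferentiableAt 𝓘(ℝ, E) 𝓘(ℝ, ℂ) F x := by
  refine MDifferentiableAt.congr_of_eventuallyEq ?_ (eventuallyEq_comp_idChart (E := E) x)
  refine MDifferentiableAt.comp x (I' := 𝓘(ℝ, E)) ?_
    ((contMDiffAt_idChart_translate x).mdifferentiableAt (by simp))
  rw [inv_mul_cancel]
  exact h.mdifferentiableAt

theorem contMDiffAt_of_comp_idChartSymm {F : G → ℂ} {x : G} {m : ℕ}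
    (h : ContDiffAt ℝ m (fun u => F (x * idChartSymm E G u)) (idCoord E G)) :
    ContMDiffAt 𝓘(ℝ, E) 𝓘(ℝ, ℂ) m F x := by
  refine ContMDiffAt.congr_of_eventuallyEq ?_ (eventuallyEq_comp_idChart (E := E) x)
  refine ContMDiffAt.comp x (I' := 𝓘(ℝ, E)) ?_
    ((contMDiffAt_idChart_translate x).of_le (by exact_mod_cast le_top))
  rw [inv_mul_cancel]
  exact h.contMDiffAt

theorem contDiffAt_comp_idChartSymm {F : G → ℂ} {m : ℕ}
    (h : ContMDiff 𝓘(ℝ, E) 𝓘(ℝ, ℂ) m F) (x : G) {u : E}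
    (hu : u ∈ (extChartAt 𝓘(ℝ, E) (1 : G)).target) :
    ContDiffAt ℝ m (fun u => F (x * idChartSymm E G u)) u := by
  rw [← contMDiffAt_iff_contDiffAt]
  have h1 : ContMDiffAt 𝓘(ℝ, E) 𝓘(ℝ, E) m (fun y : G => x * y) (idChartSymm E G u) :=
    ((contMDiff_mul_left (I := 𝓘(ℝ, E)) (n := ∞)).of_le (by exact_mod_cast le_top)).contMDiffAt
  exact (h.contMDiffAt.comp _ h1).comp u
    ((contMDiffAt_idChartSymm hu).of_le (by exact_mod_cast le_top))

/-- A differentiable function whose derivatives along left-invariant vector fields are `C^m` is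
`C^{m+1}`. -/
theorem contMDiff_succ_of_lieDerivFun [FiniteDimensional ℝ E] {F : G → ℂ} {m : ℕ}
    (hF : MDifferentiable 𝓘(ℝ, E) 𝓘(ℝ, ℂ) F)
    (h : ∀ v : GroupLieAlgebra 𝓘(ℝ, E) G, ContMDiff 𝓘(ℝ, E) 𝓘(ℝ, ℂ) m (lieDerivFun v F)) :
    ContMDiff 𝓘(ℝ, E) 𝓘(ℝ, ℂ) (m + 1 : ℕ) F := by
  intro x
  let b : Module.Basis (Fin (Module.finrank ℝ E)) ℝ (GroupLieAlgebra 𝓘(ℝ, E) G) :=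
    Module.finBasis ℝ E
  obtain ⟨r, hr, K, hK, c, h1, h2, -, h4⟩ := exists_local_coframe b
  apply contMDiffAt_of_comp_idChartSymm (E := E)
  have hmem : Metric.ball (idCoord E G) r ∈ 𝓝 (idCoord E G) := Metric.ball_mem_nhds _ hr
  refine ContDiffOn.contDiffAt (s := Metric.ball (idCoord E G) r) ?_ hmem
  rw [show ((m + 1 : ℕ) : ℕ∞ω) = (m : ℕ∞ω) + 1 by norm_cast,
    contDiffOn_succ_iff_fderiv_of_isOpen Metric.isOpen_ball]
  refine ⟨fun u hu => (h4 F hF x u hu).differentiableAt.differentiableWithinAt, by simp, ?_⟩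
  have hcd : ContDiffOn ℝ m (fun u => ∑ i, (c i u).smulRight
      (lieDerivFun (b i) F (x * idChartSymm E G u))) (Metric.ball (idCoord E G) r) := by
    refine ContDiffOn.sum fun i _ u hu => ContDiffAt.contDiffWithinAt ?_
    refine ContDiffAt.smulRight ((h2 i u hu).of_le (by exact_mod_cast le_top)) ?_
    exact contDiffAt_comp_idChartSymm (h (b i)) x (h1 hu)
  exact hcd.congr fun u hu => (h4 F hF x u hu).fderiv

/-- A family of smooth functions all of whose derivatives along left-invariant vector fields are
dominated by integrable functions of the parameter. -/
def IsDominated {Ω : Type*} [MeasurableSpace Ω] (m : Measure Ω) (f : Ω → SmoothFn E G) : Prop :=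
  ∀ w : List (GroupLieAlgebra 𝓘(ℝ, E) G),
    (∀ x, AEStronglyMeasurable (fun t => (w.foldr lieDeriv (f t)) x) m) ∧
    ∃ B : Ω → ℝ, Integrable B m ∧ ∀ t x, ‖(w.foldr lieDeriv (f t)) x‖ ≤ B t

/-- `foldr` applies the last letter of a word first, so differentiating the family lengthens each
word at its end. -/
theorem IsDominated.lieDeriv {Ω : Type*} [MeasurableSpace Ω] {m : Measure Ω}
    {f : Ω → SmoothFn E G} (hf : IsDominated m f) (v : GroupLieAlgebra 𝓘(ℝ, E) G) :
    IsDominated m (fun t => CompactLie.lieDeriv v (f t)) := by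
  intro w
  simpa [List.foldr_append] using hf (w ++ [v])

/-- In the chart, the derivative of each member is a combination of its left-invariant derivatives
with coefficients bounded by `K`. The dominating functions of one-letter words therefore dominate
it, uniformly in the base point. -/
theorem IsDominated.lieDerivFun_integral [FiniteDimensional ℝ E] {Ω : Type*} [MeasurableSpace Ω]
    {m : Measure Ω} {f : Ω → SmoothFn E G} (hf : IsDominated m f) :
    MDifferentiable 𝓘(ℝ, E) 𝓘(ℝ, ℂ) (fun x => ∫ t, f t x ∂m) ∧
    ∀ v x, lieDerivFun v (fun x => ∫ t, f t x ∂m) x = ∫ t, CompactLie.lieDeriv v (f t) x ∂m := by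
  let b : Module.Basis (Fin (Module.finrank ℝ E)) ℝ (GroupLieAlgebra 𝓘(ℝ, E) G) :=
    Module.finBasis ℝ E
  obtain ⟨r, hr, K, hK, c, h1, h2, h3, h4⟩ := exists_local_coframe b
  have hmd : ∀ t, MDifferentiable 𝓘(ℝ, E) 𝓘(ℝ, ℂ) (f t) := fun t =>
    (f t).contMDiff.mdifferentiable (by simp)
  choose B hBi hB using fun i => (hf [b i]).2
  have hB' : ∀ i t x, ‖lieDerivFun (b i) (f t) x‖ ≤ B i t := fun i t x => hB i t x
  have hu0 : idCoord E G ∈ Metric.ball (idCoord E G) r := Metric.mem_ball_self hr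
  have h0 := hf []
  obtain ⟨B0, hB0i, hB0⟩ := h0.2
  let F' : G → E → Ω → E →L[ℝ] ℂ := fun x u t => ∑ i, (c i u).smulRight
    (lieDerivFun (b i) (f t) (x * idChartSymm E G u))
  have hmeas : ∀ x, AEStronglyMeasurable (F' x (idCoord E G)) m := fun x => by
    refine Finset.aestronglyMeasurable_fun_sum _ fun i _ => ?_
    have hm := (hf [b i]).1 (x * idChartSymm E G (idCoord E G))
    exact ((ContinuousLinearMap.smulRightL ℝ E ℂ
      (c i (idCoord E G))).continuous).comp_aestronglyMeasurable hm
  have hbound : ∀ x t, ∀ u ∈ Metric.ball (idCoord E G) r, ‖F' x u t‖ ≤ ∑ i, K * B i t := by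
    intro x t u hu
    refine (norm_sum_le _ _).trans (Finset.sum_le_sum fun i _ => ?_)
    rw [ContinuousLinearMap.norm_smulRight_apply]
    exact mul_le_mul (h3 i u hu) (hB' _ _ _) (norm_nonneg _) hK.le
  have hbi : Integrable (fun t => ∑ i, K * B i t) m :=
    integrable_finsetSum _ fun i _ => (hBi i).const_mul K
  have hmain : ∀ x, HasFDerivAt (fun u => ∫ t, f t (x * idChartSymm E G u) ∂m)
      (∫ t, F' x (idCoord E G) t ∂m) (idCoord E G) := by
    intro x
    refine hasFDerivAt_integral_of_dominated_of_fderiv_le (F' := F' x)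
      (bound := fun t => ∑ i, K * B i t) (s := Metric.ball (idCoord E G) r)
      (Metric.ball_mem_nhds _ hr) (.of_forall fun u => h0.1 _) ?_ (hmeas x)
      (.of_forall fun t u hu => hbound x t u hu) hbi
      (.of_forall fun t u hu => h4 (f t) (hmd t) x u hu)
    exact Integrable.mono' hB0i (h0.1 _) (.of_forall fun t => hB0 t _)
  have hdiff : MDifferentiable 𝓘(ℝ, E) 𝓘(ℝ, ℂ) (fun x => ∫ t, f t x ∂m) := fun x =>
    mdifferentiableAt_of_comp_idChartSymm (E := E) (hmain x).differentiableAt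
  refine ⟨hdiff, fun v x => ?_⟩
  rw [lieDerivFun_eq_fderiv v (hdiff x), (hmain x).fderiv]
  have hInt : Integrable (F' x (idCoord E G)) m :=
    hbi.mono' (hmeas x) (.of_forall fun t => hbound x t _ hu0)
  refine (ContinuousLinearMap.integral_apply hInt (v : E)).trans ?_
  refine integral_congr_ae (.of_forall fun t => ?_)
  have := lieDerivFun_eq_fderiv v (hmd t x)
  rw [(h4 (f t) (hmd t) x _ hu0).fderiv] at this
  exact this.symm

/-- Differentiation under the integral sign for dominated families of smooth functions. -/
theorem IsDominated.contMDiff_integral [FiniteDimensional ℝ E] {Ω : Type*} [MeasurableSpace Ω]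
    {m : Measure Ω} {f : Ω → SmoothFn E G} (hf : IsDominated m f) :
    ContMDiff 𝓘(ℝ, E) 𝓘(ℝ, ℂ) ∞ (fun x => ∫ t, f t x ∂m) := by
  rw [contMDiff_infty]
  intro k
  -- The family must vary: the derivatives of the integral are integrals of another dominated
  -- family.
  induction k generalizing f with
  | zero =>
    exact contMDiff_zero_iff.2 hf.lieDerivFun_integral.1.continuous
  | succ k ih =>
    refine contMDiff_succ_of_lieDerivFun hf.lieDerivFun_integral.1 fun v => ?_
    have h := ih (hf.lieDeriv v)
    exact h.congr fun x => hf.lieDerivFun_integral.2 v x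

/-- The integral of a dominated family of smooth functions. -/
def IsDominated.integral [FiniteDimensional ℝ E] {Ω : Type*} [MeasurableSpace Ω]
    {m : Measure Ω} {f : Ω → SmoothFn E G} (hf : IsDominated m f) : SmoothFn E G :=
  ⟨fun x => ∫ t, f t x ∂m, hf.contMDiff_integral⟩

theorem IsDominated.foldr_lieDeriv_integral [FiniteDimensional ℝ E] {Ω : Type*}
    [MeasurableSpace Ω] {m : Measure Ω} {f : Ω → SmoothFn E G} (hf : IsDominated m f)
    (w : List (GroupLieAlgebra 𝓘(ℝ, E) G)) (x : G) :
    (w.foldr CompactLie.lieDeriv hf.integral) x = ∫ t, (w.foldr CompactLie.lieDeriv (f t)) x ∂m := by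
  induction w using List.reverseRecOn generalizing f with
  | nil => rfl
  | append_singleton w v ih =>
    simp only [List.foldr_append, List.foldr_cons, List.foldr_nil]
    rw [← ih (hf.lieDeriv v)]
    congr 2
    ext y
    exact hf.lieDerivFun_integral.2 v y

end Families

/-! ### Calculus of left-invariant fields on smooth functions and integration by parts. -/

section Calculus

open Set Filter Topology MeasureTheory

variable {E : Type*} [NormedAddCommGroup E] [NormedSpace ℝ E]
  {G : Type*} [TopologicalSpace G] [ChartedSpace E G] [Group G] [LieGroup 𝓘(ℝ, E) ∞ G]

theorem SmoothFn.mdifferentiable (f : SmoothFn E G) : MDifferentiable 𝓘(ℝ, E) 𝓘(ℝ, ℂ) f :=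
  f.contMDiff.mdifferentiable (by simp)

theorem SmoothFn.continuous (f : SmoothFn E G) : Continuous f := f.contMDiff.continuous

theorem lieDeriv_apply (v : GroupLieAlgebra 𝓘(ℝ, E) G) (f : SmoothFn E G) (x : G) :
    lieDeriv v f x = lieDerivFun v f x := rfl

theorem lieDeriv_eq_fderiv (v : GroupLieAlgebra 𝓘(ℝ, E) G) (f : SmoothFn E G) (x : G) :
    lieDeriv v f x =
      fderiv ℝ (fun z : E => f (x * idChartSymm E G z)) (idCoord E G) (v : E) :=
  lieDerivFun_eq_fderiv v (f.mdifferentiable x)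

theorem SmoothFn.differentiableAt_chart (f : SmoothFn E G) (x : G) :
    DifferentiableAt ℝ (fun u => f (x * idChartSymm E G u)) (idCoord E G) :=
  differentiableAt_comp_idChartSymm f.mdifferentiable x idCoord_mem_target

theorem smoothFn_smul_apply (c : ℂ) (f : SmoothFn E G) (x : G) : (c • f) x = c * f x := rfl

theorem lieDeriv_smul (v : GroupLieAlgebra 𝓘(ℝ, E) G) (c : ℂ) (f : SmoothFn E G) :
    lieDeriv v (c • f) = c • lieDeriv v f := by
  ext x
  rw [smoothFn_smul_apply, lieDeriv_eq_fderiv, lieDeriv_eq_fderiv]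
  have h : HasFDerivAt (fun u => (c • f) (x * idChartSymm E G u))
      (c • fderiv ℝ (fun u => f (x * idChartSymm E G u)) (idCoord E G)) (idCoord E G) :=
    (f.differentiableAt_chart x).hasFDerivAt.const_smul c
  rw [h.fderiv]
  rfl

theorem lieDeriv_add (v : GroupLieAlgebra 𝓘(ℝ, E) G) (f g : SmoothFn E G) :
    lieDeriv v (f + g) = lieDeriv v f + lieDeriv v g := by
  ext x
  rw [ContMDiffMap.coe_add, Pi.add_apply, lieDeriv_eq_fderiv, lieDeriv_eq_fderiv,
    lieDeriv_eq_fderiv]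
  have h : HasFDerivAt (fun u => (f + g) (x * idChartSymm E G u))
      (fderiv ℝ (fun u => f (x * idChartSymm E G u)) (idCoord E G) +
        fderiv ℝ (fun u => g (x * idChartSymm E G u)) (idCoord E G)) (idCoord E G) :=
    (f.differentiableAt_chart x).hasFDerivAt.add (g.differentiableAt_chart x).hasFDerivAt
  rw [h.fderiv]
  rfl

/-- Derivation along a left-invariant vector field as a linear map. -/
def lieDerivLin (v : GroupLieAlgebra 𝓘(ℝ, E) G) : SmoothFn E G →ₗ[ℂ] SmoothFn E G where
  toFun := lieDeriv v
  map_add' := lieDeriv_add v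
  map_smul' := lieDeriv_smul v

/-- An iterated derivative along left-invariant vector fields as a linear map. -/
def lieDerivWord (w : List (GroupLieAlgebra 𝓘(ℝ, E) G)) : SmoothFn E G →ₗ[ℂ] SmoothFn E G where
  toFun f := w.foldr lieDeriv f
  map_add' f g := by
    induction w with
    | nil => rfl
    | cons v w ih => simp only [List.foldr_cons, ih, lieDeriv_add]
  map_smul' c f := by
    induction w with
    | nil => rfl
    | cons v w ih => simp only [List.foldr_cons, ih, lieDeriv_smul, RingHom.id_apply]

theorem lieDerivWord_apply (w : List (GroupLieAlgebra 𝓘(ℝ, E) G)) (f : SmoothFn E G) :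
    lieDerivWord w f = w.foldr lieDeriv f := rfl

/-- The product of two smooth functions. -/
def mulFn (f g : SmoothFn E G) : SmoothFn E G :=
  ⟨fun x => f x * g x, ((contDiff_mul (𝕜 := ℝ) (𝔸 := ℂ)).contMDiff (n := ∞)).comp
    (f.contMDiff.prodMk_space g.contMDiff)⟩

theorem mulFn_apply (f g : SmoothFn E G) (x : G) : mulFn f g x = f x * g x := rfl

theorem lieDeriv_mulFn (v : GroupLieAlgebra 𝓘(ℝ, E) G) (f g : SmoothFn E G) (x : G) :
    lieDeriv v (mulFn f g) x = f x * lieDeriv v g x + lieDeriv v f x * g x := by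
  rw [lieDeriv_eq_fderiv, lieDeriv_eq_fderiv, lieDeriv_eq_fderiv]
  have h := (f.differentiableAt_chart x).hasFDerivAt.mul (g.differentiableAt_chart x).hasFDerivAt
  have h' : HasFDerivAt (fun u => mulFn f g (x * idChartSymm E G u)) _ (idCoord E G) := h
  rw [h'.fderiv]
  simp only [idChartSymm_idCoord, mul_one]
  refine (_root_.add_apply _ _ (v : E)).trans ?_
  refine congrArg₂ (· + ·) rfl ?_
  exact mul_comm _ _

/-- The complex conjugate of a smooth function. -/
def conjFn (f : SmoothFn E G) : SmoothFn E G :=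
  ⟨fun x => conj (f x), (Complex.conjCLE.toContinuousLinearMap.contMDiff (n := ∞)).comp
    f.contMDiff⟩

theorem conjFn_apply (f : SmoothFn E G) (x : G) : conjFn f x = conj (f x) := rfl

theorem lieDeriv_conjFn (v : GroupLieAlgebra 𝓘(ℝ, E) G) (f : SmoothFn E G) :
    lieDeriv v (conjFn f) = conjFn (lieDeriv v f) := by
  ext x
  rw [conjFn_apply, lieDeriv_eq_fderiv, lieDeriv_eq_fderiv]
  have h : HasFDerivAt (fun u => conjFn f (x * idChartSymm E G u)) _ (idCoord E G) :=
    Complex.conjCLE.toContinuousLinearMap.hasFDerivAt.comp (idCoord E G)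
      (f.differentiableAt_chart x).hasFDerivAt
  rw [h.fderiv]
  rfl

theorem translate_apply (h : G) (f : SmoothFn E G) (x : G) : translate h f x = f (h * x) := rfl

theorem lieDeriv_translate (v : GroupLieAlgebra 𝓘(ℝ, E) G) (h : G) (f : SmoothFn E G) :
    lieDeriv v (translate h f) = translate h (lieDeriv v f) := by
  ext x
  rw [translate_apply, lieDeriv_eq_fderiv, lieDeriv_eq_fderiv]
  simp only [translate_apply, mul_assoc]

theorem foldr_lieDeriv_translate (w : List (GroupLieAlgebra 𝓘(ℝ, E) G)) (h : G)
    (f : SmoothFn E G) : w.foldr lieDeriv (translate h f) = translate h (w.foldr lieDeriv f) := by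
  induction w with
  | nil => rfl
  | cons v w ih => simp only [List.foldr_cons, ih, lieDeriv_translate]

theorem lieDerivFun_const (v : GroupLieAlgebra 𝓘(ℝ, E) G) (c : ℂ) (x : G) :
    lieDerivFun v (fun _ => c) x = 0 := by
  rw [lieDerivFun_eq_fderiv v mdifferentiableAt_const]
  simp only [fderiv_fun_const]
  rfl

variable [CompactSpace G] [MeasurableSpace G] [BorelSpace G]

theorem exists_norm_le {f : G → ℂ} (hf : Continuous f) :
    ∃ C, 0 ≤ C ∧ ∀ x, ‖f x‖ ≤ C := by
  obtain ⟨C, hC⟩ := isCompact_univ.exists_bound_of_continuousOn hf.continuousOn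
  exact ⟨max C 0, le_max_right _ _, fun x => (hC x (mem_univ _)).trans (le_max_left _ _)⟩

theorem integrable_of_continuous (μ : Measure G) [IsFiniteMeasure μ] {f : G → ℂ}
    (hf : Continuous f) : Integrable f μ :=
  hf.integrable_of_hasCompactSupport (HasCompactSupport.of_compactSpace f)

/-- Compact groups are unimodular: a right translate of the Haar probability measure is again one,
and such a measure is unique. -/
theorem isMulRightInvariant [IsTopologicalGroup G] (μ : Measure G) [μ.IsHaarMeasure]
    [IsProbabilityMeasure μ] : μ.IsMulRightInvariant where
  map_mul_right_eq_self g := by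
    have : IsProbabilityMeasure (μ.map (· * g)) :=
      Measure.isProbabilityMeasure_map (measurable_mul_const g).aemeasurable
    exact Measure.isHaarMeasure_eq_of_isProbabilityMeasure _ _

/-- Left-invariant fields commute with left translations, so every derivative of the family is a
translate of a fixed continuous function, bounded by compactness. This makes convolutions smooth. -/
theorem isDominated_translate (μ : Measure G) [IsFiniteMeasure μ] {K : G → ℂ} (hK : Continuous K)
    (f : SmoothFn E G) : IsDominated μ (fun y => K y • translate y f) := by
  have : IsTopologicalGroup G := topologicalGroup_of_lieGroup 𝓘(ℝ, E) ∞
  intro w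
  have hw : ∀ y x, (w.foldr lieDeriv (K y • translate y f)) x =
      K y * (w.foldr lieDeriv f) (y * x) := by
    intro y x
    rw [← lieDerivWord_apply, map_smul, lieDerivWord_apply, foldr_lieDeriv_translate]
    rfl
  have hc := (w.foldr lieDeriv f).continuous
  refine ⟨fun x => ?_, ?_⟩
  · simp only [hw]
    exact (integrable_of_continuous μ
      (hK.mul (hc.comp (continuous_id.mul continuous_const)))).aestronglyMeasurable
  · obtain ⟨C, hC0, hC⟩ := exists_norm_le hc
    obtain ⟨D, hD0, hD⟩ := exists_norm_le hK
    refine ⟨fun _ => D * C, integrable_const _, fun y x => ?_⟩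
    rw [hw, norm_mul]
    exact mul_le_mul (hD y) (hC _) (norm_nonneg _) hD0

/-- By right invariance the function `x ↦ ∫ f (y * x) dy` is constant. Differentiating it at the
identity under the integral sign gives the claim. -/
theorem integral_lieDeriv (μ : Measure G) [μ.IsHaarMeasure] [IsProbabilityMeasure μ]
    [FiniteDimensional ℝ E]
    (v : GroupLieAlgebra 𝓘(ℝ, E) G) (f : SmoothFn E G) : ∫ x, lieDeriv v f x ∂μ = 0 := by
  have : IsTopologicalGroup G := topologicalGroup_of_lieGroup 𝓘(ℝ, E) ∞
  have := isMulRightInvariant μ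
  have hd := isDominated_translate μ (K := fun _ => 1) continuous_const f
  have h := hd.lieDerivFun_integral.2 v 1
  have hconst : (fun x => ∫ y, ((1 : ℂ) • translate y f) x ∂μ) = fun _ => ∫ y, f y ∂μ := by
    ext x
    simp only [one_smul, translate_apply]
    exact integral_mul_right_eq_self f x
  rw [hconst, lieDerivFun_const] at h
  rw [h]
  refine integral_congr_ae (.of_forall fun y => ?_)
  simp only [one_smul, lieDeriv_translate, translate_apply, mul_one]

/-- Integration by parts along a left-invariant vector field. -/
theorem integral_lieDeriv_mul (μ : Measure G) [μ.IsHaarMeasure] [IsProbabilityMeasure μ]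
    [FiniteDimensional ℝ E] (v : GroupLieAlgebra 𝓘(ℝ, E) G) (f g : SmoothFn E G) :
    ∫ x, lieDeriv v f x * g x ∂μ = -∫ x, f x * lieDeriv v g x ∂μ := by
  have h := integral_lieDeriv μ v (mulFn f g)
  simp only [lieDeriv_mulFn] at h
  have h' := integral_add
    (integrable_of_continuous μ (f.continuous.mul (lieDeriv v g).continuous))
    (integrable_of_continuous μ ((lieDeriv v f).continuous.mul g.continuous))
  exact eq_neg_of_add_eq_zero_right (h'.symm.trans h)

end Calculus

/-! ### Smoothness of the coefficients of representations. -/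

section IrrepSmooth

open Set Filter Topology MeasureTheory

variable {G : Type*} [TopologicalSpace G] [Group G]

theorem Irrep.continuous_mat (ξ : Irrep G) : Continuous ξ.mat :=
  continuous_subtype_val.comp ξ.continuous_hom

theorem Irrep.continuous_entry (ξ : Irrep G) (i j) : Continuous fun x => ξ.mat x i j :=
  ξ.continuous_mat.matrix_elem i j

theorem Irrep.mat_one (ξ : Irrep G) : ξ.mat 1 = 1 := by simp [Irrep.mat]

theorem Irrep.mat_mul (ξ : Irrep G) (x y : G) : ξ.mat (x * y) = ξ.mat x * ξ.mat y := by
  simp [Irrep.mat]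

theorem Irrep.mat_inv (ξ : Irrep G) (x : G) : ξ.mat x⁻¹ = (ξ.mat x).conjTranspose := by
  simp [Irrep.mat, Matrix.star_eq_conjTranspose]

theorem Irrep.conjTranspose_mul_mat (ξ : Irrep G) (x : G) :
    (ξ.mat x).conjTranspose * ξ.mat x = 1 := by
  rw [← ξ.mat_inv, ← ξ.mat_mul, inv_mul_cancel, ξ.mat_one]

theorem Irrep.norm_entry_le_one (ξ : Irrep G) (x : G) (i j) : ‖ξ.mat x i j‖ ≤ 1 :=
  entry_norm_bound_of_unitary (ξ.hom x).2 i j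

variable {E : Type*} [NormedAddCommGroup E] [NormedSpace ℝ E] [ChartedSpace E G]
  [LieGroup 𝓘(ℝ, E) ∞ G] [CompactSpace G] [T2Space G] [MeasurableSpace G] [BorelSpace G]
  [FiniteDimensional ℝ E]

/-- The substitution `y ↦ y * x⁻¹` gives `ξ(x) f̂(ξ) = ∫ f(y x) ξ(y)^* dy`. All derivatives in `x`
fall on `f`, and only continuity of `ξ` is needed. -/
theorem contMDiff_mat_mul_fourierCoeff (μ : Measure G) [μ.IsHaarMeasure] [IsProbabilityMeasure μ]
    (ξ : Irrep G) (f : SmoothFn E G) (i j) :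
    ContMDiff 𝓘(ℝ, E) 𝓘(ℝ, ℂ) ∞ fun x => (ξ.mat x * fourierCoeff μ f ξ) i j := by
  have : IsTopologicalGroup G := topologicalGroup_of_lieGroup 𝓘(ℝ, E) ∞
  have := isMulRightInvariant μ
  have hK : Continuous fun y => (ξ.mat y).conjTranspose i j :=
    (ξ.continuous_entry j i).star
  refine (isDominated_translate μ hK f).contMDiff_integral.congr fun x => ?_
  simp only [smoothFn_smul_apply, translate_apply, Matrix.mul_apply, fourierCoeff, Matrix.of_apply]
  rw [← integral_mul_right_eq_self _ x⁻¹]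
  simp only [inv_mul_cancel_right, ← integral_const_mul]
  have hInt : ∀ k ∈ Finset.univ, Integrable
      (fun a => ξ.mat x i k * (f a * (ξ.mat a).conjTranspose k j)) μ := fun k _ =>
    integrable_of_continuous μ
      (continuous_const.mul (f.continuous.mul (ξ.continuous_entry j k).star))
  refine (integral_finsetSum _ hInt).symm.trans ?_
  refine integral_congr_ae (.of_forall fun y => ?_)
  have : (ξ.mat (y * x⁻¹)).conjTranspose = ξ.mat x * (ξ.mat y).conjTranspose := by
    rw [ξ.mat_mul, Matrix.conjTranspose_mul, ← ξ.mat_inv, inv_inv]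
  simp only [this, Matrix.mul_apply, Finset.sum_mul]
  exact Finset.sum_congr rfl fun k _ => by ring

/-- A normalized bump function supported near the identity has a Fourier coefficient close to the
unit matrix, and a nonzero determinant is an open condition. -/
theorem exists_isUnit_det_fourierCoeff (μ : Measure G) [μ.IsHaarMeasure] [IsProbabilityMeasure μ]
    (ξ : Irrep G) : ∃ f : SmoothFn E G, IsUnit (fourierCoeff μ f ξ).det := by
  have : IsTopologicalGroup G := topologicalGroup_of_lieGroup 𝓘(ℝ, E) ∞
  have hopen : IsOpen {A : Fin ξ.dim → Fin ξ.dim → ℂ | (Matrix.of A).det ≠ 0} :=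
    isOpen_ne_fun (Continuous.matrix_det (continuous_id)) continuous_const
  have hone : (fun i j => if i = j then (1 : ℂ) else 0) ∈
      {A : Fin ξ.dim → Fin ξ.dim → ℂ | (Matrix.of A).det ≠ 0} := by
    have : (Matrix.of fun i j => if i = j then (1 : ℂ) else 0) =
      (1 : Matrix (Fin ξ.dim) (Fin ξ.dim) ℂ) := by ext i j; simp [Matrix.one_apply]
    simp [this]
  obtain ⟨ε, hε, hball⟩ := Metric.isOpen_iff.1 hopen _ hone
  have hnear : ∀ᶠ x in 𝓝 (1 : G), ∀ i j,
      ‖(ξ.mat x).conjTranspose i j - (if i = j then 1 else 0)‖ < ε / 2 := by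
    refine eventually_all.2 fun i => eventually_all.2 fun j => ?_
    have hc : Continuous fun x => ‖(ξ.mat x).conjTranspose i j - (if i = j then 1 else 0)‖ :=
      (((ξ.continuous_entry j i).star).sub continuous_const).norm
    refine hc.continuousAt.eventually_lt continuousAt_const ?_
    simp [ξ.mat_one, Matrix.one_apply, eq_comm (a := j), hε]
  obtain ⟨φ, -, hφ⟩ := (SmoothBumpFunction.nhds_basis_support (I := 𝓘(ℝ, E)) hnear).mem_iff.1
    hnear
  let f : SmoothFn E G := ⟨fun x => (φ x : ℂ),
    (Complex.ofRealCLM.contMDiff (n := ∞)).comp φ.contMDiff⟩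
  have hpos : 0 < ∫ x, φ x ∂μ :=
    φ.continuous.integral_pos_of_hasCompactSupport_nonneg_nonzero φ.hasCompactSupport
      (fun x => φ.nonneg) (x := 1) (by simp)
  set c : ℝ := ∫ x, φ x ∂μ
  have hφi : Integrable (fun x => φ x) μ :=
    φ.continuous.integrable_of_hasCompactSupport φ.hasCompactSupport
  have hkey : (fun i j => (c : ℂ)⁻¹ * fourierCoeff μ f ξ i j) ∈
      {A : Fin ξ.dim → Fin ξ.dim → ℂ | (Matrix.of A).det ≠ 0} := by
    apply hball
    refine (dist_pi_lt_iff hε).2 fun i => (dist_pi_lt_iff hε).2 fun j => ?_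
    rw [dist_eq_norm]
    have h1 : (c : ℂ)⁻¹ * fourierCoeff μ f ξ i j - (if i = j then 1 else 0) =
        (c : ℂ)⁻¹ * ∫ x, (φ x : ℂ) * ((ξ.mat x).conjTranspose i j - (if i = j then 1 else 0)) ∂μ := by
      have hc : (c : ℂ) ≠ 0 := by exact_mod_cast hpos.ne'
      have h2 : ∫ x, (φ x : ℂ) * ((ξ.mat x).conjTranspose i j - (if i = j then 1 else 0)) ∂μ =
          fourierCoeff μ f ξ i j - c * (if i = j then 1 else 0) := by
        simp only [mul_sub]
        rw [integral_sub, integral_mul_const, integral_complex_ofReal]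
        · rfl
        · exact integrable_of_continuous μ
            (f.continuous.mul (ξ.continuous_entry j i).star)
        · exact integrable_of_continuous μ (f.continuous.mul continuous_const)
      rw [h2]; field_simp
    rw [h1, norm_mul, norm_inv, Complex.norm_real, Real.norm_of_nonneg hpos.le]
    have h3 : ‖∫ x, (φ x : ℂ) * ((ξ.mat x).conjTranspose i j - (if i = j then 1 else 0)) ∂μ‖ ≤
        ∫ x, φ x * (ε / 2) ∂μ := by
      refine norm_integral_le_of_norm_le (hφi.mul_const _) (.of_forall fun x => ?_)
      rw [norm_mul, Complex.norm_real, Real.norm_of_nonneg φ.nonneg]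
      by_cases hx : φ x = 0
      · simp [hx]
      · exact mul_le_mul_of_nonneg_left (hφ hx i j).le φ.nonneg
    rw [integral_mul_const] at h3
    calc c⁻¹ * _ ≤ c⁻¹ * (c * (ε / 2)) := by gcongr
      _ = ε / 2 := by field_simp
      _ < ε := by linarith
  refine ⟨f, isUnit_iff_ne_zero.2 fun h0 => hkey ?_⟩
  have : (Matrix.of fun i j => (c : ℂ)⁻¹ * fourierCoeff μ f ξ i j) =
      (c : ℂ)⁻¹ • fourierCoeff μ f ξ := by ext i j; simp
  rw [this, Matrix.det_smul, h0, mul_zero]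

/-- The coefficients of a continuous unitary representation are smooth. -/
theorem Irrep.contMDiff_entry (μ : Measure G) [μ.IsHaarMeasure] [IsProbabilityMeasure μ]
    (ξ : Irrep G) (i j) : ContMDiff 𝓘(ℝ, E) 𝓘(ℝ, ℂ) ∞ fun x => ξ.mat x i j := by
  obtain ⟨f, hf⟩ := exists_isUnit_det_fourierCoeff (E := E) μ ξ
  -- With `f̂(ξ)` invertible, `ξ(x)` is the smooth matrix function `ξ(x) f̂(ξ)` times a constant
  -- matrix.
  have h : ∀ x, ξ.mat x i j = ∑ k, (fourierCoeff μ f ξ)⁻¹ k j • (ξ.mat x * fourierCoeff μ f ξ) i k := by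
    intro x
    conv_lhs => rw [← Matrix.mul_nonsing_inv_cancel_right _ (ξ.mat x) hf]
    rw [Matrix.mul_apply]
    exact Finset.sum_congr rfl fun k _ => mul_comm _ _
  refine ContMDiff.congr ?_ h
  refine contMDiff_finsetSum fun k _ => ?_
  exact ((ContinuousLinearMap.restrictScalars ℝ
      ((fourierCoeff μ f ξ)⁻¹ k j • ContinuousLinearMap.id ℂ ℂ)).contMDiff (n := ∞)).comp
    (contMDiff_mat_mul_fourierCoeff μ ξ f i k)

end IrrepSmooth

/-! ### Schur's lemma and the orthogonality relations. -/

section Schur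

open Set Filter Topology MeasureTheory

variable {G : Type*} [TopologicalSpace G] [Group G]

theorem Irrep.dim_pos (ξ : Irrep G) : 0 < ξ.dim := by
  by_contra h
  have h0 : ξ.dim = 0 := by omega
  have := ξ.irreducible
  obtain ⟨a, b, hab⟩ := exists_pair_ne (Subrepresentation (matrixRep ξ.hom))
  apply hab
  have hs : Subsingleton (Fin ξ.dim → ℂ) := by rw [h0]; infer_instance
  apply Subrepresentation.toSubmodule_injective
  exact Subsingleton.elim _ _

theorem Irrep.dim_ne_zero (ξ : Irrep G) : (ξ.dim : ℂ) ≠ 0 := by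
  exact_mod_cast ξ.dim_pos.ne'

/-- An invariant subspace of an irreducible representation is trivial. -/
theorem Irrep.eq_bot_or_eq_top (ξ : Irrep G) (W : Submodule ℂ (Fin ξ.dim → ℂ))
    (hW : ∀ x, ∀ v ∈ W, (ξ.mat x).mulVec v ∈ W) : W = ⊥ ∨ W = ⊤ := by
  have := ξ.irreducible
  let S : Subrepresentation (matrixRep ξ.hom) :=
    { toSubmodule := W
      apply_mem_toSubmodule := fun x v hv => hW x v hv }
  rcases IsSimpleOrder.eq_bot_or_eq_top S with h | h
  · left; exact congrArg Subrepresentation.toSubmodule h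
  · right; exact congrArg Subrepresentation.toSubmodule h

/-- Schur's lemma: the commutant of an irreducible representation. -/
theorem Irrep.eq_smul_one_of_commute (ξ : Irrep G) (A : Matrix (Fin ξ.dim) (Fin ξ.dim) ℂ)
    (hA : ∀ x, ξ.mat x * A = A * ξ.mat x) : ∃ c : ℂ, A = c • 1 := by
  have : Nonempty (Fin ξ.dim) := ⟨⟨0, ξ.dim_pos⟩⟩
  obtain ⟨c, hc⟩ := Module.End.exists_eigenvalue (Matrix.toLin' A)
  refine ⟨c, ?_⟩
  rcases ξ.eq_bot_or_eq_top (Module.End.eigenspace (Matrix.toLin' A) c) (fun x v hv => by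
    rw [Module.End.mem_eigenspace_iff, Matrix.toLin'_apply] at hv ⊢
    rw [Matrix.mulVec_mulVec, ← hA, ← Matrix.mulVec_mulVec, hv, Matrix.mulVec_smul]) with h | h
  · exact absurd h hc
  · have h2 : ∀ v, A.mulVec v = c • v := fun v => by
      have : v ∈ Module.End.eigenspace (Matrix.toLin' A) c := h ▸ Submodule.mem_top
      rwa [Module.End.mem_eigenspace_iff, Matrix.toLin'_apply] at this
    apply Matrix.toLin'.injective
    ext1 v
    ext1
    simp [h2]

/-- Schur's lemma: intertwiners of inequivalent irreducible representations vanish. -/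
theorem Irrep.eq_zero_of_intertwine {ξ η : Irrep G} (hne : ¬ ξ.Equivalent η)
    (A : Matrix (Fin ξ.dim) (Fin η.dim) ℂ) (hA : ∀ x, ξ.mat x * A = A * η.mat x) : A = 0 := by
  by_contra hA0
  have hA' : ∀ x, η.mat x * A.conjTranspose = A.conjTranspose * ξ.mat x := by
    intro x
    have h := congrArg Matrix.conjTranspose (hA x⁻¹)
    rw [Matrix.conjTranspose_mul, Matrix.conjTranspose_mul, ← ξ.mat_inv, ← η.mat_inv,
      inv_inv] at h
    exact h.symm
  obtain ⟨c, hc⟩ := ξ.eq_smul_one_of_commute (A * A.conjTranspose) fun x => by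
    rw [← Matrix.mul_assoc, hA, Matrix.mul_assoc, hA', Matrix.mul_assoc]
  obtain ⟨c', hc'⟩ := η.eq_smul_one_of_commute (A.conjTranspose * A) fun x => by
    rw [← Matrix.mul_assoc, hA', Matrix.mul_assoc, hA, Matrix.mul_assoc]
  have hcc : c = c' := by
    have h : c • A = c' • A := by
      have := Matrix.mul_assoc A A.conjTranspose A
      rw [hc, hc'] at this
      simpa using this
    exact smul_left_injective ℂ hA0 h
  have hr : ∃ r : ℝ, 0 ≤ r ∧ c = r := by
    let i : Fin ξ.dim := ⟨0, ξ.dim_pos⟩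
    refine ⟨∑ j, ‖A i j‖ ^ 2, by positivity, ?_⟩
    have := congrFun (congrFun hc i) i
    simp only [Matrix.mul_apply, Matrix.conjTranspose_apply, Matrix.smul_apply, Matrix.one_apply_eq,
      smul_eq_mul, mul_one] at this
    rw [← this]
    push_cast
    refine Finset.sum_congr rfl fun j _ => ?_
    exact Complex.mul_conj' _
  obtain ⟨r, hr0, hcr⟩ := hr
  have hrpos : 0 < r := by
    refine lt_of_le_of_ne hr0 fun h => hA0 ?_
    rw [hcr, ← h] at hc
    open scoped ComplexOrder in
    exact Matrix.self_mul_conjTranspose_eq_zero.1 (by simpa using hc)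
  -- `A A^*` and `A^* A` are the same positive scalar `r`, so `A` divided by `√r` is a unitary
  -- intertwiner, which contradicts inequivalence.
  let s : ℂ := ((√r)⁻¹ : ℝ)
  have hss : s * s * r = 1 := by
    simp only [s]
    have h1 : √r * √r = r := Real.mul_self_sqrt hr0
    have h2 : √r ≠ 0 := (Real.sqrt_pos.2 hrpos).ne'
    have h3 : (√r)⁻¹ * (√r)⁻¹ * r = 1 := by
      nth_rewrite 3 [← h1]
      field_simp
    exact_mod_cast h3
  have hst : star s = s := Complex.conj_ofReal _
  apply hne
  refine ⟨s • A, ?_, ?_, fun x => ?_⟩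
  · rw [Matrix.conjTranspose_smul, hst, Matrix.smul_mul, Matrix.mul_smul, hc, smul_smul, smul_smul,
      hcr, hss, one_smul]
  · rw [Matrix.conjTranspose_smul, hst, Matrix.smul_mul, Matrix.mul_smul, hc', smul_smul, smul_smul,
      ← hcc, hcr, hss, one_smul]
  · rw [Matrix.mul_smul, hA, Matrix.smul_mul]

variable [IsTopologicalGroup G] [CompactSpace G] [MeasurableSpace G] [BorelSpace G]
  (μ : Measure G) [μ.IsHaarMeasure] [IsProbabilityMeasure μ]

/-- The average of `ξ(x) B η(x)^*`. -/
def avgMatrix (ξ η : Irrep G) (B : Matrix (Fin ξ.dim) (Fin η.dim) ℂ) :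
    Matrix (Fin ξ.dim) (Fin η.dim) ℂ :=
  Matrix.of fun i k => ∫ x, (ξ.mat x * B * (η.mat x).conjTranspose) i k ∂μ

theorem mul_of_integral_mul {p q : ℕ} {M : G → Matrix (Fin p) (Fin q) ℂ} (hM : Continuous M)
    (A : Matrix (Fin p) (Fin p) ℂ) (B : Matrix (Fin q) (Fin q) ℂ) (i k) :
    (A * (Matrix.of fun i k => ∫ x, M x i k ∂μ) * B) i k = ∫ x, (A * M x * B) i k ∂μ := by
  have hInt : ∀ j l, Integrable (fun x => A i j * M x j l * B l k) μ := fun j l =>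
    integrable_of_continuous μ ((continuous_const.mul (hM.matrix_elem j l)).mul continuous_const)
  simp only [Matrix.mul_apply, Matrix.of_apply, Finset.sum_mul]
  rw [integral_finsetSum _ fun l _ => integrable_finsetSum _ fun j _ => hInt j l]
  refine Finset.sum_congr rfl fun l _ => ?_
  rw [integral_finsetSum _ fun j _ => hInt j l]
  refine Finset.sum_congr rfl fun j _ => ?_
  rw [integral_mul_const, integral_const_mul]

/-- Conjugating the average by `y` replaces `x` by `y * x` in the integrand, which left invariance
absorbs. -/
theorem avgMatrix_intertwine (ξ η : Irrep G) (B : Matrix (Fin ξ.dim) (Fin η.dim) ℂ) (y : G) :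
    ξ.mat y * avgMatrix μ ξ η B = avgMatrix μ ξ η B * η.mat y := by
  have h : ξ.mat y * avgMatrix μ ξ η B * (η.mat y).conjTranspose = avgMatrix μ ξ η B := by
    ext i k
    rw [avgMatrix, mul_of_integral_mul μ
      ((ξ.continuous_mat.matrix_mul continuous_const).matrix_mul
        η.continuous_mat.matrix_conjTranspose)]
    have h2 : ∀ x, ξ.mat y * (ξ.mat x * B * (η.mat x).conjTranspose) * (η.mat y).conjTranspose =
        ξ.mat (y * x) * B * (η.mat (y * x)).conjTranspose := by
      intro x
      rw [ξ.mat_mul, η.mat_mul, Matrix.conjTranspose_mul]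
      simp only [Matrix.mul_assoc]
    simp only [h2]
    exact integral_mul_left_eq_self
      (fun x => (ξ.mat x * B * (η.mat x).conjTranspose) i k) y
  calc ξ.mat y * avgMatrix μ ξ η B
      = ξ.mat y * avgMatrix μ ξ η B * ((η.mat y).conjTranspose * η.mat y) := by
        rw [η.conjTranspose_mul_mat, Matrix.mul_one]
    _ = avgMatrix μ ξ η B * η.mat y := by rw [← Matrix.mul_assoc, h]

theorem avgMatrix_single (ξ η : Irrep G) (i j k l) :
    avgMatrix μ ξ η (Matrix.single j l 1) i k = ∫ x, ξ.mat x i j * conj (η.mat x k l) ∂μ := by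
  simp only [avgMatrix, Matrix.of_apply]
  refine integral_congr_ae (.of_forall fun x => ?_)
  simp only [Matrix.mul_apply, Matrix.single_apply, Matrix.conjTranspose_apply]
  rw [Finset.sum_eq_single l, Finset.sum_eq_single j]
  · simp
  · intro b _ hb; simp [hb.symm]
  · simp
  · intro b _ hb
    rw [Finset.sum_eq_zero, zero_mul]
    intro c _; simp [hb.symm]
  · simp

/-- Schur orthogonality for inequivalent representations. -/
theorem integral_entry_mul_conj_of_not_equivalent {ξ η : Irrep G} (hne : ¬ ξ.Equivalent η)
    (i j k l) : ∫ x, ξ.mat x i j * conj (η.mat x k l) ∂μ = 0 := by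
  rw [← avgMatrix_single, Irrep.eq_zero_of_intertwine hne _ (avgMatrix_intertwine μ ξ η _)]
  rfl

/-- Schur orthogonality for the coefficients of one representation. -/
theorem integral_entry_mul_conj_self (ξ : Irrep G) (i j k l) :
    ∫ x, ξ.mat x i j * conj (ξ.mat x k l) ∂μ = if i = k ∧ j = l then (ξ.dim : ℂ)⁻¹ else 0 := by
  obtain ⟨c, hc⟩ := ξ.eq_smul_one_of_commute _
    (avgMatrix_intertwine μ ξ ξ (Matrix.single j l 1))
  have hik : ∀ i k, ∫ x, ξ.mat x i j * conj (ξ.mat x k l) ∂μ = if i = k then c else 0 := by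
    intro i k
    rw [← avgMatrix_single, hc, Matrix.smul_apply, Matrix.one_apply]
    simp
  -- The scalar `c` is found from a trace: summing over `i = k` gives `d c` on one side and, by
  -- unitarity of `ξ(x)`, the entry `δ_{jl}` on the other.
  have htr : ∑ i, ∫ x, ξ.mat x i j * conj (ξ.mat x i l) ∂μ = if j = l then 1 else 0 := by
    rw [← integral_finsetSum]
    · have : ∀ x, ∑ i, ξ.mat x i j * conj (ξ.mat x i l) = if j = l then 1 else 0 := by
        intro x
        have := congrFun (congrFun (ξ.conjTranspose_mul_mat x) l) j
        rw [Matrix.mul_apply, Matrix.one_apply] at this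
        simp only [eq_comm (a := j), ← this, Matrix.conjTranspose_apply]
        exact Finset.sum_congr rfl fun i _ => mul_comm _ _
      simp [this]
    · exact fun i _ => integrable_of_continuous μ
        ((ξ.continuous_entry i j).mul (ξ.continuous_entry i l).star)
  simp only [hik, if_true, Finset.sum_const, Finset.card_univ, Fintype.card_fin,
    nsmul_eq_mul] at htr
  rw [hik]
  have hd := ξ.dim_ne_zero
  by_cases h1 : i = k <;> by_cases h2 : j = l <;> simp only [h1, h2, and_true, and_false, if_true,
    if_false] at htr ⊢
  · field_simp; linear_combination htr
  · rcases mul_eq_zero.1 htr with h | h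
    · exact absurd h hd
    · exact h

end Schur

/-! ### The Peter–Weyl theorem by compact convolution operators. -/

section PeterWeyl

open Set Filter Topology MeasureTheory

/-- The operator sending a vector `f` of a Hilbert space to the continuous function
`x ↦ ⟪κ x, f⟫`. -/
def kernelMap {X H : Type*} [TopologicalSpace X] [CompactSpace X] [NormedAddCommGroup H]
    [InnerProductSpace ℂ H] (κ : C(X, H)) : H →L[ℂ] C(X, ℂ) :=
  LinearMap.mkContinuous
    { toFun := fun f => ⟨fun x => inner ℂ (κ x) f, κ.continuous.inner continuous_const⟩
      map_add' := fun f g => by ext x; exact inner_add_right _ _ _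
      map_smul' := fun c f => by ext x; exact inner_smul_right _ _ _ }
    ‖κ‖ fun f => by
      refine (ContinuousMap.norm_le _ (by positivity)).2 fun x => ?_
      refine (norm_inner_le_norm _ _).trans ?_
      gcongr
      exact κ.norm_coe_le_norm x

theorem kernelMap_apply {X H : Type*} [TopologicalSpace X] [CompactSpace X] [NormedAddCommGroup H]
    [InnerProductSpace ℂ H] (κ : C(X, H)) (f : H) (x : X) :
    kernelMap κ f x = inner ℂ (κ x) f := rfl

/-- Arzelà–Ascoli: the image of the unit ball is bounded by `‖κ‖` and equicontinuous with modulus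
`‖κ x - κ y‖`. -/
theorem isCompactOperator_kernelMap {X H : Type*} [TopologicalSpace X] [CompactSpace X]
    [NormedAddCommGroup H] [InnerProductSpace ℂ H] (κ : C(X, H)) :
    IsCompactOperator (kernelMap κ) := by
  let e := ContinuousMap.linearIsometryBoundedOfCompact X ℂ ℂ
  let A : Set (BoundedContinuousFunction X ℂ) := (fun f => e (kernelMap κ f)) '' Metric.ball 0 1
  have hA : IsCompact (closure A) := by
    refine BoundedContinuousFunction.arzela_ascoli (Metric.closedBall 0 ‖κ‖)
      (isCompact_closedBall _ _) A ?_ ?_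
    · rintro _ x ⟨f, hf, rfl⟩
      rw [mem_closedBall_zero_iff]
      have hf1 : ‖f‖ ≤ 1 := (mem_ball_zero_iff.1 hf).le
      calc ‖inner ℂ (κ x) f‖ ≤ ‖κ x‖ * ‖f‖ := norm_inner_le_norm _ _
        _ ≤ ‖κ‖ * 1 := by gcongr; exact κ.norm_coe_le_norm x
        _ = ‖κ‖ := mul_one _
    · intro x
      refine Metric.equicontinuousAt_of_continuity_modulus (fun y => ‖κ x - κ y‖) ?_ _ ?_
      · have : ContinuousAt (fun y => ‖κ x - κ y‖) x := by fun_prop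
        simpa [ContinuousAt] using this
      · refine .of_forall fun y => ?_
        rintro ⟨_, f, hf, rfl⟩
        have hf1 : ‖f‖ ≤ 1 := (mem_ball_zero_iff.1 hf).le
        change dist (inner ℂ (κ x) f) (inner ℂ (κ y) f) ≤ _
        rw [dist_eq_norm, ← inner_sub_left]
        calc ‖inner ℂ (κ x - κ y) f‖ ≤ ‖κ x - κ y‖ * ‖f‖ := norm_inner_le_norm _ _
          _ ≤ ‖κ x - κ y‖ * 1 := by gcongr
          _ = ‖κ x - κ y‖ := mul_one _
  refine ⟨e.symm '' closure A, hA.image e.symm.continuous, ?_⟩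
  refine mem_of_superset (Metric.ball_mem_nhds 0 one_pos) fun f hf => ?_
  exact ⟨e (kernelMap κ f), subset_closure ⟨f, hf, rfl⟩, e.symm_apply_apply _⟩

variable {G : Type*} [TopologicalSpace G] [Group G] [IsTopologicalGroup G] [CompactSpace G]
  [T2Space G] [MeasurableSpace G] [BorelSpace G]
  (μ : Measure G) [μ.IsHaarMeasure] [IsProbabilityMeasure μ]

/-- The class in `L²` of a continuous function. -/
abbrev l2 : C(G, ℂ) →L[ℂ] Lp ℂ 2 μ := ContinuousMap.toLp 2 μ ℂ

theorem measurePreserving_right (h : G) : MeasurePreserving (fun x => x * h) μ μ :=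
  have := isMulRightInvariant μ
  measurePreserving_mul_right μ h

/-- The right regular representation on `L²`. -/
def rightReg (h : G) : Lp ℂ 2 μ →ₗᵢ[ℂ] Lp ℂ 2 μ :=
  Lp.compMeasurePreservingₗᵢ ℂ (fun x => x * h) (measurePreserving_right μ h)

theorem coeFn_rightReg (h : G) (f : Lp ℂ 2 μ) : rightReg μ h f =ᵐ[μ] fun x => f (x * h) :=
  Lp.coeFn_compMeasurePreserving f (measurePreserving_right μ h)

theorem rightReg_mul (h k : G) (f : Lp ℂ 2 μ) :
    rightReg μ (h * k) f = rightReg μ h (rightReg μ k f) := by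
  apply Lp.ext
  filter_upwards [coeFn_rightReg μ (h * k) f, coeFn_rightReg μ h (rightReg μ k f),
    (measurePreserving_right μ h).quasiMeasurePreserving.ae (coeFn_rightReg μ k f)]
    with x h1 h2 h3
  rw [h1, h2, h3, mul_assoc]

theorem rightReg_one (f : Lp ℂ 2 μ) : rightReg μ 1 f = f := by
  apply Lp.ext
  filter_upwards [coeFn_rightReg μ 1 f] with x h1
  rw [h1, mul_one]

theorem continuous_rightReg (f : Lp ℂ 2 μ) : Continuous fun h => rightReg μ h f := by
  have hc : Continuous fun h : G => (⟨fun x => x * h, by fun_prop⟩ : C(G, G)) :=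
    ContinuousMap.continuous_of_continuous_uncurry _ (by
      change Continuous fun p : G × G => p.2 * p.1
      fun_prop)
  exact Continuous.compMeasurePreservingLp (f := fun _ : G => f) continuous_const hc
    (fun h => measurePreserving_right μ h) (by simp)

theorem rightReg_l2 (h : G) (c : C(G, ℂ)) :
    rightReg μ h (l2 μ c) = l2 μ (c.comp ⟨fun x => x * h, by fun_prop⟩) := by
  apply Lp.ext
  filter_upwards [coeFn_rightReg μ h (l2 μ c),
    (measurePreserving_right μ h).quasiMeasurePreserving.ae
      (ContinuousMap.coeFn_toLp (p := 2) (𝕜 := ℂ) μ c),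
    ContinuousMap.coeFn_toLp (p := 2) (𝕜 := ℂ) μ (c.comp ⟨fun x => x * h, by fun_prop⟩)]
    with x h1 h2 h3
  rw [h1, h2, h3]
  rfl

/-- A coefficient of an irreducible representation as a continuous function. -/
def Irrep.coeff (ξ : Irrep G) (i j : Fin ξ.dim) : C(G, ℂ) :=
  ⟨fun x => ξ.mat x i j, ξ.continuous_entry i j⟩

/-- The span in `L²` of the coefficients of the irreducible representations. -/
def coeffSpan : Submodule ℂ (Lp ℂ 2 μ) :=
  Submodule.span ℂ {f | ∃ (ξ : Irrep G) (i j : Fin ξ.dim), f = l2 μ (ξ.coeff i j)}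

theorem inner_rightReg (h : G) (f g : Lp ℂ 2 μ) :
    inner ℂ (rightReg μ h f) (rightReg μ h g) = inner ℂ f g :=
  (rightReg μ h).inner_map_map f g

/-- The matrices of the right regular representation on an invariant finite-dimensional space. -/
theorem exists_hom_of_invariant (V : Submodule ℂ (Lp ℂ 2 μ)) [FiniteDimensional ℂ V]
    (hV : ∀ h, ∀ f ∈ V, rightReg μ h f ∈ V) {d : ℕ} (e : OrthonormalBasis (Fin d) ℂ V) :
    ∃ ρ : G →* Matrix.unitaryGroup (Fin d) ℂ, Continuous ρ ∧
      ∀ h j, rightReg μ h (e j) = ∑ i, (ρ h).1 i j • (e i : Lp ℂ 2 μ) := by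
  let M : G → Matrix (Fin d) (Fin d) ℂ := fun h =>
    Matrix.of fun i j => inner ℂ (e i : Lp ℂ 2 μ) (rightReg μ h (e j))
  have hexp : ∀ h j, rightReg μ h (e j) = ∑ i, M h i j • (e i : Lp ℂ 2 μ) := by
    intro h j
    have := e.sum_repr' ⟨rightReg μ h (e j), hV h _ (e j).2⟩
    have h2 := congrArg (Subtype.val) this
    simp only [Submodule.coe_sum, Submodule.coe_smul] at h2
    exact h2.symm
  have hor : ∀ i j, inner ℂ (e i : Lp ℂ 2 μ) (e j) = if i = j then (1 : ℂ) else 0 := fun i j =>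
    (orthonormal_iff_ite.1 e.orthonormal) i j
  have hmul : ∀ h k, M (h * k) = M h * M k := by
    intro h k
    ext i j
    simp only [M, Matrix.of_apply, Matrix.mul_apply]
    rw [rightReg_mul, hexp k j, map_sum, inner_sum]
    refine Finset.sum_congr rfl fun l _ => ?_
    rw [map_smul, inner_smul_right, mul_comm, ← hexp k j]
    rfl
  have hone : M 1 = 1 := by
    ext i j
    simp only [M, Matrix.of_apply, rightReg_one, hor, Matrix.one_apply]
  have huni : ∀ h, (M h).conjTranspose * M h = 1 := by
    intro h
    ext i j
    have h1 := inner_rightReg μ h (e i : Lp ℂ 2 μ) (e j)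
    rw [hor, hexp h i, sum_inner] at h1
    rw [Matrix.one_apply, ← h1, Matrix.mul_apply]
    refine Finset.sum_congr rfl fun l _ => ?_
    rw [inner_smul_left]
    rfl
  let ρ : G →* Matrix.unitaryGroup (Fin d) ℂ :=
    { toFun := fun h => ⟨M h, Matrix.mem_unitaryGroup_iff'.2 (huni h)⟩
      map_one' := Subtype.ext hone
      map_mul' := fun h k => Subtype.ext (hmul h k) }
  refine ⟨ρ, ?_, hexp⟩
  refine Continuous.subtype_mk (continuous_matrix fun i j => ?_) _
  exact continuous_const.inner (continuous_rightReg μ _)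

theorem l2_sum_smul {d : ℕ} (a : Fin d → ℂ) (c : Fin d → C(G, ℂ)) :
    l2 μ (∑ i, a i • c i) = ∑ i, a i • l2 μ (c i) := by
  simp only [map_sum, map_smul]

/-- Evaluating the transformation law at the identity gives `c_j(x) = ∑ c_i(1) ρ(x)_{ij}`, so `c_j`
is a combination of coefficients. Continuity of `c_j` is what makes evaluation at a point
meaningful. -/
theorem l2_mem_coeffSpan {d : ℕ} (ρ : G →* Matrix.unitaryGroup (Fin d) ℂ) (hρ : Continuous ρ)
    (hir : (matrixRep ρ).IsIrreducible) (c : Fin d → C(G, ℂ))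
    (hc : ∀ h j, (c j).comp ⟨fun x => x * h, by fun_prop⟩ = ∑ i, (ρ h).1 i j • c i) (j : Fin d) :
    l2 μ (c j) ∈ coeffSpan μ := by
  let ξ : Irrep G := ⟨d, ρ, hρ, hir⟩
  have hcj : c j = ∑ i : Fin d, c i 1 • ξ.coeff i j := by
    ext x
    have h2 := congrArg (fun k : C(G, ℂ) => k 1) (hc x j)
    simp only [ContinuousMap.comp_apply, ContinuousMap.coe_mk, one_mul, ContinuousMap.coe_sum,
      ContinuousMap.coe_smul, Finset.sum_apply, Pi.smul_apply] at h2 ⊢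
    rw [h2]
    exact Finset.sum_congr rfl fun i _ => mul_comm _ _
  rw [hcj, map_sum]
  refine Submodule.sum_mem _ fun i _ => ?_
  rw [map_smul]
  exact Submodule.smul_mem _ _ (Submodule.subset_span ⟨ξ, i, j, rfl⟩)

/-- An orthonormal basis turns `V` into a unitary matrix representation; irreducibility is
transported along `Φ`, and the continuous representatives of the basis obey the law required by
`l2_mem_coeffSpan`. -/
theorem le_coeffSpan_of_irreducible (V : Submodule ℂ (Lp ℂ 2 μ)) [FiniteDimensional ℂ V]
    (hV : ∀ h, ∀ f ∈ V, rightReg μ h f ∈ V) (hc : ∀ f ∈ V, ∃ c : C(G, ℂ), l2 μ c = f)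
    (hbot : V ≠ ⊥)
    (hirr : ∀ W ≤ V, (∀ h, ∀ f ∈ W, rightReg μ h f ∈ W) → W = ⊥ ∨ W = V) :
    V ≤ coeffSpan μ := by
  let e := stdOrthonormalBasis ℂ V
  obtain ⟨ρ, hρc, hρ⟩ := exists_hom_of_invariant μ V hV e
  let Φ : (Fin (Module.finrank ℂ V) → ℂ) →ₗ[ℂ] Lp ℂ 2 μ :=
    V.subtype.comp (e.toBasis.equivFun.symm : _ →ₗ[ℂ] V)
  have hΦ : ∀ v, Φ v = ∑ i, v i • (e i : Lp ℂ 2 μ) := by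
    intro v
    simp only [Φ, LinearMap.comp_apply, LinearEquiv.coe_coe, Module.Basis.equivFun_symm_apply,
      OrthonormalBasis.coe_toBasis, Submodule.coe_subtype, Submodule.coe_sum, Submodule.coe_smul]
  have hΦinj : Function.Injective Φ :=
    V.injective_subtype.comp e.toBasis.equivFun.symm.injective
  have hΦmem : ∀ v, Φ v ∈ V := fun v => (e.toBasis.equivFun.symm v).2
  have hΦsurj : ∀ f ∈ V, ∃ v, Φ v = f := fun f hf =>
    ⟨e.toBasis.equivFun ⟨f, hf⟩, by simp [Φ]⟩
  have hΦrep : ∀ h v, Φ ((ρ h).1.mulVec v) = rightReg μ h (Φ v) := by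
    intro h v
    rw [hΦ, hΦ, map_sum]
    simp only [map_smul, hρ, Finset.smul_sum, Matrix.mulVec, dotProduct, Finset.sum_smul]
    rw [Finset.sum_comm]
    refine Finset.sum_congr rfl fun i _ => Finset.sum_congr rfl fun j _ => ?_
    rw [smul_smul, mul_comm]
  have hnt : Nontrivial (Fin (Module.finrank ℂ V) → ℂ) := by
    have : Nontrivial V := Submodule.nontrivial_iff_ne_bot.2 hbot
    exact e.toBasis.equivFun.symm.toEquiv.nontrivial
  have hir : (matrixRep ρ).IsIrreducible := by
    have hbt : (⊥ : Subrepresentation (matrixRep ρ)) ≠ ⊤ := fun h =>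
      bot_ne_top (α := Submodule ℂ (Fin (Module.finrank ℂ V) → ℂ))
        (congrArg Subrepresentation.toSubmodule h)
    have : Nontrivial (Subrepresentation (matrixRep ρ)) := ⟨⊥, ⊤, hbt⟩
    refine ⟨fun W => ?_⟩
    rcases hirr (W.toSubmodule.map Φ) (by rintro _ ⟨v, -, rfl⟩; exact hΦmem v) (by
      rintro h _ ⟨v, hv, rfl⟩
      exact ⟨_, W.apply_mem_toSubmodule h hv, hΦrep h v⟩) with h | h
    · left
      apply Subrepresentation.toSubmodule_injective
      refine (Submodule.eq_bot_iff _).2 fun v hv => hΦinj ?_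
      rw [map_zero, ← Submodule.mem_bot ℂ, ← h]
      exact ⟨v, hv, rfl⟩
    · right
      apply Subrepresentation.toSubmodule_injective
      refine eq_top_iff.2 fun v _ => ?_
      have : Φ v ∈ W.toSubmodule.map Φ := by rw [h]; exact hΦmem v
      obtain ⟨v', hv', hvv⟩ := this
      exact hΦinj hvv ▸ hv'
  choose c hc' using fun j => hc (e j : Lp ℂ 2 μ) (e j).2
  have hmem : ∀ j, (e j : Lp ℂ 2 μ) ∈ coeffSpan μ := by
    intro j
    rw [← hc' j]
    refine l2_mem_coeffSpan μ ρ hρc hir c (fun h j => ?_) j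
    apply ContinuousMap.toLp_injective (p := 2) (𝕜 := ℂ) μ
    have h1 := (rightReg_l2 μ h (c j)).symm.trans
      ((congrArg (rightReg μ h) (hc' j)).trans (hρ h j))
    refine h1.trans (Eq.trans ?_ (l2_sum_smul μ (fun i => (ρ h).1 i j) c).symm)
    simp only [hc']
  intro f hf
  obtain ⟨v, rfl⟩ := hΦsurj f hf
  rw [hΦ]
  exact Submodule.sum_mem _ fun i _ => Submodule.smul_mem _ _ (hmem i)

/-- A finite-dimensional space of continuous functions which is invariant under right translations
consists of coefficients of irreducible representations. -/
theorem le_coeffSpan_of_finiteDimensional (n : ℕ) (V : Submodule ℂ (Lp ℂ 2 μ))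
    [FiniteDimensional ℂ V] (hn : Module.finrank ℂ V ≤ n)
    (hV : ∀ h, ∀ f ∈ V, rightReg μ h f ∈ V) (hc : ∀ f ∈ V, ∃ c : C(G, ℂ), l2 μ c = f) :
    V ≤ coeffSpan μ := by
  induction n generalizing V with
  | zero =>
    have : V = ⊥ := Submodule.finrank_eq_zero.1 (by omega)
    rw [this]; exact bot_le
  | succ n ih =>
    by_cases hbot : V = ⊥
    · rw [hbot]; exact bot_le
    by_cases hirr : ∀ W ≤ V, (∀ h, ∀ f ∈ W, rightReg μ h f ∈ W) → W = ⊥ ∨ W = V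
    · exact le_coeffSpan_of_irreducible μ V hV hc hbot hirr
    push Not at hirr
    obtain ⟨W, hWV, hWinv, hW0, hWne⟩ := hirr
    have : FiniteDimensional ℂ W := Submodule.finiteDimensional_of_le hWV
    have hW : W ≤ coeffSpan μ := by
      refine ih W ?_ hWinv fun f hf => hc f (hWV hf)
      have := Submodule.finrank_lt_finrank_of_lt (lt_of_le_of_ne hWV hWne)
      omega
    -- The complement of `W` in `V` is invariant since translations are unitary, and has smaller
    -- dimension since `W` is nonzero, so induction applies to both summands.
    have hW' : Wᗮ ⊓ V ≤ coeffSpan μ := by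
      have : FiniteDimensional ℂ (Wᗮ ⊓ V : Submodule ℂ (Lp ℂ 2 μ)) :=
        Submodule.finiteDimensional_of_le inf_le_right
      refine ih _ ?_ (fun h f hf => ⟨?_, hV h f hf.2⟩) fun f hf => hc f hf.2
      · have hlt : Wᗮ ⊓ V < V := by
          refine lt_of_le_of_ne inf_le_right fun heq => hW0 ?_
          have hVW : V ≤ Wᗮ := inf_eq_right.1 heq
          have : W ≤ Wᗮ := hWV.trans hVW
          exact (Submodule.isOrtho_self.1 this)
        have := Submodule.finrank_lt_finrank_of_lt hlt
        omega
      · intro w hw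
        have h1 := hf.1 _ (hWinv h⁻¹ w hw)
        have h2 := inner_rightReg μ h (rightReg μ h⁻¹ w) f
        rw [← rightReg_mul, mul_inv_cancel, rightReg_one, h1] at h2
        exact h2
    have hsup : W ⊔ Wᗮ ⊓ V = V := Submodule.sup_orthogonal_inf_of_hasOrthogonalProjection hWV
    rw [← hsup]
    exact sup_le hW hW'

/-- The vector-valued kernel of a convolution operator. -/
def convKernel (k : C(G, ℂ)) : C(G, Lp ℂ 2 μ) where
  -- The conjugation offsets the conjugate-linearity of the inner product in its first argument.
  toFun x := l2 μ ⟨fun y => conj (k (x * y⁻¹)), by fun_prop⟩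
  continuous_toFun := by
    refine (l2 μ).continuous.comp (ContinuousMap.continuous_of_continuous_uncurry _ ?_)
    change Continuous fun p : G × G => conj (k (p.1 * p.2⁻¹))
    fun_prop

/-- The operator `f ↦ ∫ k(x y⁻¹) f(y) dy` on `L²`. -/
def convOp (k : C(G, ℂ)) : Lp ℂ 2 μ →L[ℂ] Lp ℂ 2 μ := (l2 μ).comp (kernelMap (convKernel μ k))

theorem isCompactOperator_convOp (k : C(G, ℂ)) : IsCompactOperator (convOp μ k) :=
  (isCompactOperator_kernelMap (convKernel μ k)).clm_comp (l2 μ)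

theorem kernelMap_convKernel_l2 (k a : C(G, ℂ)) (x : G) :
    kernelMap (convKernel μ k) (l2 μ a) x = ∫ y, k (x * y⁻¹) * a y ∂μ := by
  rw [kernelMap_apply]
  refine (ContinuousMap.inner_toLp μ _ a).trans ?_
  refine integral_congr_ae (.of_forall fun y => ?_)
  simp [mul_comm]

/-- The kernel `k(x y⁻¹)` is unchanged when `x` and `y` are multiplied on the right by the same
element. -/
theorem convOp_rightReg (k : C(G, ℂ)) (h : G) (f : Lp ℂ 2 μ) :
    convOp μ k (rightReg μ h f) = rightReg μ h (convOp μ k f) := by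
  simp only [convOp, ContinuousLinearMap.comp_apply]
  rw [rightReg_l2]
  congr 1
  ext x
  simp only [kernelMap_apply, ContinuousMap.comp_apply, ContinuousMap.coe_mk]
  rw [← inner_rightReg μ h (convKernel μ k (x * h)) f]
  congr 1
  refine Eq.symm ((rightReg_l2 μ h _).trans ?_)
  simp only [convKernel, ContinuousMap.coe_mk]
  congr 1
  ext y
  simp [mul_assoc]

/-- The hypothesis says that `k(x y⁻¹)` is a Hermitian kernel. Fubini gives the identity for
continuous functions, which are dense. -/
theorem isSymmetric_convOp (k : C(G, ℂ)) (hk : ∀ x, k x⁻¹ = conj (k x)) :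
    (convOp μ k).IsSymmetric := by
  have hdense : DenseRange (l2 μ : C(G, ℂ) → Lp ℂ 2 μ) :=
    ContinuousMap.toLp_denseRange ℂ μ ℂ (by simp)
  intro f g
  refine hdense.induction_on₂ (p := fun f g => inner ℂ (convOp μ k f) g = inner ℂ f (convOp μ k g))
    ?_ (fun a b => ?_) f g
  · exact isClosed_eq (by fun_prop) (by fun_prop)
  · simp only [convOp, ContinuousLinearMap.comp_apply]
    rw [ContinuousMap.inner_toLp, ContinuousMap.inner_toLp]
    simp only [kernelMap_convKernel_l2]
    have h1 : ∀ x, b x * conj (∫ y, k (x * y⁻¹) * a y ∂μ) =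
        ∫ y, b x * conj (k (x * y⁻¹) * a y) ∂μ := by
      intro x
      rw [← integral_conj, ← integral_const_mul]
    simp only [h1]
    rw [integral_integral_swap_of_hasCompactSupport (by fun_prop)
      (HasCompactSupport.of_compactSpace _)]
    refine integral_congr_ae (.of_forall fun y => ?_)
    simp only
    rw [← integral_mul_const]
    refine integral_congr_ae (.of_forall fun x => ?_)
    have := hk (x * y⁻¹)
    simp only [mul_inv_rev, inv_inv] at this
    simp only [this, map_mul]
    ring

/-- **Peter–Weyl theorem**: the coefficients of the irreducible representations span a dense
subspace of `L²`. -/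
theorem orthogonal_coeffSpan : (coeffSpan μ)ᗮ = ⊥ := by
  refine (Submodule.eq_bot_iff _).2 fun f hf => ?_
  -- Eigenspaces for nonzero eigenvalues are finite-dimensional, translation-invariant and consist
  -- of continuous functions, so they lie in `coeffSpan μ` and are orthogonal to `f`. By symmetry
  -- the image of `f` is orthogonal to all eigenspaces, including the kernel, and the spectral
  -- theorem makes it zero.
  have hperp : ∀ (k : C(G, ℂ)), (∀ x, k x⁻¹ = conj (k x)) → convOp μ k f = 0 := by
    intro k hk
    have hcomp := isCompactOperator_convOp μ k
    have hsymm := isSymmetric_convOp μ k hk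
    have hbot := ContinuousLinearMap.orthogonalComplement_iSup_eigenspaces_eq_bot hcomp hsymm
    rw [← Submodule.mem_bot ℂ, ← hbot, Submodule.mem_orthogonal]
    intro u hu
    have hle : (⨆ t, Module.End.eigenspace (convOp μ k : Module.End ℂ (Lp ℂ 2 μ)) t) ≤
        (ℂ ∙ convOp μ k f)ᗮ := by
      refine iSup_le fun t e he => ?_
      rw [Submodule.mem_orthogonal_singleton_iff_inner_left]
      have he' : convOp μ k e = t • e := Module.End.mem_eigenspace_iff.1 he
      refine (hsymm e f).symm.trans ?_
      change inner ℂ (convOp μ k e) f = 0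
      rw [he', inner_smul_left]
      by_cases ht : t = 0
      · simp [ht]
      have hfd := ContinuousLinearMap.finite_dimensional_eigenspace hcomp t ht
      have : e ∈ coeffSpan μ := by
        refine le_coeffSpan_of_finiteDimensional μ _
          (Module.End.eigenspace (convOp μ k).toLinearMap t) le_rfl (fun h f hf => ?_)
          (fun f hf => ?_) he
        · have hf' : convOp μ k f = t • f := Module.End.mem_eigenspace_iff.1 hf
          refine Module.End.mem_eigenspace_iff.2 ?_
          change convOp μ k _ = _
          rw [convOp_rightReg, hf', map_smul]
        · have hf' : convOp μ k f = t • f := Module.End.mem_eigenspace_iff.1 hf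
          refine ⟨t⁻¹ • kernelMap (convKernel μ k) f, ?_⟩
          rw [map_smul]
          change t⁻¹ • convOp μ k f = f
          rw [hf', smul_smul, inv_mul_cancel₀ ht, one_smul]
      rw [hf e this, mul_zero]
    exact Submodule.mem_orthogonal_singleton_iff_inner_left.1 (hle hu)
  have hinner : ∀ (k : C(G, ℂ)), (∀ x, k x⁻¹ = conj (k x)) →
      inner ℂ (convKernel μ k 1) f = 0 := by
    intro k hk
    have h1 : kernelMap (convKernel μ k) f = 0 := by
      apply ContinuousMap.toLp_injective (p := 2) (𝕜 := ℂ) μ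
      rw [map_zero]
      exact hperp k hk
    exact congrArg (fun c : C(G, ℂ) => c 1) h1
  have hall : ∀ a : C(G, ℂ), inner ℂ (l2 μ a) f = 0 := by
    intro a
    -- Every continuous `a` is a combination of two kernels with the Hermitian symmetry: `2 a(y)` is
    -- the sum of the conjugate of `k1(y⁻¹)` and of `i` times the conjugate of `k2(y⁻¹)`.
    let k1 : C(G, ℂ) := ⟨fun x => conj (a x⁻¹) + a x, by fun_prop⟩
    let k2 : C(G, ℂ) := ⟨fun x => Complex.I * (conj (a x⁻¹) - a x), by fun_prop⟩
    have e1 := hinner k1 (fun x => by simp [k1, add_comm])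
    have e2 := hinner k2 (fun x => by simp [k2]; ring)
    have hsum : (2 : ℂ) • a = (⟨fun y => conj (k1 (1 * y⁻¹)), by fun_prop⟩ : C(G, ℂ)) +
        Complex.I • (⟨fun y => conj (k2 (1 * y⁻¹)), by fun_prop⟩ : C(G, ℂ)) := by
      ext y
      simp only [k1, k2, ContinuousMap.coe_mk, ContinuousMap.add_apply, ContinuousMap.smul_apply,
        one_mul, inv_inv, map_add, map_sub, map_mul, Complex.conj_conj, Complex.conj_I, smul_eq_mul]
      linear_combination (a y - conj (a y⁻¹)) * Complex.I_mul_I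
    have h2 : (2 : ℂ) • l2 μ a = convKernel μ k1 1 + Complex.I • convKernel μ k2 1 := by
      rw [← map_smul, hsum, map_add, map_smul]
      rfl
    have h3 : inner ℂ ((2 : ℂ) • l2 μ a) f = 0 := by
      rw [h2, inner_add_left, inner_smul_left, e1, e2]; simp
    rw [inner_smul_left] at h3
    simpa using h3
  have hdense : DenseRange (l2 μ : C(G, ℂ) → Lp ℂ 2 μ) :=
    ContinuousMap.toLp_denseRange ℂ μ ℂ (by simp)
  have : inner ℂ f f = (0 : ℂ) := by
    refine hdense.induction_on (p := fun g => inner ℂ g f = (0 : ℂ)) f ?_ hall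
    exact isClosed_eq (by fun_prop) continuous_const
  exact inner_self_eq_zero.1 this

end PeterWeyl

/-! ### The Hilbert basis of coefficients and Parseval's identity. -/

section Parseval

open Set Filter Topology MeasureTheory

variable {G : Type*} [TopologicalSpace G] [Group G] [IsTopologicalGroup G] [CompactSpace G]
  [T2Space G] [MeasurableSpace G] [BorelSpace G]
  (μ : Measure G) [μ.IsHaarMeasure] [IsProbabilityMeasure μ]

theorem fourierCoeff_apply (f : G → ℂ) (ξ : Irrep G) (i j) :
    fourierCoeff μ f ξ i j = ∫ x, f x * conj (ξ.mat x j i) ∂μ := rfl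

theorem fourierCoeff_congr {f g : G → ℂ} (h : f =ᵐ[μ] g) (ξ : Irrep G) :
    fourierCoeff μ f ξ = fourierCoeff μ g ξ := by
  ext i j
  rw [fourierCoeff_apply, fourierCoeff_apply]
  refine integral_congr_ae ?_
  filter_upwards [h] with x hx
  rw [hx]

theorem fourierCoeff_l2 (c : C(G, ℂ)) (ξ : Irrep G) :
    fourierCoeff μ (l2 μ c) ξ = fourierCoeff μ c ξ :=
  fourierCoeff_congr μ (ContinuousMap.coeFn_toLp (p := 2) (𝕜 := ℂ) μ c) ξ

theorem inner_l2_coeff (f : Lp ℂ 2 μ) (ξ : Irrep G) (i j) :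
    inner ℂ (l2 μ (ξ.coeff j i)) f = fourierCoeff μ f ξ i j := by
  rw [fourierCoeff_apply, L2.inner_def]
  refine integral_congr_ae ?_
  filter_upwards [ContinuousMap.coeFn_toLp (p := 2) (𝕜 := ℂ) μ (ξ.coeff j i)] with x hx
  rw [hx]
  rfl

theorem not_equivalent_out {q r : UnitaryDual G} (h : q ≠ r) : ¬ q.out.Equivalent r.out :=
  fun he => h (Quotient.out_equiv_out.1 he)

theorem fourierCoeff_entry_self (ξ : Irrep G) (k l i j) :
    fourierCoeff μ (fun x => ξ.mat x k l) ξ i j =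
      if j = k ∧ i = l then (ξ.dim : ℂ)⁻¹ else 0 := by
  rw [fourierCoeff_apply, integral_entry_mul_conj_self]
  simp only [eq_comm]

theorem fourierCoeff_entry_of_not_equivalent {ξ η : Irrep G} (h : ¬ ξ.Equivalent η) (k l) :
    fourierCoeff μ (fun x => ξ.mat x k l) η = 0 := by
  ext i j
  rw [fourierCoeff_apply, integral_entry_mul_conj_of_not_equivalent μ h]
  rfl

/-- The normalized coefficients of representatives of the unitary dual. -/
def basisFn (a : Σ q : UnitaryDual G, Fin q.out.dim × Fin q.out.dim) : Lp ℂ 2 μ :=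
  -- The indices are exchanged so that the coordinate of `f` at `⟨q, i, j⟩` is a multiple of the
  -- `(i, j)` entry of its Fourier coefficient, which involves the adjoint of `ξ(x)`.
  ((√a.1.out.dim : ℝ) : ℂ) • l2 μ (a.1.out.coeff a.2.2 a.2.1)

theorem inner_basisFn (f : Lp ℂ 2 μ) (q : UnitaryDual G) (i j) :
    inner ℂ (basisFn μ ⟨q, i, j⟩) f = ((√q.out.dim : ℝ) : ℂ) * fourierCoeff μ f q.out i j := by
  rw [basisFn, inner_smul_left, inner_l2_coeff, Complex.conj_ofReal]

theorem orthonormal_basisFn : Orthonormal ℂ (basisFn μ) := by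
  classical
  rw [orthonormal_iff_ite]
  rintro ⟨q, i, j⟩ ⟨r, k, l⟩
  rw [inner_basisFn]
  have h1 : fourierCoeff μ (basisFn μ ⟨r, k, l⟩) q.out =
      ((√r.out.dim : ℝ) : ℂ) • fourierCoeff μ (fun x => r.out.mat x l k) q.out := by
    ext i j
    rw [← inner_l2_coeff, basisFn, inner_smul_right, inner_l2_coeff, fourierCoeff_l2]
    rfl
  rw [h1]
  by_cases h : q = r
  · subst h
    rw [Matrix.smul_apply, fourierCoeff_entry_self]
    have hd : ((√q.out.dim : ℝ) : ℂ) * ((√q.out.dim : ℝ) : ℂ) = q.out.dim := by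
      rw [← Complex.ofReal_mul, Real.mul_self_sqrt (by positivity)]; simp
    have hd0 := q.out.dim_ne_zero
    by_cases h2 : j = l ∧ i = k
    · obtain ⟨rfl, rfl⟩ := h2
      simp only [and_self, if_true, smul_eq_mul]
      rw [← mul_assoc, hd, mul_inv_cancel₀ hd0]
    · rw [if_neg h2, if_neg]
      · simp
      · intro h3
        apply h2
        simp only [Sigma.mk.injEq, heq_eq_eq, Prod.mk.injEq, true_and] at h3
        exact ⟨h3.2, h3.1⟩
  · rw [fourierCoeff_entry_of_not_equivalent μ (not_equivalent_out (Ne.symm h)), if_neg]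
    · simp
    · intro h3
      exact h (congrArg Sigma.fst h3)

/-- Every irreducible representation is unitarily conjugate to the representative of its class, so
its coefficients are combinations of those of the representative. -/
theorem coeffSpan_le : coeffSpan μ ≤ Submodule.span ℂ (range (basisFn μ)) := by
  refine Submodule.span_le.2 ?_
  rintro _ ⟨ξ, i, j, rfl⟩
  let q : UnitaryDual G := ⟦ξ⟧
  obtain ⟨U, hU1, hU2, hU⟩ : ξ.Equivalent q.out := Setoid.symm (Quotient.mk_out ξ)
  have hξ : ξ.coeff i j = ∑ k, ∑ l, (U i k * conj (U j l)) • q.out.coeff k l := by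
    ext x
    have : ξ.mat x = U * q.out.mat x * U.conjTranspose := by
      rw [← hU, Matrix.mul_assoc, hU1, Matrix.mul_one]
    change ξ.mat x i j = _
    rw [this]
    simp only [Matrix.mul_apply, Matrix.conjTranspose_apply, ContinuousMap.coe_sum,
      ContinuousMap.coe_smul, Finset.sum_apply, Pi.smul_apply, Finset.sum_mul]
    rw [Finset.sum_comm]
    refine Finset.sum_congr rfl fun k _ => Finset.sum_congr rfl fun l _ => ?_
    simp only [smul_eq_mul, Irrep.coeff, ContinuousMap.coe_mk]
    change _ * _ * conj (U j l) = _
    ring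
  rw [hξ, map_sum]
  refine Submodule.sum_mem _ fun k _ => ?_
  rw [map_sum]
  refine Submodule.sum_mem _ fun l _ => ?_
  rw [map_smul]
  refine Submodule.smul_mem _ _ ?_
  have hd : ((√q.out.dim : ℝ) : ℂ) ≠ 0 := by
    have := Real.sqrt_pos.2 (Nat.cast_pos (α := ℝ).2 q.out.dim_pos)
    exact_mod_cast this.ne'
  have : l2 μ (q.out.coeff k l) = ((√q.out.dim : ℝ) : ℂ)⁻¹ • basisFn μ ⟨q, l, k⟩ := by
    rw [basisFn, smul_smul, inv_mul_cancel₀ hd, one_smul]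
  rw [this]
  exact Submodule.smul_mem _ _ (Submodule.subset_span ⟨_, rfl⟩)

/-- The Hilbert basis of `L²` formed by the normalized coefficients. -/
def coeffBasis : HilbertBasis (Σ q : UnitaryDual G, Fin q.out.dim × Fin q.out.dim) ℂ (Lp ℂ 2 μ) :=
  HilbertBasis.mkOfOrthogonalEqBot (orthonormal_basisFn μ) (by
    rw [eq_bot_iff, ← orthogonal_coeffSpan μ]
    exact Submodule.orthogonal_le (coeffSpan_le μ))

theorem coeffBasis_apply (a) : coeffBasis μ a = basisFn μ a := by
  simp [coeffBasis]

theorem hsNormSq_nonneg {m n : ℕ} (A : Matrix (Fin m) (Fin n) ℂ) : 0 ≤ hsNormSq A :=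
  Finset.sum_nonneg fun _ _ => Finset.sum_nonneg fun _ _ => by positivity

/-- **Parseval's identity**. -/
theorem hasSum_parseval (f : Lp ℂ 2 μ) :
    HasSum (fun q : UnitaryDual G => q.out.dim * hsNormSq (fourierCoeff μ f q.out)) (‖f‖ ^ 2) := by
  have h1 := (coeffBasis μ).hasSum_inner_mul_inner f f
  have h2 : HasSum (fun a => ‖inner ℂ (basisFn μ a) f‖ ^ 2) (‖f‖ ^ 2) := by
    have e1 : ∀ a, inner ℂ f (coeffBasis μ a) * inner ℂ (coeffBasis μ a) f =
        ((‖inner ℂ (basisFn μ a) f‖ ^ 2 : ℝ) : ℂ) := by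
      intro a
      rw [coeffBasis_apply, ← inner_conj_symm f, RCLike.conj_mul]
      simp
    have e2 : inner ℂ f f = ((‖f‖ ^ 2 : ℝ) : ℂ) := by
      rw [inner_self_eq_norm_sq_to_K]
      simp
    simp only [e1, e2] at h1
    exact Complex.hasSum_ofReal.1 h1
  refine h2.sigma fun q => ?_
  have h3 := hasSum_fintype (fun ij : Fin q.out.dim × Fin q.out.dim =>
    ‖inner ℂ (basisFn μ ⟨q, ij⟩) f‖ ^ 2)
  convert h3 using 1
  rw [Fintype.sum_prod_type]
  simp only [inner_basisFn, hsNormSq, norm_mul, mul_pow, Complex.norm_real, Finset.mul_sum,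
    Real.norm_eq_abs, sq_abs, Real.sq_sqrt (Nat.cast_nonneg _)]

theorem tsum_ofReal_parseval (f : Lp ℂ 2 μ) :
    ∑' q : UnitaryDual G, ENNReal.ofReal (q.out.dim * hsNormSq (fourierCoeff μ f q.out)) =
      ‖f‖ₑ ^ 2 := by
  have h := hasSum_parseval μ f
  rw [← ENNReal.ofReal_tsum_of_nonneg (fun q => mul_nonneg (Nat.cast_nonneg _) (hsNormSq_nonneg _))
    h.summable, h.tsum_eq, ← ofReal_norm, ENNReal.ofReal_pow (norm_nonneg _)]

theorem eq_zero_of_fourierCoeff_eq_zero (f : Lp ℂ 2 μ)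
    (h : ∀ q : UnitaryDual G, fourierCoeff μ f q.out = 0) : f = 0 := by
  have h1 := hasSum_parseval μ f
  have : (fun q : UnitaryDual G => (q.out.dim : ℝ) * hsNormSq (fourierCoeff μ f q.out)) =
      fun _ => 0 := by
    ext q
    simp [h q, hsNormSq]
  rw [this] at h1
  have h2 := h1.unique hasSum_zero
  simpa using h2

/-- A continuous function is determined by its Fourier coefficients. -/
theorem eq_of_fourierCoeff_eq {f g : G → ℂ} (hf : Continuous f) (hg : Continuous g)
    (h : ∀ q : UnitaryDual G, fourierCoeff μ f q.out = fourierCoeff μ g q.out) : f = g := by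
  let a : C(G, ℂ) := ⟨f, hf⟩
  let b : C(G, ℂ) := ⟨g, hg⟩
  have h1 : l2 μ (a - b) = 0 := by
    refine eq_zero_of_fourierCoeff_eq_zero μ _ fun q => ?_
    ext i j
    rw [← inner_l2_coeff, map_sub, inner_sub_right, inner_l2_coeff, inner_l2_coeff,
      fourierCoeff_l2, fourierCoeff_l2]
    change fourierCoeff μ f q.out i j - fourierCoeff μ g q.out i j = 0
    rw [h q, sub_self]
  have h2 : a - b = 0 := by
    apply ContinuousMap.toLp_injective (p := 2) (𝕜 := ℂ) μ
    rw [map_zero]; exact h1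
  exact congrArg DFunLike.coe (sub_eq_zero.1 h2)

end Parseval

/-! ### Differentials of representations and the Casimir matrix. -/

section Casimir

open Set Filter Topology MeasureTheory

variable {E : Type*} [NormedAddCommGroup E] [NormedSpace ℝ E]
  {G : Type*} [TopologicalSpace G] [ChartedSpace E G] [Group G] [LieGroup 𝓘(ℝ, E) ∞ G]

/-- Evaluation of smooth functions at a point as a linear form. -/
def evalLin (x : G) : SmoothFn E G →ₗ[ℂ] ℂ where
  toFun f := f x
  map_add' _ _ := rfl
  map_smul' _ _ := rfl

theorem evalLin_apply (x : G) (f : SmoothFn E G) : evalLin x f = f x := rfl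

theorem smoothFn_sum_apply {ι : Type*} (s : Finset ι) (f : ι → SmoothFn E G) (x : G) :
    (∑ i ∈ s, f i) x = ∑ i ∈ s, f i x := by
  simp only [← evalLin_apply, map_sum]

theorem lieDeriv_sum_smul {ι : Type*} (v : GroupLieAlgebra 𝓘(ℝ, E) G) (s : Finset ι) (a : ι → ℂ)
    (f : ι → SmoothFn E G) :
    lieDeriv v (∑ i ∈ s, a i • f i) = ∑ i ∈ s, a i • lieDeriv v (f i) := by
  change lieDerivLin v _ = _
  simp only [map_sum, map_smul]
  rfl

variable [CompactSpace G] [T2Space G] [FiniteDimensional ℝ E] [IsTopologicalGroup G]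

/-- The statement involves no measure, so a Borel structure and a Haar measure are introduced only
for the proof. -/
theorem Irrep.contMDiff (ξ : Irrep G) (i j) :
    ContMDiff 𝓘(ℝ, E) 𝓘(ℝ, ℂ) ∞ fun x => ξ.mat x i j := by
  borelize G
  let μ : Measure G := Measure.haarMeasure ⊤
  have : IsProbabilityMeasure μ := ⟨by
    have := Measure.haarMeasure_self (K₀ := (⊤ : TopologicalSpace.PositiveCompacts G))
    simpa using this⟩
  exact ξ.contMDiff_entry μ i j

variable (E) in
/-- A coefficient of an irreducible representation as a smooth function. -/
def Irrep.entry (ξ : Irrep G) (i j : Fin ξ.dim) : SmoothFn E G :=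
  ⟨fun x => ξ.mat x i j, ξ.contMDiff i j⟩

theorem Irrep.entry_apply (ξ : Irrep G) (i j x) : ξ.entry E i j x = ξ.mat x i j := rfl

/-- The derivative at the identity of a representation in the direction `v`. -/
def Irrep.deriv (ξ : Irrep G) (v : GroupLieAlgebra 𝓘(ℝ, E) G) :
    Matrix (Fin ξ.dim) (Fin ξ.dim) ℂ :=
  Matrix.of fun i j => lieDeriv v (ξ.entry E i j) 1

theorem Irrep.translate_entry (ξ : Irrep G) (h : G) (i j) :
    translate h (ξ.entry E i j) = ∑ k, ξ.mat h i k • ξ.entry E k j := by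
  ext x
  rw [smoothFn_sum_apply]
  change ξ.mat (h * x) i j = _
  rw [ξ.mat_mul, Matrix.mul_apply]
  rfl

/-- Since `ξ(x y) = ξ(x) ξ(y)`, a left-invariant derivative at `x` is `ξ(x)` times the derivative at
the identity. Iterated derivatives thus become matrix products. -/
theorem Irrep.lieDeriv_entry_apply (ξ : Irrep G) (v : GroupLieAlgebra 𝓘(ℝ, E) G) (i j) (x : G) :
    lieDeriv v (ξ.entry E i j) x = (ξ.mat x * ξ.deriv v) i j := by
  have h := congrArg (fun f : SmoothFn E G => f 1) (lieDeriv_translate v x (ξ.entry E i j))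
  simp only [translate_apply, mul_one] at h
  rw [← h, ξ.translate_entry, lieDeriv_sum_smul, smoothFn_sum_apply, Matrix.mul_apply]
  rfl

theorem Irrep.lieDeriv_entry (ξ : Irrep G) (v : GroupLieAlgebra 𝓘(ℝ, E) G) (i j) :
    lieDeriv v (ξ.entry E i j) = ∑ k, ξ.deriv v k j • ξ.entry E i k := by
  ext x
  rw [ξ.lieDeriv_entry_apply, smoothFn_sum_apply, Matrix.mul_apply]
  exact Finset.sum_congr rfl fun k _ => mul_comm _ _

theorem Irrep.foldr_lieDeriv_entry (ξ : Irrep G) (w : List (GroupLieAlgebra 𝓘(ℝ, E) G)) (i j) :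
    w.foldr lieDeriv (ξ.entry E i j) = ∑ k, (w.map ξ.deriv).prod k j • ξ.entry E i k := by
  induction w with
  | nil =>
    simp only [List.foldr_nil, List.map_nil, List.prod_nil, Matrix.one_apply, ite_smul, one_smul,
      zero_smul, Finset.sum_ite_eq', Finset.mem_univ, if_true]
  | cons v w ih =>
    rw [List.foldr_cons, ih, lieDeriv_sum_smul, List.map_cons, List.prod_cons]
    simp only [ξ.lieDeriv_entry, Finset.smul_sum, Matrix.mul_apply, Finset.sum_smul, smul_smul]
    rw [Finset.sum_comm]
    exact Finset.sum_congr rfl fun k _ => Finset.sum_congr rfl fun l _ => by rw [mul_comm]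

theorem Irrep.foldr_lieDeriv_entry_apply (ξ : Irrep G) (w : List (GroupLieAlgebra 𝓘(ℝ, E) G))
    (i j) (x : G) :
    (w.foldr lieDeriv (ξ.entry E i j)) x = (ξ.mat x * (w.map ξ.deriv).prod) i j := by
  rw [ξ.foldr_lieDeriv_entry, smoothFn_sum_apply, Matrix.mul_apply]
  exact Finset.sum_congr rfl fun k _ => mul_comm _ _

theorem Irrep.deriv_sum (ξ : Irrep G) {n : ℕ} (c : Fin n → ℝ)
    (X : Fin n → GroupLieAlgebra 𝓘(ℝ, E) G) :
    ξ.deriv (∑ a, c a • X a) = ∑ a, (c a : ℂ) • ξ.deriv (X a) := by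
  ext i j
  simp only [Matrix.sum_apply, Matrix.smul_apply, smul_eq_mul]
  exact lieDerivFun_sum c X _ 1

/-- The derivative of a unitary representation is skew-Hermitian. -/
theorem Irrep.conjTranspose_deriv (ξ : Irrep G) (v : GroupLieAlgebra 𝓘(ℝ, E) G) :
    (ξ.deriv v).conjTranspose = -ξ.deriv v := by
  ext i j
  -- `F` is an entry of `ξ(x)^* ξ(x)`, hence constant; its derivative at the identity is the sum of
  -- the differential and its adjoint.
  let F : SmoothFn E G := ∑ k, (1 : ℂ) • mulFn (conjFn (ξ.entry E k i)) (ξ.entry E k j)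
  have hF : (F : G → ℂ) = fun _ => (1 : Matrix (Fin ξ.dim) (Fin ξ.dim) ℂ) i j := by
    ext x
    simp only [F, smoothFn_sum_apply, one_smul, mulFn_apply, conjFn_apply, Irrep.entry_apply]
    rw [← ξ.conjTranspose_mul_mat x, Matrix.mul_apply]
    rfl
  have h1 : lieDeriv v F 1 = 0 := by
    rw [lieDeriv_apply, hF, lieDerivFun_const]
  rw [show F = ∑ k, (1 : ℂ) • mulFn (conjFn (ξ.entry E k i)) (ξ.entry E k j) from rfl,
    lieDeriv_sum_smul, smoothFn_sum_apply] at h1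
  simp only [one_smul, lieDeriv_mulFn, lieDeriv_conjFn, conjFn_apply, Irrep.entry_apply,
    ξ.mat_one, ξ.lieDeriv_entry_apply, Matrix.one_mul, Finset.sum_add_distrib, Matrix.one_apply]
    at h1
  simp only [apply_ite conj, map_one, map_zero, ite_mul, one_mul, zero_mul, mul_ite, mul_one,
    mul_zero, Finset.sum_ite_eq', Finset.mem_univ, if_true] at h1
  change conj (ξ.deriv v j i) = -ξ.deriv v i j
  exact eq_neg_of_add_eq_zero_right h1

/-- Conjugation by a group element. -/
theorem Irrep.exists_ad (ξ : Irrep G) (h : G) (v : GroupLieAlgebra 𝓘(ℝ, E) G) :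
    ξ.mat h * ξ.deriv v * (ξ.mat h).conjTranspose =
      ξ.deriv (show GroupLieAlgebra 𝓘(ℝ, E) G from
        (mfderiv 𝓘(ℝ, E) 𝓘(ℝ, E) (fun y : G => y * h⁻¹) (h * 1) : E →L[ℝ] E)
          ((mfderiv 𝓘(ℝ, E) 𝓘(ℝ, E) (fun y : G => h * y) 1 : E →L[ℝ] E) v)) := by
  ext i j
  let f := ξ.entry E i j
  have hL : MDifferentiableAt 𝓘(ℝ, E) 𝓘(ℝ, E) (fun y : G => h * y) 1 :=
    (contMDiff_mul_left (I := 𝓘(ℝ, E)) (n := ∞)).mdifferentiableAt (by simp)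
  have hR : MDifferentiableAt 𝓘(ℝ, E) 𝓘(ℝ, E) (fun y : G => y * h⁻¹) (h * 1) :=
    (contMDiff_mul_right (I := 𝓘(ℝ, E)) (n := ∞)).mdifferentiableAt (by simp)
  have hf : MDifferentiableAt 𝓘(ℝ, E) 𝓘(ℝ, ℂ) f (h * 1 * h⁻¹) := f.mdifferentiable _
  have hfR : MDifferentiableAt 𝓘(ℝ, E) 𝓘(ℝ, ℂ) (f ∘ fun y : G => y * h⁻¹) (h * 1) :=
    hf.comp (h * 1) hR
  have c1 := mfderiv_comp (1 : G) hfR hL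
  have c2 := mfderiv_comp (h * 1) hf hR
  -- the function `y ↦ ξ(h y h⁻¹)`
  let F : SmoothFn E G := ∑ k, (ξ.mat h⁻¹ k j) • translate h (ξ.entry E i k)
  have hF : ((f ∘ fun y : G => y * h⁻¹) ∘ fun y : G => h * y) = F := by
    ext y
    simp only [F, Function.comp_apply, smoothFn_sum_apply, smoothFn_smul_apply, translate_apply,
      f, Irrep.entry_apply]
    rw [ξ.mat_mul, Matrix.mul_apply]
    exact Finset.sum_congr rfl fun k _ => mul_comm _ _
  have e1 : lieDeriv v F 1 = (ξ.mat h * ξ.deriv v * (ξ.mat h).conjTranspose) i j := by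
    simp only [F, lieDeriv_sum_smul, smoothFn_sum_apply, smoothFn_smul_apply, lieDeriv_translate,
      translate_apply, mul_one, ξ.lieDeriv_entry_apply]
    rw [Matrix.mul_apply, ← ξ.mat_inv]
    exact Finset.sum_congr rfl fun k _ => mul_comm _ _
  rw [← e1]
  have hinv : ∀ (k : G → ℂ) (u : E), lieDerivFun (show GroupLieAlgebra 𝓘(ℝ, E) G from u) k 1 =
      (mfderiv 𝓘(ℝ, E) 𝓘(ℝ, ℂ) k 1 : E →L[ℝ] ℂ) u := by
    intro k u
    have hid : (fun y : G => (1 : G) * y) = id := by ext y; simp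
    have : mulInvariantVectorField (I := 𝓘(ℝ, E))
        (show GroupLieAlgebra 𝓘(ℝ, E) G from u) (1 : G) = u := by
      have hk : ∀ k : G → G, k = id → (mfderiv 𝓘(ℝ, E) 𝓘(ℝ, E) k 1 : E →L[ℝ] E) =
        ContinuousLinearMap.id ℝ E := by rintro k rfl; exact mfderiv_id
      exact DFunLike.congr_fun (hk _ hid) u
    exact congrArg (mfderiv 𝓘(ℝ, E) 𝓘(ℝ, ℂ) k 1 : E →L[ℝ] ℂ) this
  have e2 : lieDeriv v F 1 = (mfderiv 𝓘(ℝ, E) 𝓘(ℝ, ℂ) F 1 : E →L[ℝ] ℂ) v := hinv F v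
  rw [e2]
  refine Eq.trans ?_ (hinv f _).symm
  have hpt : ∀ (x : G), x = 1 → ∀ u : E, (mfderiv 𝓘(ℝ, E) 𝓘(ℝ, ℂ) f x : E →L[ℝ] ℂ) u =
      (mfderiv 𝓘(ℝ, E) 𝓘(ℝ, ℂ) f 1 : E →L[ℝ] ℂ) u := by rintro x rfl u; rfl
  refine Eq.trans ?_ (hpt (h * 1 * h⁻¹) (by simp) _)
  rw [← hF]
  refine (DFunLike.congr_fun c1 v).trans ?_
  exact DFunLike.congr_fun c2 _

variable {n : ℕ} (X : Module.Basis (Fin n) ℝ (GroupLieAlgebra 𝓘(ℝ, E) G))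
  {g : Bundle.ContMDiffRiemannianMetric 𝓘(ℝ, E) ∞ E (fun x : G => TangentSpace 𝓘(ℝ, E) x)}

/-- The matrix of the adjoint representation is orthogonal for a bi-invariant metric. -/
theorem exists_orthogonal_ad (hg : IsBiinvariant g)
    (hX : ∀ i j, g.inner 1 (X i) (X j) = if i = j then 1 else 0) (h : G) :
    ∃ a : Matrix (Fin n) (Fin n) ℝ, a * a.transpose = 1 ∧ ∀ (ξ : Irrep G) (j : Fin n),
      ξ.mat h * ξ.deriv (X j) * (ξ.mat h).conjTranspose = ∑ i, (a i j : ℂ) • ξ.deriv (X i) := by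
  let Ad : E → E := fun v =>
    (mfderiv 𝓘(ℝ, E) 𝓘(ℝ, E) (fun y : G => y * h⁻¹) (h * 1) : E →L[ℝ] E)
          ((mfderiv 𝓘(ℝ, E) 𝓘(ℝ, E) (fun y : G => h * y) 1 : E →L[ℝ] E) v)
  let Xb : Module.Basis (Fin n) ℝ E := X
  let g1 : E →L[ℝ] E →L[ℝ] ℝ := g.inner 1
  have hX' : ∀ i j, g1 (Xb i) (Xb j) = if i = j then 1 else 0 := hX
  -- `Ad` is the differential at the identity of `y ↦ h y h⁻¹`, a left translation followed by a
  -- right one; both are isometries by bi-invariance.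
  have hinv : ∀ v w : E, g1 (Ad v) (Ad w) = g1 v w := by
    intro v w
    have h1 := hg.1 h 1 v w
    have h2 := hg.2 h⁻¹ (h * 1)
      ((mfderiv 𝓘(ℝ, E) 𝓘(ℝ, E) (fun y : G => h * y) 1 : E →L[ℝ] E) v)
      ((mfderiv 𝓘(ℝ, E) 𝓘(ℝ, E) (fun y : G => h * y) 1 : E →L[ℝ] E) w)
    have hpt : ∀ x : G, x = 1 → ∀ u u' : E, (g.inner x : E →L[ℝ] E →L[ℝ] ℝ) u u' = g1 u u' := by
      rintro x rfl u u'; rfl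
    exact (hpt (h * 1 * h⁻¹) (by simp) _ _).symm.trans (h2.trans h1)
  let a : Matrix (Fin n) (Fin n) ℝ := Matrix.of fun i j => Xb.repr (Ad (Xb j)) i
  have hAd : ∀ j, Ad (Xb j) = ∑ i, a i j • Xb i := fun j => (Xb.sum_repr (Ad (Xb j))).symm
  have hata : a.transpose * a = 1 := by
    ext j k
    have h1 := hinv (Xb j) (Xb k)
    rw [hAd, hAd, hX'] at h1
    simp only [map_sum, map_smul, _root_.sum_apply, _root_.smul_apply, hX', smul_eq_mul, mul_ite,
      mul_one, mul_zero, Finset.sum_ite_eq', Finset.mem_univ, if_true] at h1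
    rw [Matrix.mul_apply, Matrix.one_apply, ← h1]
    exact Finset.sum_congr rfl fun i _ => by rw [Matrix.transpose_apply]; ring
  refine ⟨a, mul_eq_one_comm.1 hata, fun ξ j => ?_⟩
  rw [ξ.exists_ad]
  refine Eq.trans ?_ (ξ.deriv_sum (fun i => a i j) X)
  exact congrArg (fun v : GroupLieAlgebra 𝓘(ℝ, E) G => ξ.deriv v) (hAd j)

/-- Conjugation by `ξ(h)` transforms the differentials of an orthonormal basis by an orthogonal
matrix, so the sum of their squares commutes with `ξ(h)`, and Schur's lemma makes it scalar. -/
theorem Irrep.exists_casimir (hg : IsBiinvariant g)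
    (hX : ∀ i j, g.inner 1 (X i) (X j) = if i = j then 1 else 0) (ξ : Irrep G) :
    ∃ c : ℂ, ∑ a, (ξ.deriv (X a)).conjTranspose * ξ.deriv (X a) = c • 1 := by
  refine ξ.eq_smul_one_of_commute _ fun h => ?_
  simp only [ξ.conjTranspose_deriv]
  obtain ⟨a, ha, had⟩ := exists_orthogonal_ad X hg hX h
  have hconj : ξ.mat h * (∑ j, ξ.deriv (X j) * ξ.deriv (X j)) * (ξ.mat h).conjTranspose =
      ∑ j, ξ.deriv (X j) * ξ.deriv (X j) := by
    have h1 : ∀ j, ξ.mat h * (ξ.deriv (X j) * ξ.deriv (X j)) * (ξ.mat h).conjTranspose =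
        (∑ i, (a i j : ℂ) • ξ.deriv (X i)) * (∑ i, (a i j : ℂ) • ξ.deriv (X i)) := by
      intro j
      rw [← had ξ j]
      calc _ = ξ.mat h * ξ.deriv (X j) * 1 * (ξ.deriv (X j) * (ξ.mat h).conjTranspose) := by
            simp only [Matrix.mul_assoc, Matrix.one_mul]
        _ = _ := by rw [← ξ.conjTranspose_mul_mat h]; simp only [Matrix.mul_assoc]
    rw [Finset.mul_sum, Finset.sum_mul]
    simp only [h1, Finset.sum_mul_sum, Matrix.smul_mul, Matrix.mul_smul, smul_smul]
    rw [Finset.sum_comm]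
    refine Finset.sum_congr rfl fun i _ => ?_
    rw [Finset.sum_comm]
    simp only [← Finset.sum_smul]
    have h2 : ∀ k, ∑ j, (a k j : ℂ) * (a i j : ℂ) = if i = k then 1 else 0 := by
      intro k
      have := congrFun (congrFun ha i) k
      rw [Matrix.mul_apply, Matrix.one_apply] at this
      simp only [Matrix.transpose_apply] at this
      have h3 : (∑ j, a k j * a i j) = if i = k then 1 else 0 := by
        rw [← this]; exact Finset.sum_congr rfl fun j _ => mul_comm _ _
      by_cases hik : i = k
      · rw [if_pos hik] at h3 ⊢
        exact_mod_cast h3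
      · rw [if_neg hik] at h3 ⊢
        exact_mod_cast h3
    refine (Finset.sum_congr rfl fun k _ => by rw [h2 k]).trans ?_
    simp
  simp only [Matrix.neg_mul, Finset.sum_neg_distrib, Matrix.mul_neg, neg_inj]
  calc _ = ξ.mat h * (∑ j, ξ.deriv (X j) * ξ.deriv (X j)) *
        ((ξ.mat h).conjTranspose * ξ.mat h) := by rw [ξ.conjTranspose_mul_mat, Matrix.mul_one]
    _ = _ := by rw [← Matrix.mul_assoc, hconj]

theorem Irrep.laplacian_entry (ξ : Irrep G) (i j) (x : G) :
    laplacian X (fun y => ξ.mat y i j) x =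
      (ξ.mat x * ∑ a, (ξ.deriv (X a)).conjTranspose * ξ.deriv (X a)) i j := by
  have h : ∀ a, lieDerivFun (X a) (lieDerivFun (X a) fun y => ξ.mat y i j) x =
      (ξ.mat x * (ξ.deriv (X a) * ξ.deriv (X a))) i j := by
    intro a
    have := ξ.foldr_lieDeriv_entry_apply [X a, X a] i j x
    simp only [List.map_cons, List.map_nil, List.prod_cons, List.prod_nil, mul_one] at this
    exact this
  unfold laplacian
  simp only [h, ξ.conjTranspose_deriv, Matrix.neg_mul, Finset.sum_neg_distrib, Matrix.mul_neg,
    Matrix.neg_apply, Finset.mul_sum, Matrix.sum_apply]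

theorem Irrep.exists_mat_ne_zero (ξ : Irrep G) : ∃ i j, ξ.mat 1 i j ≠ 0 :=
  ⟨⟨0, ξ.dim_pos⟩, ⟨0, ξ.dim_pos⟩, by rw [ξ.mat_one]; simp⟩

/-- The Casimir operator acts by the eigenvalue of the Laplacian. -/
theorem Irrep.casimir (hg : IsBiinvariant g)
    (hX : ∀ i j, g.inner 1 (X i) (X j) = if i = j then 1 else 0) (ξ : Irrep G) :
    0 ≤ laplaceEigenvalue X ξ ∧
    ∑ a, (ξ.deriv (X a)).conjTranspose * ξ.deriv (X a) = (laplaceEigenvalue X ξ : ℂ) • 1 := by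
  obtain ⟨c, hc⟩ := ξ.exists_casimir X hg hX
  let o : Fin ξ.dim := ⟨0, ξ.dim_pos⟩
  -- The scalar is read off from one diagonal entry, a sum of squared moduli; this shows that it is
  -- real and nonnegative.
  let ν : ℝ := ∑ a, ∑ k, ‖ξ.deriv (X a) k o‖ ^ 2
  have hν0 : 0 ≤ ν := Finset.sum_nonneg fun _ _ => Finset.sum_nonneg fun _ _ => by positivity
  have hcν : c = ν := by
    have := congrFun (congrFun hc o) o
    simp only [Matrix.sum_apply, Matrix.mul_apply, Matrix.conjTranspose_apply, Matrix.smul_apply,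
      Matrix.one_apply_eq, smul_eq_mul, mul_one] at this
    rw [← this]
    simp only [ν]
    push_cast
    refine Finset.sum_congr rfl fun a _ => Finset.sum_congr rfl fun k _ => ?_
    exact Complex.conj_mul' _
  -- The infimum defining `laplaceEigenvalue` is taken over exactly one number, since some
  -- coefficient of `ξ` does not vanish at the identity.
  have hset : {t : ℝ | ∀ i j x, laplacian X (fun y => ξ.mat y i j) x = t * ξ.mat x i j} = {ν} := by
    ext t
    simp only [mem_ofPred_eq, mem_singleton_iff, ξ.laplacian_entry X, hc, hcν, Matrix.mul_smul,
      Matrix.mul_one, Matrix.smul_apply, smul_eq_mul]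
    constructor
    · intro h
      obtain ⟨i, j, hij⟩ := ξ.exists_mat_ne_zero
      have := mul_right_cancel₀ hij (h i j 1)
      exact_mod_cast this.symm
    · rintro rfl i j x; rfl
  have hle : laplaceEigenvalue X ξ = ν := by
    rw [laplaceEigenvalue, hset, csInf_singleton]
  rw [hle, hc, hcν]
  exact ⟨hν0, rfl⟩

end Casimir

/-! ### Euclidean norms of complex vectors. -/

section VecNorm

/-- The Euclidean norm of a vector of complex numbers. -/
def vecNorm {d : ℕ} (v : Fin d → ℂ) : ℝ := ‖(WithLp.toLp 2 v : EuclideanSpace ℂ (Fin d))‖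

variable {d : ℕ}

theorem vecNorm_nonneg (v : Fin d → ℂ) : 0 ≤ vecNorm v := norm_nonneg _

theorem vecNorm_sq (v : Fin d → ℂ) : vecNorm v ^ 2 = ∑ i, ‖v i‖ ^ 2 := by
  rw [vecNorm, EuclideanSpace.norm_sq_eq]

theorem vecNorm_add_le (v w : Fin d → ℂ) : vecNorm (v + w) ≤ vecNorm v + vecNorm w :=
  norm_add_le (WithLp.toLp 2 v : EuclideanSpace ℂ (Fin d)) (WithLp.toLp 2 w)

theorem vecNorm_smul (c : ℂ) (v : Fin d → ℂ) : vecNorm (c • v) = ‖c‖ * vecNorm v :=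
  norm_smul c (WithLp.toLp 2 v : EuclideanSpace ℂ (Fin d))

theorem vecNorm_zero : vecNorm (0 : Fin d → ℂ) = 0 :=
  norm_zero (E := EuclideanSpace ℂ (Fin d))

theorem vecNorm_sum_le {ι : Type*} (s : Finset ι) (v : ι → Fin d → ℂ) :
    vecNorm (∑ i ∈ s, v i) ≤ ∑ i ∈ s, vecNorm (v i) := by
  classical
  induction s using Finset.induction_on with
  | empty => simp [vecNorm_zero]
  | insert i s hi ih =>
    rw [Finset.sum_insert hi, Finset.sum_insert hi]
    exact (vecNorm_add_le _ _).trans (by gcongr)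

theorem norm_apply_le_vecNorm (v : Fin d → ℂ) (i : Fin d) : ‖v i‖ ≤ vecNorm v :=
  PiLp.norm_apply_le (WithLp.toLp 2 v : EuclideanSpace ℂ (Fin d)) i

theorem norm_sum_conj_mul_le (v w : Fin d → ℂ) :
    ‖∑ i, conj (w i) * v i‖ ≤ vecNorm w * vecNorm v := by
  have h := norm_inner_le_norm (𝕜 := ℂ) (WithLp.toLp 2 w : EuclideanSpace ℂ (Fin d))
    (WithLp.toLp 2 v)
  rw [PiLp.inner_apply] at h
  simp only [RCLike.inner_apply] at h
  have h' : ∑ i, conj (w i) * v i = ∑ i, v i * conj (w i) :=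
    Finset.sum_congr rfl fun i _ => mul_comm _ _
  rw [h']
  exact h

theorem sum_conj_mul_self (v : Fin d → ℂ) : ∑ i, conj (v i) * v i = ((vecNorm v ^ 2 : ℝ) : ℂ) := by
  rw [vecNorm_sq]
  push_cast
  exact Finset.sum_congr rfl fun i _ => Complex.conj_mul' _

theorem ofReal_vecNorm_sq_mulVec {m : ℕ} (A : Matrix (Fin m) (Fin d) ℂ) (v : Fin d → ℂ) :
    ((vecNorm (A.mulVec v) ^ 2 : ℝ) : ℂ) = ∑ i, conj (v i) * (A.conjTranspose * A).mulVec v i := by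
  rw [← sum_conj_mul_self, ← Matrix.mulVec_mulVec]
  have h : star (A.mulVec v) ⬝ᵥ A.mulVec v = star v ⬝ᵥ A.conjTranspose.mulVec (A.mulVec v) := by
    rw [Matrix.star_mulVec, ← Matrix.dotProduct_mulVec]
  exact h

theorem vecNorm_mulVec_of_isometry {m : ℕ} {A : Matrix (Fin m) (Fin d) ℂ}
    (hA : A.conjTranspose * A = 1) (v : Fin d → ℂ) : vecNorm (A.mulVec v) = vecNorm v := by
  have h := ofReal_vecNorm_sq_mulVec A v
  rw [hA, Matrix.one_mulVec, sum_conj_mul_self] at h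
  have h2 : vecNorm (A.mulVec v) ^ 2 = vecNorm v ^ 2 := by exact_mod_cast h
  exact (sq_eq_sq₀ (vecNorm_nonneg _) (vecNorm_nonneg _)).1 h2

end VecNorm

/-! ### The weight: bounds for derivatives, Lipschitz estimates and the zero eigenvalue. -/

section Weights

open Set Filter Topology MeasureTheory

variable {E : Type*} [NormedAddCommGroup E] [NormedSpace ℝ E]
  {G : Type*} [TopologicalSpace G] [ChartedSpace E G] [Group G] [LieGroup 𝓘(ℝ, E) ∞ G]
  [CompactSpace G] [T2Space G] [FiniteDimensional ℝ E] [IsTopologicalGroup G]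
  {n : ℕ} (X : Module.Basis (Fin n) ℝ (GroupLieAlgebra 𝓘(ℝ, E) G))
  {g : Bundle.ContMDiffRiemannianMetric 𝓘(ℝ, E) ∞ E (fun x : G => TangentSpace 𝓘(ℝ, E) x)}

theorem Irrep.vecNorm_mat_mulVec (ξ : Irrep G) (x : G) (v : Fin ξ.dim → ℂ) :
    vecNorm ((ξ.mat x).mulVec v) = vecNorm v :=
  vecNorm_mulVec_of_isometry (ξ.conjTranspose_mul_mat x) v

variable (hg : IsBiinvariant g) (hX : ∀ i j, g.inner 1 (X i) (X j) = if i = j then 1 else 0)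

include hg hX

theorem one_le_weight (ξ : Irrep G) : 1 ≤ weight X ξ := by
  rw [weight, Real.one_le_sqrt]
  linarith [(ξ.casimir X hg hX).1]

theorem weight_pos (ξ : Irrep G) : 0 < weight X ξ := one_pos.trans_le (one_le_weight X hg hX ξ)

theorem weight_sq (ξ : Irrep G) : weight X ξ ^ 2 = 1 + laplaceEigenvalue X ξ :=
  Real.sq_sqrt (by linarith [(ξ.casimir X hg hX).1])

/-- This is the quadratic form of the Casimir identity; through it the weight controls all
derivatives, with constants independent of the dimension of `ξ`. -/
theorem Irrep.sum_vecNorm_deriv_sq (ξ : Irrep G) (v : Fin ξ.dim → ℂ) :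
    ∑ a, vecNorm ((ξ.deriv (X a)).mulVec v) ^ 2 = laplaceEigenvalue X ξ * vecNorm v ^ 2 := by
  have h : ((∑ a, vecNorm ((ξ.deriv (X a)).mulVec v) ^ 2 : ℝ) : ℂ) =
      ((laplaceEigenvalue X ξ * vecNorm v ^ 2 : ℝ) : ℂ) := by
    rw [Complex.ofReal_sum]
    simp only [ofReal_vecNorm_sq_mulVec]
    rw [Finset.sum_comm]
    simp only [← Finset.mul_sum]
    have h1 : ∀ i, ∑ a, ((ξ.deriv (X a)).conjTranspose * ξ.deriv (X a)).mulVec v i =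
        (laplaceEigenvalue X ξ : ℂ) * v i := by
      intro i
      have := congrArg (fun M => M.mulVec v i) (ξ.casimir X hg hX).2
      simp only [Matrix.smul_mulVec, Matrix.one_mulVec, Matrix.sum_mulVec, Finset.sum_apply,
        Pi.smul_apply, smul_eq_mul] at this
      exact this
    simp only [h1]
    rw [Complex.ofReal_mul, ← sum_conj_mul_self, Finset.mul_sum]
    exact Finset.sum_congr rfl fun i _ => by ring
  exact_mod_cast h

theorem Irrep.vecNorm_deriv_basis_le (ξ : Irrep G) (a : Fin n) (v : Fin ξ.dim → ℂ) :
    vecNorm ((ξ.deriv (X a)).mulVec v) ≤ weight X ξ * vecNorm v := by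
  refine (sq_le_sq₀ (vecNorm_nonneg _)
    (mul_nonneg (weight_pos X hg hX ξ).le (vecNorm_nonneg _))).1 ?_
  have h1 := Finset.single_le_sum (f := fun a => vecNorm ((ξ.deriv (X a)).mulVec v) ^ 2)
    (fun a _ => by positivity) (Finset.mem_univ a)
  rw [ξ.sum_vecNorm_deriv_sq X hg hX] at h1
  rw [mul_pow, weight_sq X hg hX]
  nlinarith [sq_nonneg (vecNorm v)]

theorem vecNorm_deriv_le (v : GroupLieAlgebra 𝓘(ℝ, E) G) :
    ∃ C, 0 ≤ C ∧ ∀ (ξ : Irrep G) (u : Fin ξ.dim → ℂ),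
      vecNorm ((ξ.deriv v).mulVec u) ≤ C * weight X ξ * vecNorm u := by
  refine ⟨∑ a, |X.repr v a|, Finset.sum_nonneg fun _ _ => abs_nonneg _, fun ξ u => ?_⟩
  have h : ξ.deriv v = ∑ a, (X.repr v a : ℂ) • ξ.deriv (X a) := by
    rw [← ξ.deriv_sum, X.sum_repr]
  rw [h, Matrix.sum_mulVec]
  refine (vecNorm_sum_le _ _).trans ?_
  rw [Finset.sum_mul, Finset.sum_mul]
  refine Finset.sum_le_sum fun a _ => ?_
  rw [Matrix.smul_mulVec, vecNorm_smul, Complex.norm_real, Real.norm_eq_abs, mul_assoc]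
  gcongr
  exact ξ.vecNorm_deriv_basis_le X hg hX a u

theorem vecNorm_deriv_word_le (w : List (GroupLieAlgebra 𝓘(ℝ, E) G)) :
    ∃ C, 0 ≤ C ∧ ∀ (ξ : Irrep G) (u : Fin ξ.dim → ℂ),
      vecNorm ((w.map ξ.deriv).prod.mulVec u) ≤ C * weight X ξ ^ w.length * vecNorm u := by
  induction w with
  | nil => exact ⟨1, zero_le_one, fun ξ u => by simp⟩
  | cons v w ih =>
    obtain ⟨C, hC, h⟩ := ih
    obtain ⟨D, hD, h'⟩ := vecNorm_deriv_le X hg hX v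
    refine ⟨D * C, mul_nonneg hD hC, fun ξ u => ?_⟩
    have hw := (weight_pos X hg hX ξ).le
    rw [List.map_cons, List.prod_cons, ← Matrix.mulVec_mulVec, List.length_cons]
    calc _ ≤ D * weight X ξ * vecNorm ((w.map ξ.deriv).prod.mulVec u) := h' ξ _
      _ ≤ D * weight X ξ * (C * weight X ξ ^ w.length * vecNorm u) := by
        gcongr; exact h ξ u
      _ = _ := by ring

/-- Polynomial bounds for the derivatives of the coefficients. -/
theorem norm_foldr_lieDeriv_entry_le (w : List (GroupLieAlgebra 𝓘(ℝ, E) G)) :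
    ∃ C, 0 ≤ C ∧ ∀ (ξ : Irrep G) (i j : Fin ξ.dim) (x : G),
      ‖(w.foldr lieDeriv (ξ.entry E i j)) x‖ ≤ C * weight X ξ ^ w.length := by
  obtain ⟨C, hC, h⟩ := vecNorm_deriv_word_le X hg hX w
  refine ⟨C, hC, fun ξ i j x => ?_⟩
  rw [ξ.foldr_lieDeriv_entry_apply]
  let e : Fin ξ.dim → ℂ := Pi.single j 1
  have he : vecNorm e = 1 := by
    have : vecNorm e ^ 2 = 1 := by
      rw [vecNorm_sq, Finset.sum_eq_single j]
      · simp [e]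
      · intro b _ hb; simp [e, Pi.single_eq_of_ne hb]
      · simp
    nlinarith [vecNorm_nonneg e]
  have hcol : (ξ.mat x * (w.map ξ.deriv).prod) i j =
      (ξ.mat x).mulVec ((w.map ξ.deriv).prod.mulVec e) i := by
    rw [Matrix.mulVec_mulVec, Matrix.mulVec_single_one]
    rfl
  rw [hcol]
  refine (norm_apply_le_vecNorm _ i).trans ?_
  rw [ξ.vecNorm_mat_mulVec]
  simpa [he] using h ξ e

/-- In the chart at the identity, representations are Lipschitz with constant controlled by
the weight. -/
theorem exists_lipschitz_bound : ∃ r > (0 : ℝ), ∃ K > (0 : ℝ),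
    Metric.ball (idCoord E G) r ⊆ (extChartAt 𝓘(ℝ, E) (1 : G)).target ∧
    ∀ (ξ : Irrep G) (j : Fin ξ.dim), ∀ u ∈ Metric.ball (idCoord E G) r,
      ∀ u' ∈ Metric.ball (idCoord E G) r,
      vecNorm (fun i => ξ.mat (idChartSymm E G u') i j - ξ.mat (idChartSymm E G u) i j) ≤
        K * weight X ξ * ‖u' - u‖ := by
  obtain ⟨r, hr, K, hK, c, h1, h2, h3, h4⟩ := exists_local_coframe X
  refine ⟨r, hr, n * K + 1, by positivity, h1, fun ξ j u hu u' hu' => ?_⟩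
  set δ : Fin ξ.dim → ℂ := fun i => ξ.mat (idChartSymm E G u') i j - ξ.mat (idChartSymm E G u) i j
    with hδ
  have hw := weight_pos X hg hX ξ
  -- The column difference `δ` is paired with the moving column. The increment of this scalar
  -- function between the two points is `‖δ‖²`, while its left-invariant derivatives are at most
  -- `‖δ‖` times the weight. The mean value inequality then allows one factor `‖δ‖` to be cancelled,
  -- with no dependence on the dimension.
  let f : SmoothFn E G := ∑ i, conj (δ i) • ξ.entry E i j
  have hf : ∀ x, f x = ∑ i, conj (δ i) * ξ.mat x i j := fun x => by
    simp only [f, smoothFn_sum_apply]; rfl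
  have hXf : ∀ a x, ‖lieDerivFun (X a) f x‖ ≤ vecNorm δ * weight X ξ := by
    intro a x
    have e1 : lieDerivFun (X a) f x = ∑ i, conj (δ i) * (ξ.mat x * ξ.deriv (X a)) i j := by
      rw [← lieDeriv_apply]
      simp only [f, lieDeriv_sum_smul, smoothFn_sum_apply, smoothFn_smul_apply,
        ξ.lieDeriv_entry_apply]
    let e : Fin ξ.dim → ℂ := Pi.single j 1
    have he : vecNorm e = 1 := by
      have : vecNorm e ^ 2 = 1 := by
        rw [vecNorm_sq, Finset.sum_eq_single j]
        · simp [e]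
        · intro b _ hb; simp [e, Pi.single_eq_of_ne hb]
        · simp
      nlinarith [vecNorm_nonneg e]
    have hcol : ∀ i, (ξ.mat x * ξ.deriv (X a)) i j =
        (ξ.mat x).mulVec ((ξ.deriv (X a)).mulVec e) i := by
      intro i
      rw [Matrix.mulVec_mulVec, Matrix.mulVec_single_one]
      rfl
    rw [e1]
    simp only [hcol]
    refine (norm_sum_conj_mul_le _ _).trans ?_
    rw [ξ.vecNorm_mat_mulVec]
    gcongr
    · exact vecNorm_nonneg _
    · simpa [he] using ξ.vecNorm_deriv_basis_le X hg hX a e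
  have hmv := (convex_ball (idCoord E G) r).norm_image_sub_le_of_norm_hasFDerivWithin_le
    (f := fun u => f (1 * idChartSymm E G u)) (C := n * K * (vecNorm δ * weight X ξ))
    (fun u hu => (h4 f f.mdifferentiable 1 u hu).hasFDerivWithinAt) (fun u hu => by
      refine (norm_sum_le _ _).trans ?_
      have : ∀ a ∈ Finset.univ, ‖(c a u).smulRight
          (lieDerivFun (X a) f (1 * idChartSymm E G u))‖ ≤ K * (vecNorm δ * weight X ξ) := by
        intro a _
        rw [ContinuousLinearMap.norm_smulRight_apply]
        exact mul_le_mul (h3 a u hu) (hXf _ _) (norm_nonneg _) hK.le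
      refine (Finset.sum_le_sum this).trans_eq ?_
      simp [mul_assoc]) hu hu'
  have hfin : f (1 * idChartSymm E G u') - f (1 * idChartSymm E G u) =
      ((vecNorm δ ^ 2 : ℝ) : ℂ) := by
    rw [← sum_conj_mul_self, hf, hf, ← Finset.sum_sub_distrib]
    refine Finset.sum_congr rfl fun i _ => ?_
    simp only [one_mul, ← mul_sub]
    rfl
  rw [hfin, Complex.norm_real, Real.norm_of_nonneg (sq_nonneg _)] at hmv
  have hv0 := vecNorm_nonneg δ
  rcases hv0.eq_or_lt with h0 | h0
  · rw [← h0]; positivity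
  · have h5 : vecNorm δ * vecNorm δ ≤ vecNorm δ * (n * K * weight X ξ * ‖u' - u‖) := by
      calc vecNorm δ * vecNorm δ = vecNorm δ ^ 2 := by ring
        _ ≤ _ := hmv
        _ = _ := by ring
    have h6 := le_of_mul_le_mul_left h5 h0
    have h7 : 0 ≤ weight X ξ * ‖u' - u‖ := by positivity
    nlinarith

/-- A representation with vanishing Laplace eigenvalue is trivial. -/
theorem Irrep.mat_eq_one_of_eigenvalue_eq_zero [ConnectedSpace G] (ξ : Irrep G)
    (h0 : laplaceEigenvalue X ξ = 0) (x : G) : ξ.mat x = 1 := by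
  have hD : ∀ a v, (ξ.deriv (X a)).mulVec v = 0 := by
    intro a v
    have h1 := ξ.sum_vecNorm_deriv_sq X hg hX v
    rw [h0, zero_mul] at h1
    have h2 := (Finset.sum_eq_zero_iff_of_nonneg (fun a _ => by positivity)).1 h1 a
      (Finset.mem_univ _)
    ext i
    have h3 := norm_apply_le_vecNorm ((ξ.deriv (X a)).mulVec v) i
    rw [pow_eq_zero_iff two_ne_zero] at h2
    rw [h2] at h3
    simpa using h3
  have hD' : ∀ a, ξ.deriv (X a) = 0 := fun a => by
    ext i j
    have := congrFun (hD a (Pi.single j 1)) i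
    rw [Matrix.mulVec_single_one] at this
    exact this
  obtain ⟨r, hr, K, hK, c, h1, h2, h3, h4⟩ := exists_local_coframe X
  rw [← ξ.mat_one]
  ext i j
  -- All left-invariant derivatives vanish, so the coefficients are constant on translates of a
  -- chart ball; connectedness makes them globally constant.
  have hloc : IsLocallyConstant fun x => ξ.mat x i j := by
    rw [IsLocallyConstant.iff_eventually_eq]
    intro x
    let f := ξ.entry E i j
    have hconst : ∀ u ∈ Metric.ball (idCoord E G) r, f (x * idChartSymm E G u) =
        f (x * idChartSymm E G (idCoord E G)) := by
      intro u hu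
      refine (convex_ball (idCoord E G) r).is_const_of_fderivWithin_eq_zero (𝕜 := ℝ)
        (f := fun u => f (x * idChartSymm E G u))
        (fun u hu => (h4 f f.mdifferentiable x u hu).differentiableAt.differentiableWithinAt)
        (fun u hu => ?_) hu (Metric.mem_ball_self hr)
      rw [fderivWithin_of_isOpen Metric.isOpen_ball hu, (h4 f f.mdifferentiable x u hu).fderiv]
      refine Finset.sum_eq_zero fun a _ => ?_
      rw [← lieDeriv_apply, ξ.lieDeriv_entry_apply, hD' a, Matrix.mul_zero, Matrix.zero_apply]
      ext w
      simp
    have hch : Tendsto (fun y => extChartAt 𝓘(ℝ, E) (1 : G) (x⁻¹ * y)) (𝓝 x)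
        (𝓝 (idCoord E G)) := by
      have : Tendsto (fun y => extChartAt 𝓘(ℝ, E) (1 : G) (x⁻¹ * y)) (𝓝 x)
        (𝓝 (extChartAt 𝓘(ℝ, E) (1 : G) (x⁻¹ * x))) :=
        (contMDiffAt_idChart_translate (E := E) x).continuousAt
      rwa [inv_mul_cancel] at this
    filter_upwards [eventuallyEq_comp_idChart (E := E) (F := f) x,
      hch (Metric.ball_mem_nhds _ hr)] with y hy1 hy2
    have h5 := hconst _ hy2
    rw [idChartSymm_idCoord, mul_one] at h5
    exact hy1.trans h5
  exact hloc.apply_eq_of_isPreconnected isPreconnected_univ (mem_univ _) (mem_univ _)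

end Weights

/-! ### Functions with prescribed Fourier coefficient at one representation. -/

section Synthesis

open Set Filter Topology MeasureTheory

variable {E : Type*} [NormedAddCommGroup E] [NormedSpace ℝ E]
  {G : Type*} [TopologicalSpace G] [ChartedSpace E G] [Group G] [LieGroup 𝓘(ℝ, E) ∞ G]
  [CompactSpace G] [T2Space G] [FiniteDimensional ℝ E] [IsTopologicalGroup G]

variable (E) in
/-- The function `d_ξ Tr(ξ(x) A)` with Fourier coefficient `A` at `ξ`. -/
def synth (ξ : Irrep G) (A : Matrix (Fin ξ.dim) (Fin ξ.dim) ℂ) : SmoothFn E G :=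
  ∑ p : Fin ξ.dim × Fin ξ.dim, (ξ.dim * A p.1 p.2 : ℂ) • ξ.entry E p.2 p.1

theorem synth_apply (ξ : Irrep G) (A : Matrix (Fin ξ.dim) (Fin ξ.dim) ℂ) (x : G) :
    synth E ξ A x = ξ.dim * (A * ξ.mat x).trace := by
  rw [synth, smoothFn_sum_apply, Fintype.sum_prod_type, Matrix.trace, Finset.mul_sum]
  refine Finset.sum_congr rfl fun i _ => ?_
  rw [Matrix.diag_apply, Matrix.mul_apply, Finset.mul_sum]
  refine Finset.sum_congr rfl fun j _ => ?_
  rw [smoothFn_smul_apply, Irrep.entry_apply, mul_assoc]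

variable [MeasurableSpace G] [BorelSpace G]
  (μ : Measure G) [μ.IsHaarMeasure] [IsProbabilityMeasure μ]

/-- A Fourier coefficient as a linear form on smooth functions. -/
def fourierLin (ξ : Irrep G) (i j : Fin ξ.dim) : SmoothFn E G →ₗ[ℂ] ℂ where
  toFun f := fourierCoeff μ f ξ i j
  map_add' f g := by
    simp only [fourierCoeff_apply, ContMDiffMap.coe_add, Pi.add_apply, add_mul]
    exact integral_add
      (integrable_of_continuous μ (f.continuous.mul (ξ.continuous_entry j i).star))
      (integrable_of_continuous μ (g.continuous.mul (ξ.continuous_entry j i).star))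
  map_smul' c f := by
    simp only [fourierCoeff_apply, smoothFn_smul_apply, mul_assoc]
    exact integral_const_mul c _

theorem fourierLin_apply (ξ : Irrep G) (i j) (f : SmoothFn E G) :
    fourierLin μ ξ i j f = fourierCoeff μ f ξ i j := rfl

theorem fourierCoeff_smoothFn_sum {ι : Type*} (s : Finset ι) (f : ι → SmoothFn E G) (ξ : Irrep G) :
    fourierCoeff μ (∑ a ∈ s, f a : SmoothFn E G) ξ = ∑ a ∈ s, fourierCoeff μ (f a) ξ := by
  ext i j
  rw [← fourierLin_apply, map_sum, Matrix.sum_apply]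
  rfl

theorem fourierCoeff_smoothFn_sub (f g : SmoothFn E G) (ξ : Irrep G) :
    fourierCoeff μ (f - g : SmoothFn E G) ξ = fourierCoeff μ f ξ - fourierCoeff μ g ξ := by
  ext i j
  rw [← fourierLin_apply, map_sub, Matrix.sub_apply]
  rfl

theorem fourierCoeff_smoothFn_smul (c : ℂ) (f : SmoothFn E G) (ξ : Irrep G) :
    fourierCoeff μ (c • f : SmoothFn E G) ξ = c • fourierCoeff μ f ξ := by
  ext i j
  rw [← fourierLin_apply, map_smul, Matrix.smul_apply]
  rfl

theorem fourierCoeff_synth_self (ξ : Irrep G) (A : Matrix (Fin ξ.dim) (Fin ξ.dim) ℂ) :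
    fourierCoeff μ (synth E ξ A) ξ = A := by
  classical
  ext k l
  rw [synth, fourierCoeff_smoothFn_sum, Matrix.sum_apply, Finset.sum_eq_single (k, l)]
  · rw [fourierCoeff_smoothFn_smul, Matrix.smul_apply]
    have := fourierCoeff_entry_self μ ξ l k k l
    rw [if_pos ⟨rfl, rfl⟩] at this
    change (ξ.dim * A k l : ℂ) * fourierCoeff μ (fun x => ξ.mat x l k) ξ k l = _
    rw [this, mul_comm (ξ.dim : ℂ), mul_assoc, mul_inv_cancel₀ ξ.dim_ne_zero, mul_one]
  · rintro ⟨i, j⟩ - hne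
    rw [fourierCoeff_smoothFn_smul, Matrix.smul_apply]
    have := fourierCoeff_entry_self μ ξ j i k l
    rw [if_neg (by rintro ⟨rfl, rfl⟩; exact hne rfl)] at this
    change (ξ.dim * A i j : ℂ) * fourierCoeff μ (fun x => ξ.mat x j i) ξ k l = _
    rw [this, mul_zero]
  · simp

theorem fourierCoeff_synth_of_not_equivalent {ξ η : Irrep G} (h : ¬ ξ.Equivalent η)
    (A : Matrix (Fin ξ.dim) (Fin ξ.dim) ℂ) : fourierCoeff μ (synth E ξ A) η = 0 := by
  rw [synth, fourierCoeff_smoothFn_sum]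
  refine Finset.sum_eq_zero fun p _ => ?_
  rw [fourierCoeff_smoothFn_smul]
  change _ • fourierCoeff μ (fun x => ξ.mat x p.2 p.1) η = 0
  rw [fourierCoeff_entry_of_not_equivalent μ h, smul_zero]

open Classical in
theorem fourierCoeff_synth_out (q r : UnitaryDual G)
    (A : ∀ q : UnitaryDual G, Matrix (Fin q.out.dim) (Fin q.out.dim) ℂ) :
    fourierCoeff μ (synth E q.out (A q)) r.out = if q = r then A r else 0 := by
  split_ifs with h
  · subst h; exact fourierCoeff_synth_self μ _ _
  · exact fourierCoeff_synth_of_not_equivalent μ (not_equivalent_out h) _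

/-- The class in `L²` of a smooth function. -/
def smoothL2 (f : SmoothFn E G) : Lp ℂ 2 μ := l2 μ ⟨f, f.continuous⟩

theorem coeFn_smoothL2 (f : SmoothFn E G) : smoothL2 μ f =ᵐ[μ] f :=
  ContinuousMap.coeFn_toLp (p := 2) (𝕜 := ℂ) μ _

theorem fourierCoeff_smoothL2 (f : SmoothFn E G) (ξ : Irrep G) :
    fourierCoeff μ (smoothL2 μ f) ξ = fourierCoeff μ f ξ :=
  fourierCoeff_congr μ (coeFn_smoothL2 μ f) ξ

theorem norm_smoothL2_sq (f : SmoothFn E G) : ‖smoothL2 μ f‖ ^ 2 = ∫ x, ‖f x‖ ^ 2 ∂μ := by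
  have h := inner_self_eq_norm_sq_to_K (𝕜 := ℂ) (smoothL2 μ f)
  rw [smoothL2, ContinuousMap.inner_toLp] at h
  have h2 : ∫ x, f x * conj (f x) ∂μ = ((∫ x, ‖f x‖ ^ 2 ∂μ : ℝ) : ℂ) := by
    rw [← integral_complex_ofReal]
    refine integral_congr_ae (.of_forall fun x => ?_)
    simp only [Complex.mul_conj']
    push_cast
    rfl
  have h3 : ((∫ x, ‖f x‖ ^ 2 ∂μ : ℝ) : ℂ) = ((‖smoothL2 μ f‖ ^ 2 : ℝ) : ℂ) := by
    rw [← h2]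
    push_cast
    exact h
  exact_mod_cast h3.symm

end Synthesis

/-! ### Polynomial growth of the unitary dual by a covering argument. -/

section Packing

open Set Filter Topology MeasureTheory

variable {E : Type*} [NormedAddCommGroup E] [NormedSpace ℝ E]
  {G : Type*} [TopologicalSpace G] [ChartedSpace E G] [Group G] [LieGroup 𝓘(ℝ, E) ∞ G]
  [CompactSpace G] [T2Space G] [FiniteDimensional ℝ E] [IsTopologicalGroup G]
  {n : ℕ} (X : Module.Basis (Fin n) ℝ (GroupLieAlgebra 𝓘(ℝ, E) G))
  {g : Bundle.ContMDiffRiemannianMetric 𝓘(ℝ, E) ∞ E (fun x : G => TangentSpace 𝓘(ℝ, E) x)}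

/-- The points whose image under every representation is close to the unit matrix, at the scale
given by the weight of the representation. -/
def nearId (s : ℝ) : Set G :=
  {y | ∀ (ξ : Irrep G) (j : Fin ξ.dim),
    vecNorm (fun i => ξ.mat y i j - (1 : Matrix (Fin ξ.dim) (Fin ξ.dim) ℂ) i j) ≤ s * weight X ξ}

theorem isClosed_nearId (s : ℝ) : IsClosed (nearId X s) := by
  simp only [nearId, ofPred_forall]
  refine isClosed_iInter fun ξ => isClosed_iInter fun j => ?_
  refine isClosed_le ?_ continuous_const
  refine Continuous.norm ((PiLp.continuous_toLp 2 _).comp ?_)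
  exact continuous_pi fun i => (ξ.continuous_entry i j).sub continuous_const

variable (hg : IsBiinvariant g) (hX : ∀ i j, g.inner 1 (X i) (X j) = if i = j then 1 else 0)

include hg hX

theorem nearId_mono {s t : ℝ} (h : s ≤ t) : nearId X s ⊆ nearId X t := fun _ hy ξ j =>
  (hy ξ j).trans (mul_le_mul_of_nonneg_right h (weight_pos X hg hX ξ).le)

/-- An open set is covered by `N ^ n` translates of the set of points close to the identity at
scale `K / N`. -/
theorem exists_open_cover_nearId : ∃ (U : Set G) (K : ℝ), IsOpen U ∧ U.Nonempty ∧ 0 ≤ K ∧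
    ∀ N : ℕ, 0 < N → ∃ a : (Fin n → Fin N) → G, U ⊆ ⋃ k, {y | (a k)⁻¹ * y ∈ nearId X (K / N)} := by
  obtain ⟨r, hr, K, hK, hball, hlip⟩ := exists_lipschitz_bound X hg hX
  let Xb : Module.Basis (Fin n) ℝ E := X
  let S : ℝ := ∑ a, ‖Xb a‖
  have hS : 0 ≤ S := Finset.sum_nonneg fun _ _ => norm_nonneg _
  -- This side length keeps the coordinate cube of side `ρ` inside the ball of radius `r`, because
  -- `ρ * S < r`.
  let ρ : ℝ := r / (S + 1)
  have hρ : 0 < ρ := by positivity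
  have hρS : ρ * S < r := by
    rw [div_mul_eq_mul_div, div_lt_iff₀ (by positivity)]
    nlinarith
  have hnorm : ∀ (t : Fin n → ℝ) (c : ℝ), (∀ a, |t a| ≤ c) → ‖∑ a, t a • Xb a‖ ≤ c * S := by
    intro t c ht
    refine (norm_sum_le _ _).trans ?_
    rw [Finset.mul_sum]
    refine Finset.sum_le_sum fun a _ => ?_
    rw [norm_smul, Real.norm_eq_abs]
    gcongr
    exact ht a
  have hin : ∀ t : Fin n → ℝ, (∀ a, |t a| ≤ ρ) →
      idCoord E G + ∑ a, t a • Xb a ∈ Metric.ball (idCoord E G) r := by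
    intro t ht
    rw [mem_ball_iff_norm, add_sub_cancel_left]
    exact (hnorm t ρ ht).trans_lt hρS
  let V : Set E := {u | ∀ a, Xb.repr (u - idCoord E G) a ∈ Ioo 0 ρ}
  have hcont : ∀ a, Continuous fun u => Xb.repr (u - idCoord E G) a := fun a =>
    (LinearMap.continuous_of_finiteDimensional (Xb.coord a)).comp (continuous_id.sub continuous_const)
  have hV : IsOpen V := by
    simp only [V, ofPred_forall]
    exact isOpen_iInter_of_finite fun a => isOpen_Ioo.preimage (hcont a)
  have hVeq : ∀ u, u = idCoord E G + ∑ a, Xb.repr (u - idCoord E G) a • Xb a := fun u => by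
    rw [Xb.sum_repr]; abel
  have hVball : V ⊆ Metric.ball (idCoord E G) r := by
    intro u hu
    rw [hVeq u]
    exact hin _ fun a => by rw [abs_of_pos (hu a).1]; exact (hu a).2.le
  refine ⟨(extChartAt 𝓘(ℝ, E) (1 : G)).source ∩ extChartAt 𝓘(ℝ, E) (1 : G) ⁻¹' V, K * (ρ * S),
    isOpen_extChartAt_preimage' (I := 𝓘(ℝ, E)) (1 : G) hV, ?_, by positivity, fun N hN => ?_⟩
  · let u := idCoord E G + ∑ a, (ρ / 2) • Xb a
    have hu : u ∈ V := by
      intro a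
      have : Xb.repr (u - idCoord E G) a = ρ / 2 := by
        rw [add_sub_cancel_left, Xb.repr_sum_self fun _ => ρ / 2]
      rw [this]
      constructor <;> linarith
    have hut := hball (hVball hu)
    exact ⟨_, (extChartAt 𝓘(ℝ, E) (1 : G)).map_target hut, by
      rw [mem_preimage, (extChartAt 𝓘(ℝ, E) (1 : G)).right_inv hut]; exact hu⟩
  · have hN' : (0 : ℝ) < N := by exact_mod_cast hN
    -- The cube is cut into `N ^ n` cells of side `ρ / N`, and the translates are centred at their
    -- lower corners. A point is within `ρ / N * S` of the corner of its cell, which explains the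
    -- constant `K * (ρ * S)`.
    refine ⟨fun k => idChartSymm E G (idCoord E G + ∑ a, ((k a : ℕ) * (ρ / N) : ℝ) • Xb a), ?_⟩
    rintro y ⟨hy1, hy2⟩
    set u := extChartAt 𝓘(ℝ, E) (1 : G) y with hu
    have hyu : y = idChartSymm E G u := ((extChartAt 𝓘(ℝ, E) (1 : G)).left_inv hy1).symm
    set t : Fin n → ℝ := fun a => Xb.repr (u - idCoord E G) a with ht
    have ht0 : ∀ a, 0 < t a := fun a => (hy2 a).1
    have ht1 : ∀ a, t a < ρ := fun a => (hy2 a).2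
    have hstep : 0 < ρ / N := by positivity
    have hk : ∀ a, ⌊t a / (ρ / N)⌋₊ < N := fun a => by
      rw [Nat.floor_lt (div_nonneg (ht0 a).le hstep.le), div_lt_iff₀ hstep, mul_div_cancel₀ _ hN'.ne']
      exact ht1 a
    have hfl : ∀ a, (⌊t a / (ρ / N)⌋₊ : ℝ) * (ρ / N) ≤ t a := fun a =>
      (le_div_iff₀ hstep).1 (Nat.floor_le (div_nonneg (ht0 a).le hstep.le))
    have hfl2 : ∀ a, t a ≤ (⌊t a / (ρ / N)⌋₊ : ℝ) * (ρ / N) + ρ / N := fun a => by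
      have := (div_lt_iff₀ hstep).1 (Nat.lt_floor_add_one (t a / (ρ / N)))
      linarith
    refine mem_iUnion.2 ⟨fun a => ⟨_, hk a⟩, fun ξ j => ?_⟩
    simp only
    set u' := idCoord E G + ∑ a, ((⌊t a / (ρ / N)⌋₊ : ℝ) * (ρ / N)) • Xb a with hu'
    have hu'b : u' ∈ Metric.ball (idCoord E G) r := hin _ fun a => by
      rw [abs_of_nonneg (by positivity)]
      exact (hfl a).trans (ht1 a).le
    have hdist : ‖u - u'‖ ≤ ρ / N * S := by
      have : u - u' = ∑ a, (t a - (⌊t a / (ρ / N)⌋₊ : ℝ) * (ρ / N)) • Xb a := by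
        rw [hVeq u, hu']
        simp only [sub_smul, Finset.sum_sub_distrib, ← ht]
        rw [add_sub_add_left_eq_sub]
      rw [this]
      refine hnorm _ _ fun a => ?_
      rw [abs_le]
      constructor <;> linarith [hfl a, hfl2 a]
    have hl := hlip ξ j u' hu'b u (hVball hy2)
    -- With `a` the corner, `ξ(a⁻¹ y) - 1 = ξ(a)⁻¹ (ξ(y) - ξ(a))`, and unitarity removes the factor
    -- `ξ(a)⁻¹`.
    have hcol : (fun i => ξ.mat ((idChartSymm E G u')⁻¹ * y) i j -
        (1 : Matrix (Fin ξ.dim) (Fin ξ.dim) ℂ) i j) =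
        (ξ.mat (idChartSymm E G u')⁻¹).mulVec
          (fun i => ξ.mat (idChartSymm E G u) i j - ξ.mat (idChartSymm E G u') i j) := by
      ext i
      have h1 : (1 : Matrix (Fin ξ.dim) (Fin ξ.dim) ℂ) =
          ξ.mat (idChartSymm E G u')⁻¹ * ξ.mat (idChartSymm E G u') := by
        rw [← ξ.mat_mul, inv_mul_cancel, ξ.mat_one]
      rw [h1, ξ.mat_mul, hyu, Matrix.mul_apply, Matrix.mul_apply, ← Finset.sum_sub_distrib]
      exact Finset.sum_congr rfl fun k _ => (mul_sub _ _ _).symm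
    rw [hcol, ξ.vecNorm_mat_mulVec]
    refine hl.trans ?_
    have hw := weight_pos X hg hX ξ
    calc K * weight X ξ * ‖u - u'‖ ≤ K * weight X ξ * (ρ / N * S) := by gcongr
      _ = K * (ρ * S) / N * weight X ξ := by ring

variable [MeasurableSpace G] [BorelSpace G]
  (μ : Measure G) [μ.IsHaarMeasure] [IsProbabilityMeasure μ]

/-- A fixed open set of positive measure is covered by about `Λ ^ n` translates of the set, all of
the same measure. -/
theorem exists_measure_nearId_ge : ∃ c > (0 : ℝ), ∀ Λ : ℝ, 1 ≤ Λ →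
    c ≤ Λ ^ n * μ.real (nearId X (1 / (2 * Λ))) := by
  obtain ⟨U, K, hU, hUne, hK, hcov⟩ := exists_open_cover_nearId X hg hX
  have hUpos : 0 < μ.real U := ENNReal.toReal_pos (hU.measure_pos μ hUne).ne' (measure_ne_top _ _)
  refine ⟨μ.real U / (2 * K + 2) ^ n, by positivity, fun Λ hΛ => ?_⟩
  -- Large enough for `K / N ≤ 1 / (2 * Λ)`, and at most `Λ * (2 * K + 2)` because `Λ ≥ 1`; the
  -- summand 1 keeps it positive when `K = 0`.
  let N := ⌈2 * Λ * K⌉₊ + 1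
  have hN1 : 2 * Λ * K ≤ N := (Nat.le_ceil _).trans (by simp [N])
  have hN2 : (N : ℝ) ≤ Λ * (2 * K + 2) := by
    have := Nat.ceil_lt_add_one (show 0 ≤ 2 * Λ * K by positivity)
    simp only [N]; push_cast; nlinarith
  have hN0 : 0 < N := Nat.succ_pos _
  have hN0' : (0 : ℝ) < N := by exact_mod_cast hN0
  obtain ⟨a, ha⟩ := hcov N hN0
  have hs : K / N ≤ 1 / (2 * Λ) := by
    rw [div_le_div_iff₀ hN0' (by positivity)]; nlinarith
  have h1 : μ.real U ≤ (N : ℝ) ^ n * μ.real (nearId X (1 / (2 * Λ))) := by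
    calc μ.real U ≤ μ.real (⋃ k, {y | (a k)⁻¹ * y ∈ nearId X (K / N)}) :=
          measureReal_mono ha (measure_ne_top _ _)
      _ ≤ ∑ k, μ.real {y | (a k)⁻¹ * y ∈ nearId X (K / N)} := measureReal_iUnion_fintype_le _
      _ = ∑ k : Fin n → Fin N, μ.real (nearId X (K / N)) := by
          refine Finset.sum_congr rfl fun k _ => ?_
          exact congrArg ENNReal.toReal (measure_preimage_mul μ (a k)⁻¹ _)
      _ = (N : ℝ) ^ n * μ.real (nearId X (K / N)) := by simp
      _ ≤ _ := by
          gcongr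
          · exact measure_ne_top _ _
          · exact nearId_mono X hg hX hs
  rw [div_le_iff₀ (by positivity)]
  calc μ.real U ≤ (N : ℝ) ^ n * μ.real (nearId X (1 / (2 * Λ))) := h1
    _ ≤ (Λ * (2 * K + 2)) ^ n * μ.real (nearId X (1 / (2 * Λ))) := by gcongr
    _ = _ := by rw [mul_pow]; ring

include μ in
/-- Polynomial bound for the number of representations of bounded weight. -/
theorem exists_sum_dim_sq_le : ∃ C > (0 : ℝ), ∀ (Λ : ℝ) (F : Finset (UnitaryDual G)), 1 ≤ Λ →
    (∀ q ∈ F, weight X q.out ≤ Λ) → ∑ q ∈ F, (q.out.dim : ℝ) ^ 2 ≤ C * Λ ^ n := by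
  classical
  obtain ⟨c, hc, hμ⟩ := exists_measure_nearId_ge X hg hX μ
  refine ⟨4 / c, by positivity, fun Λ F hΛ hF => ?_⟩
  set M : ℝ := ∑ q ∈ F, (q.out.dim : ℝ) ^ 2 with hM
  have hM0 : 0 ≤ M := Finset.sum_nonneg fun _ _ => by positivity
  -- `D` is the sum of the characters weighted by dimension. Its squared `L²` norm and its value at
  -- the identity both equal `M`. On `nearId X (1 / (2 * Λ))` it stays above `M / 2` in modulus, so
  -- `M² / 4` times the measure of that set is at most `M`.
  let D : SmoothFn E G := ∑ q ∈ F, synth E q.out 1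
  have hD : ∀ x, D x = ∑ q ∈ F, (q.out.dim : ℂ) * (q.out.mat x).trace := fun x => by
    simp only [D, smoothFn_sum_apply, synth_apply, Matrix.one_mul]
  have hnorm : ∫ x, ‖D x‖ ^ 2 ∂μ = M := by
    rw [← norm_smoothL2_sq]
    refine (hasSum_parseval μ (smoothL2 μ D)).unique ?_
    have : ∀ q : UnitaryDual G, (q.out.dim : ℝ) * hsNormSq (fourierCoeff μ (smoothL2 μ D) q.out) =
        if q ∈ F then (q.out.dim : ℝ) ^ 2 else 0 := by
      intro q
      have h1 : fourierCoeff μ (smoothL2 μ D) q.out = if q ∈ F then 1 else 0 := by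
        rw [fourierCoeff_smoothL2]
        simp only [D]
        rw [fourierCoeff_smoothFn_sum]
        have := fun r => fourierCoeff_synth_out (E := E) μ r q fun _ => 1
        simp only [this]
        rw [Finset.sum_ite_eq']
      rw [h1]
      split_ifs
      · have : hsNormSq (1 : Matrix (Fin q.out.dim) (Fin q.out.dim) ℂ) = q.out.dim := by
          simp only [hsNormSq, Matrix.one_apply, apply_ite, norm_one, norm_zero]
          simp
        rw [this, sq]
      · simp [hsNormSq]
    simp only [this]
    have h2 := hasSum_sum_of_ne_finset_zero (L := SummationFilter.unconditional _) (f := fun q : UnitaryDual G =>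
      if q ∈ F then (q.out.dim : ℝ) ^ 2 else 0) (s := F) fun q hq => if_neg hq
    rwa [Finset.sum_congr rfl fun q hq => if_pos hq] at h2
  have hlow : ∀ y ∈ nearId X (1 / (2 * Λ)), (M / 2) ^ 2 ≤ ‖D y‖ ^ 2 := by
    intro y hy
    have h1 : ‖D y - (M : ℂ)‖ ≤ M / 2 := by
      rw [hD, hM]
      push_cast
      rw [← Finset.sum_sub_distrib, Finset.sum_div]
      refine (norm_sum_le _ _).trans (Finset.sum_le_sum fun q hq => ?_)
      have h2 : (q.out.dim : ℂ) * (q.out.mat y).trace - (q.out.dim : ℂ) ^ 2 =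
          q.out.dim * ∑ i, (q.out.mat y i i - (1 : Matrix (Fin q.out.dim) (Fin q.out.dim) ℂ) i i) := by
        rw [Finset.sum_sub_distrib, mul_sub]
        simp [Matrix.trace, sq]
      rw [h2, norm_mul, Complex.norm_natCast, sq, mul_div_assoc]
      gcongr
      refine (norm_sum_le _ _).trans ?_
      have h3 : ∀ i ∈ Finset.univ, ‖q.out.mat y i i -
          (1 : Matrix (Fin q.out.dim) (Fin q.out.dim) ℂ) i i‖ ≤ 1 / 2 := fun i _ => by
        refine (norm_apply_le_vecNorm (fun k => q.out.mat y k i -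
          (1 : Matrix (Fin q.out.dim) (Fin q.out.dim) ℂ) k i) i).trans ((hy q.out i).trans ?_)
        calc 1 / (2 * Λ) * weight X q.out ≤ 1 / (2 * Λ) * Λ := by gcongr; exact hF q hq
          _ = 1 / 2 := by field_simp
      refine (Finset.sum_le_sum h3).trans_eq ?_
      simp
      ring
    have h2 : M / 2 ≤ ‖D y‖ := by
      have := norm_sub_norm_le (M : ℂ) (M - D y)
      rw [sub_sub_cancel, Complex.norm_real, Real.norm_of_nonneg hM0, norm_sub_rev] at this
      linarith
    gcongr
  have hInt : Integrable (fun x => ‖D x‖ ^ 2) μ :=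
    (Continuous.pow D.continuous.norm 2).integrable_of_hasCompactSupport
      (HasCompactSupport.of_compactSpace _)
  have h5 : (M / 2) ^ 2 * μ.real (nearId X (1 / (2 * Λ))) ≤ M := by
    refine le_of_le_of_eq ?_ hnorm
    calc (M / 2) ^ 2 * μ.real (nearId X (1 / (2 * Λ)))
        = ∫ x in nearId X (1 / (2 * Λ)), (M / 2) ^ 2 ∂μ := by
          rw [setIntegral_const, smul_eq_mul, mul_comm]
      _ ≤ ∫ x in nearId X (1 / (2 * Λ)), ‖D x‖ ^ 2 ∂μ :=
          setIntegral_mono_on (integrable_const _).integrableOn hInt.integrableOn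
            (isClosed_nearId X _).measurableSet hlow
      _ ≤ ∫ x, ‖D x‖ ^ 2 ∂μ := setIntegral_le_integral hInt (.of_forall fun x => by positivity)
  rcases hM0.eq_or_lt with h0 | h0
  · rw [← h0]; positivity
  · have h6 := hμ Λ hΛ
    have h7 : M * μ.real (nearId X (1 / (2 * Λ))) ≤ 4 := by
      have : M * (M * μ.real (nearId X (1 / (2 * Λ)))) ≤ M * 4 := by nlinarith
      exact le_of_mul_le_mul_left this h0
    rw [div_mul_eq_mul_div, le_div_iff₀ hc]
    have h8 : 0 ≤ Λ ^ n := by positivity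
    calc M * c ≤ M * (Λ ^ n * μ.real (nearId X (1 / (2 * Λ)))) := by gcongr
      _ = Λ ^ n * (M * μ.real (nearId X (1 / (2 * Λ)))) := by ring
      _ ≤ Λ ^ n * 4 := by gcongr
      _ = _ := by ring

end Packing

/-! ### Symbols of left-invariant operators, summability over the dual and the spectral gap. -/

section Symbols

open Set Filter Topology MeasureTheory

variable {E : Type*} [NormedAddCommGroup E] [NormedSpace ℝ E]
  {G : Type*} [TopologicalSpace G] [ChartedSpace E G] [Group G] [LieGroup 𝓘(ℝ, E) ∞ G]
  [CompactSpace G] [T2Space G] [FiniteDimensional ℝ E] [IsTopologicalGroup G]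

theorem one_le_dim_sq (q : UnitaryDual G) : (1 : ℝ) ≤ (q.out.dim : ℝ) ^ 2 := by
  have : (1 : ℝ) ≤ q.out.dim := by exact_mod_cast q.out.dim_pos
  nlinarith

/-- The matrices of the values of a linear form at the coefficients of equivalent representations
are conjugate. -/
theorem map_entry_eq_conj {ξ η : Irrep G} {U : Matrix (Fin ξ.dim) (Fin η.dim) ℂ}
    (hU1 : U * U.conjTranspose = 1) (hU : ∀ x, ξ.mat x * U = U * η.mat x)
    (L : SmoothFn E G →ₗ[ℂ] ℂ) :
    (Matrix.of fun i j => L (ξ.entry E i j)) =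
      U * (Matrix.of fun i j => L (η.entry E i j)) * U.conjTranspose := by
  ext i j
  have hξ : ξ.entry E i j = ∑ l, conj (U j l) • ∑ k, U i k • η.entry E k l := by
    ext x
    have : ξ.mat x = U * η.mat x * U.conjTranspose := by
      rw [← hU, Matrix.mul_assoc, hU1, Matrix.mul_one]
    rw [Irrep.entry_apply, this, Matrix.mul_apply, smoothFn_sum_apply]
    refine Finset.sum_congr rfl fun l _ => ?_
    rw [smoothFn_smul_apply, smoothFn_sum_apply, Matrix.mul_apply, mul_comm]
    rfl
  rw [Matrix.of_apply, hξ, map_sum, Matrix.mul_apply]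
  refine Finset.sum_congr rfl fun l _ => ?_
  rw [map_smul, map_sum, Matrix.mul_apply, smul_eq_mul, mul_comm]
  simp only [map_smul]
  rfl

theorem symbol_one (P : SmoothFn E G → SmoothFn E G) (ξ : Irrep G) :
    symbol P 1 ξ = Matrix.of fun i j => P (ξ.entry E i j) 1 := by
  rw [symbol, ξ.mat_one, Matrix.conjTranspose_one, Matrix.one_mul]
  ext i j
  simp only [Matrix.of_apply, applyFun]
  rw [dif_pos (ξ.contMDiff i j)]
  rfl

theorem symbol_eq_conj {ξ η : Irrep G} {U : Matrix (Fin ξ.dim) (Fin η.dim) ℂ}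
    (hU1 : U * U.conjTranspose = 1) (hU : ∀ x, ξ.mat x * U = U * η.mat x)
    (P : SmoothFn E G →L[ℂ] SmoothFn E G) :
    symbol P 1 ξ = U * symbol P 1 η * U.conjTranspose := by
  rw [symbol_one, symbol_one]
  exact map_entry_eq_conj hU1 hU ((evalLin 1).comp P.toLinearMap)

theorem deriv_eq_conj {ξ η : Irrep G} {U : Matrix (Fin ξ.dim) (Fin η.dim) ℂ}
    (hU1 : U * U.conjTranspose = 1) (hU : ∀ x, ξ.mat x * U = U * η.mat x)
    (v : GroupLieAlgebra 𝓘(ℝ, E) G) : ξ.deriv v = U * η.deriv v * U.conjTranspose :=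
  map_entry_eq_conj hU1 hU ((evalLin 1).comp (lieDerivLin v))

/-- A left-invariant operator acts on coefficients by its symbol. -/
theorem apply_entry_of_isLeftInvariant (P : SmoothFn E G →L[ℂ] SmoothFn E G)
    (hP : IsLeftInvariant P) (ξ : Irrep G) (i j) (x : G) :
    P (ξ.entry E i j) x = (ξ.mat x * symbol P 1 ξ) i j := by
  have h := congrArg (fun f : SmoothFn E G => f 1) (hP x (ξ.entry E i j))
  simp only [translate_apply, mul_one] at h
  rw [← h, ξ.translate_entry, map_sum, smoothFn_sum_apply, Matrix.mul_apply, symbol_one]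
  refine Finset.sum_congr rfl fun k _ => ?_
  rw [map_smul]
  rfl

theorem apply_synth_of_isLeftInvariant (P : SmoothFn E G →L[ℂ] SmoothFn E G)
    (hP : IsLeftInvariant P) (ξ : Irrep G) (A : Matrix (Fin ξ.dim) (Fin ξ.dim) ℂ) :
    P (synth E ξ A) = synth E ξ (symbol P 1 ξ * A) := by
  ext x
  have h1 : P (synth E ξ A) x = ξ.dim * (A * (ξ.mat x * symbol P 1 ξ)).trace := by
    rw [synth, map_sum, smoothFn_sum_apply, Fintype.sum_prod_type, Matrix.trace, Finset.mul_sum]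
    refine Finset.sum_congr rfl fun i _ => ?_
    rw [Matrix.diag_apply, Matrix.mul_apply, Finset.mul_sum]
    refine Finset.sum_congr rfl fun j _ => ?_
    rw [map_smul, smoothFn_smul_apply, apply_entry_of_isLeftInvariant P hP, mul_assoc]
  rw [h1, synth_apply, ← Matrix.mul_assoc, Matrix.trace_mul_comm, Matrix.mul_assoc]

variable {n : ℕ} (X : Module.Basis (Fin n) ℝ (GroupLieAlgebra 𝓘(ℝ, E) G))
  {g : Bundle.ContMDiffRiemannianMetric 𝓘(ℝ, E) ∞ E (fun x : G => TangentSpace 𝓘(ℝ, E) x)}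
  (hg : IsBiinvariant g) (hX : ∀ i j, g.inner 1 (X i) (X j) = if i = j then 1 else 0)

include hg hX

theorem laplaceEigenvalue_eq_of_equivalent {ξ η : Irrep G} (h : ξ.Equivalent η) :
    laplaceEigenvalue X ξ = laplaceEigenvalue X η := by
  obtain ⟨U, hU1, hU2, hU⟩ := h
  have h1 := (ξ.casimir X hg hX).2
  have h2 : ∑ a, (ξ.deriv (X a)).conjTranspose * ξ.deriv (X a) =
      U * (∑ a, (η.deriv (X a)).conjTranspose * η.deriv (X a)) * U.conjTranspose := by
    rw [Matrix.mul_sum, Matrix.sum_mul]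
    refine Finset.sum_congr rfl fun a _ => ?_
    rw [deriv_eq_conj hU1 hU]
    simp only [Matrix.conjTranspose_mul, Matrix.conjTranspose_conjTranspose]
    calc U * ((η.deriv (X a)).conjTranspose * U.conjTranspose) *
          (U * η.deriv (X a) * U.conjTranspose)
        = U * ((η.deriv (X a)).conjTranspose * ((U.conjTranspose * U) * η.deriv (X a)) *
          U.conjTranspose) := by simp only [Matrix.mul_assoc]
      _ = _ := by rw [hU2, Matrix.one_mul]; simp only [Matrix.mul_assoc]
  rw [h1, (η.casimir X hg hX).2, Matrix.mul_smul, Matrix.smul_mul, Matrix.mul_one, hU1] at h2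
  have h3 := congrFun (congrFun h2 ⟨0, ξ.dim_pos⟩) ⟨0, ξ.dim_pos⟩
  simpa using h3

theorem weight_eq_of_equivalent {ξ η : Irrep G} (h : ξ.Equivalent η) :
    weight X ξ = weight X η := by
  rw [weight, weight, laplaceEigenvalue_eq_of_equivalent X hg hX h]

variable [MeasurableSpace G] [BorelSpace G]
  (μ : Measure G) [μ.IsHaarMeasure] [IsProbabilityMeasure μ]

include μ

theorem exists_dim_sq_le : ∃ C > (0 : ℝ), ∀ q : UnitaryDual G,
    (q.out.dim : ℝ) ^ 2 ≤ C * weight X q.out ^ n := by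
  obtain ⟨C, hC, h⟩ := exists_sum_dim_sq_le X hg hX μ
  refine ⟨C, hC, fun q => ?_⟩
  simpa using h (weight X q.out) {q} (one_le_weight X hg hX _) (by simp)

/-- Each class contributes at least 1 to the sum of squared dimensions, so that bound also limits
the number of classes. -/
theorem finite_weight_le (Λ : ℝ) : {q : UnitaryDual G | weight X q.out ≤ Λ}.Finite := by
  obtain ⟨C, hC, h⟩ := exists_sum_dim_sq_le X hg hX μ
  by_contra hinf
  obtain ⟨F, hF, hcard⟩ := Set.Infinite.exists_subset_card_eq hinf (⌈C * (max Λ 1) ^ n⌉₊ + 1)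
  have h1 := h (max Λ 1) F (le_max_right _ _) fun q hq => (hF hq).trans (le_max_left _ _)
  have h2 : (F.card : ℝ) ≤ ∑ q ∈ F, (q.out.dim : ℝ) ^ 2 := by
    have := Finset.sum_le_sum fun q (_ : q ∈ F) => one_le_dim_sq q
    simpa using this
  rw [hcard] at h2
  push_cast at h2
  linarith [Nat.le_ceil (C * (max Λ 1) ^ n)]

/-- Group the classes by the integer part `m` of the weight. A group has total squared dimension at
most `C (2 m) ^ n`, and division by `m ^ (n + 2)` leaves a multiple of `1 / m ^ 2`. -/
theorem summable_dim_sq_div_weight_pow :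
    Summable fun q : UnitaryDual G => (q.out.dim : ℝ) ^ 2 / weight X q.out ^ (n + 2) := by
  classical
  obtain ⟨C, hC, h⟩ := exists_sum_dim_sq_le X hg hX μ
  have hs : Summable fun m : ℕ => 1 / (m : ℝ) ^ 2 := Real.summable_one_div_nat_pow.2 one_lt_two
  have hw := fun q : UnitaryDual G => one_le_weight X hg hX q.out
  refine summable_of_sum_le (c := C * 2 ^ n * ∑' m : ℕ, 1 / (m : ℝ) ^ 2)
    (fun q => div_nonneg (by positivity) (pow_nonneg (zero_le_one.trans (hw q)) _)) fun F => ?_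
  let fl : UnitaryDual G → ℕ := fun q => ⌊weight X q.out⌋₊
  have hfl : ∀ q, (1 : ℝ) ≤ fl q := fun q => by
    have : 1 ≤ fl q := Nat.le_floor (by simpa using hw q)
    exact_mod_cast this
  have hfl1 : ∀ q, (fl q : ℝ) ≤ weight X q.out := fun q =>
    Nat.floor_le (zero_le_one.trans (hw q))
  have hfl2 : ∀ q, weight X q.out ≤ 2 * fl q := fun q => by
    have : weight X q.out < fl q + 1 := Nat.lt_floor_add_one _
    linarith [hfl q]
  rw [← Finset.sum_fiberwise_of_maps_to (t := F.image fl) (g := fl)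
    fun q hq => Finset.mem_image_of_mem _ hq]
  have hterm : ∀ m ∈ F.image fl, ∑ q ∈ F with fl q = m,
      (q.out.dim : ℝ) ^ 2 / weight X q.out ^ (n + 2) ≤ C * 2 ^ n * (1 / (m : ℝ) ^ 2) := by
    intro m hm
    obtain ⟨q₀, -, rfl⟩ := Finset.mem_image.1 hm
    have hm0 : (0 : ℝ) < fl q₀ := zero_lt_one.trans_le (hfl q₀)
    have h1 : ∀ q ∈ F.filter (fl · = fl q₀), (q.out.dim : ℝ) ^ 2 / weight X q.out ^ (n + 2) ≤
        (q.out.dim : ℝ) ^ 2 / (fl q₀ : ℝ) ^ (n + 2) := by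
      intro q hq
      rw [← (Finset.mem_filter.1 hq).2]
      have := hfl q
      gcongr
      exact hfl1 q
    refine (Finset.sum_le_sum h1).trans ?_
    rw [← Finset.sum_div]
    have h2 := h (2 * fl q₀) (F.filter (fl · = fl q₀)) (by linarith [hfl q₀]) fun q hq => by
      rw [← (Finset.mem_filter.1 hq).2]; exact hfl2 q
    calc _ ≤ C * (2 * fl q₀) ^ n / (fl q₀ : ℝ) ^ (n + 2) := by gcongr
      _ = _ := by rw [mul_pow, pow_add]; field_simp
  refine (Finset.sum_le_sum hterm).trans ?_
  rw [← Finset.mul_sum]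
  gcongr
  exact hs.sum_le_tsum _ fun _ _ => by positivity

/-- The non-zero eigenvalues of the Laplacian are bounded below. -/
theorem exists_spectral_gap : ∃ ν₀ > (0 : ℝ), ∀ q : UnitaryDual G,
    laplaceEigenvalue X q.out ≠ 0 → ν₀ ≤ laplaceEigenvalue X q.out := by
  -- Only finitely many classes have weight at most 2. For the others `ν = w² - 1 > 3`, so any gap
  -- of at most 1 is valid there.
  have hfin := finite_weight_le X hg hX μ 2
  let S : Set ℝ := (fun q : UnitaryDual G => laplaceEigenvalue X q.out) ''
    {q : UnitaryDual G | weight X q.out ≤ 2} \ {0}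
  have hS : S.Finite := (hfin.image _).sdiff
  have hpos : ∀ s ∈ S, 0 < s := by
    rintro _ ⟨⟨q, -, rfl⟩, hq⟩
    exact lt_of_le_of_ne (q.out.casimir X hg hX).1 (Ne.symm hq)
  have : ∃ ν₀ > (0 : ℝ), ν₀ ≤ 1 ∧ ∀ s ∈ S, ν₀ ≤ s := by
    rcases S.eq_empty_or_nonempty with h | h
    · exact ⟨1, one_pos, le_rfl, by simp [h]⟩
    · obtain ⟨s, hs, hmin⟩ := S.exists_min_image id hS h
      exact ⟨min s 1, lt_min (hpos s hs) one_pos, min_le_right _ _,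
        fun t ht => (min_le_left _ _).trans (hmin t ht)⟩
  obtain ⟨ν₀, h0, h1, h2⟩ := this
  refine ⟨ν₀, h0, fun q hq => ?_⟩
  by_cases hw : weight X q.out ≤ 2
  · exact h2 _ ⟨⟨q, hw, rfl⟩, hq⟩
  · have := weight_sq X hg hX q.out
    push Not at hw
    nlinarith

end Symbols

/-! ### The topology of smooth functions and convergence of Fourier series. -/

section Topology

open Set Filter Topology MeasureTheory

variable {E : Type*} [NormedAddCommGroup E] [NormedSpace ℝ E]
  {G : Type*} [TopologicalSpace G] [ChartedSpace E G] [Group G] [LieGroup 𝓘(ℝ, E) ∞ G]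

theorem tendsto_smoothFn_iff {ι : Type*} {l : Filter ι} {F : ι → SmoothFn E G}
    {f : SmoothFn E G} :
    Tendsto F l (𝓝 f) ↔ ∀ w : List (GroupLieAlgebra 𝓘(ℝ, E) G),
      TendstoUniformly (fun i x => (w.foldr lieDeriv (F i)) x)
        (⇑(w.foldr lieDeriv f : SmoothFn E G)) l := by
  rw [nhds_iInf, tendsto_iInf]
  refine forall_congr' fun w => ?_
  rw [nhds_induced, tendsto_comap_iff, UniformFun.tendsto_iff_tendstoUniformly]
  rfl

variable [CompactSpace G]

theorem continuous_toContinuousMap :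
    Continuous fun f : SmoothFn E G => (⟨f, f.continuous⟩ : C(G, ℂ)) := by
  refine continuous_iff_continuousAt.2 fun f => ?_
  rw [ContinuousAt, ContinuousMap.tendsto_iff_tendstoUniformly]
  exact tendsto_smoothFn_iff.1 tendsto_id []

/-- A Weierstrass test for every iterated derivative. The sum is treated as an integral against
counting measure, so that its smoothness follows from differentiation under the integral sign. -/
theorem exists_hasSum_of_summable [FiniteDimensional ℝ E] {ι : Type*} [Countable ι]
    (f : ι → SmoothFn E G) (hf : ∀ w : List (GroupLieAlgebra 𝓘(ℝ, E) G), ∃ u : ι → ℝ, Summable u ∧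
      ∀ i x, ‖(w.foldr lieDeriv (f i)) x‖ ≤ u i) : ∃ F, HasSum f F := by
  let _ : MeasurableSpace ι := ⊤
  have hsum : ∀ (h : ι → ℂ) (u : ι → ℝ), Summable u → (∀ i, ‖h i‖ ≤ u i) →
      ∫ i, h i ∂Measure.count = ∑' i, h i := by
    intro h u hu hb
    rw [integral_countable (integrable_count_iff.2 (hu.of_nonneg_of_le (fun _ => norm_nonneg _) hb))]
    simp
  have hdom : IsDominated (Measure.count : Measure ι) f := by
    intro w
    refine ⟨fun x => (measurable_from_top).aestronglyMeasurable, ?_⟩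
    obtain ⟨u, hu, hb⟩ := hf w
    exact ⟨u, integrable_count_iff.2 hu.norm, hb⟩
  refine ⟨hdom.integral, tendsto_smoothFn_iff.2 fun w => ?_⟩
  obtain ⟨u, hu, hb⟩ := hf w
  have h1 := tendstoUniformly_tsum hu hb
  have h2 : (⇑(w.foldr lieDeriv hdom.integral) : G → ℂ) =
      fun x => ∑' i, (w.foldr lieDeriv (f i)) x := by
    ext x
    rw [hdom.foldr_lieDeriv_integral, hsum _ u hu fun i => hb i x]
  rw [h2]
  have h3 : (fun (s : Finset ι) x => (w.foldr lieDeriv (∑ i ∈ s, f i) : SmoothFn E G) x) =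
      fun s x => ∑ i ∈ s, (w.foldr lieDeriv (f i)) x := by
    ext s x
    simp only [← lieDerivWord_apply, map_sum, smoothFn_sum_apply]
  rw [h3]
  exact h1

variable [T2Space G] [FiniteDimensional ℝ E] [IsTopologicalGroup G]
  [MeasurableSpace G] [BorelSpace G]
  (μ : Measure G) [μ.IsHaarMeasure] [IsProbabilityMeasure μ]

/-- A Fourier coefficient as a distribution. -/
def fourierCLM (ξ : Irrep G) (i j : Fin ξ.dim) : SmoothFn E G →L[ℂ] ℂ where
  toLinearMap := fourierLin μ ξ i j
  cont := by
    have h : ⇑(fourierLin (E := E) μ ξ i j) = fun f : SmoothFn E G =>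
        inner ℂ (l2 μ (ξ.coeff j i)) (l2 μ (⟨f, SmoothFn.continuous f⟩ : C(G, ℂ))) := by
      ext f
      rw [inner_l2_coeff, fourierCoeff_l2]
      rfl
    change Continuous ⇑(fourierLin (E := E) μ ξ i j)
    rw [h]
    exact continuous_const.inner ((l2 μ).continuous.comp continuous_toContinuousMap)

theorem fourierCLM_apply (ξ : Irrep G) (i j) (f : SmoothFn E G) :
    fourierCLM μ ξ i j f = fourierCoeff μ f ξ i j := rfl

/-- Fourier coefficients are distributions, so they pass through the sum, and orthogonality leaves
one term. -/
theorem fourierCoeff_of_hasSum_synth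
    {A : ∀ q : UnitaryDual G, Matrix (Fin q.out.dim) (Fin q.out.dim) ℂ} {F : SmoothFn E G}
    (h : HasSum (fun q : UnitaryDual G => synth E q.out (A q)) F) (r : UnitaryDual G) :
    fourierCoeff μ F r.out = A r := by
  classical
  ext i j
  have h1 := (fourierCLM μ r.out i j).hasSum h
  refine h1.unique ?_
  have h2 := hasSum_ite_eq r (A r i j)
  convert h2 using 1
  ext q
  rw [fourierCLM_apply, fourierCoeff_synth_out μ q r A]
  split_ifs <;> rfl

theorem smoothFn_eq_of_fourierCoeff_eq {f h : SmoothFn E G}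
    (hfh : ∀ q : UnitaryDual G, fourierCoeff μ f q.out = fourierCoeff μ h q.out) : f = h :=
  ContMDiffMap.coe_injective (eq_of_fourierCoeff_eq μ f.continuous h.continuous hfh)

/-- Left-invariant vector fields act on Fourier coefficients by matrix multiplication. -/
theorem fourierCoeff_lieDeriv (v : GroupLieAlgebra 𝓘(ℝ, E) G) (f : SmoothFn E G) (ξ : Irrep G) :
    fourierCoeff μ (lieDeriv v f) ξ = ξ.deriv v * fourierCoeff μ f ξ := by
  ext i j
  have h1 := integral_lieDeriv_mul μ v f (conjFn (ξ.entry E j i))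
  have h2 : fourierCoeff μ (lieDeriv v f) ξ i j =
      ∫ x, lieDeriv v f x * conjFn (ξ.entry E j i) x ∂μ := rfl
  -- The differential is skew-Hermitian; its sign cancels the one from integration by parts.
  have hD : ∀ k, ξ.deriv v i k = - conj (ξ.deriv v k i) := by
    intro k
    have := congrFun (congrFun (ξ.conjTranspose_deriv v) i) k
    rw [Matrix.conjTranspose_apply, Matrix.neg_apply] at this
    rw [← neg_eq_iff_eq_neg, ← this]; rfl
  rw [h2, h1, Matrix.mul_apply, lieDeriv_conjFn]
  have h3 : ∀ x, f x * conjFn (lieDeriv v (ξ.entry E j i)) x =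
      ∑ k, conj (ξ.deriv v k i) * (f x * conj (ξ.mat x j k)) := by
    intro x
    rw [conjFn_apply, ξ.lieDeriv_entry_apply, Matrix.mul_apply, map_sum, Finset.mul_sum]
    refine Finset.sum_congr rfl fun k _ => ?_
    rw [map_mul]; ring
  simp only [h3]
  have hInt : ∀ k, Integrable (fun x => conj (ξ.deriv v k i) * (f x * conj (ξ.mat x j k))) μ :=
    fun k => (integrable_of_continuous μ
      (f.continuous.mul (ξ.continuous_entry j k).star)).const_mul _
  rw [integral_finsetSum _ fun k _ => hInt k, ← Finset.sum_neg_distrib]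
  refine Finset.sum_congr rfl fun k _ => ?_
  rw [integral_const_mul, hD, neg_mul, fourierCoeff_apply]

end Topology

/-! ### Smooth functions as rapidly decreasing families of matrices. -/

section RapidDecay

open Set Filter Topology MeasureTheory

variable {E : Type*} [NormedAddCommGroup E] [NormedSpace ℝ E]
  {G : Type*} [TopologicalSpace G] [ChartedSpace E G] [Group G] [LieGroup 𝓘(ℝ, E) ∞ G]
  [CompactSpace G] [T2Space G] [FiniteDimensional ℝ E] [IsTopologicalGroup G]
  {n : ℕ} (X : Module.Basis (Fin n) ℝ (GroupLieAlgebra 𝓘(ℝ, E) G))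
  {g : Bundle.ContMDiffRiemannianMetric 𝓘(ℝ, E) ∞ E (fun x : G => TangentSpace 𝓘(ℝ, E) x)}

theorem hsNormSq_smul {m k : ℕ} (c : ℂ) (A : Matrix (Fin m) (Fin k) ℂ) :
    hsNormSq (c • A) = ‖c‖ ^ 2 * hsNormSq A := by
  simp only [hsNormSq, Matrix.smul_apply, smul_eq_mul, norm_mul, mul_pow, Finset.mul_sum]

theorem norm_apply_le_sqrt_hsNormSq {m k : ℕ} (A : Matrix (Fin m) (Fin k) ℂ) (i j) :
    ‖A i j‖ ≤ √(hsNormSq A) := by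
  refine Real.le_sqrt_of_sq_le ?_
  refine (Finset.single_le_sum (f := fun j => ‖A i j‖ ^ 2) (fun j _ => by positivity)
    (Finset.mem_univ j)).trans ?_
  exact Finset.single_le_sum (f := fun i => ∑ j, ‖A i j‖ ^ 2)
    (fun i _ => Finset.sum_nonneg fun j _ => by positivity) (Finset.mem_univ i)

/-- Families of matrices on the unitary dual which decrease faster than all powers of the
weight. -/
def RapidDecay (A : ∀ q : UnitaryDual G, Matrix (Fin q.out.dim) (Fin q.out.dim) ℂ) : Prop :=
  ∀ N : ℕ, ∃ C : ℝ, 0 ≤ C ∧ ∀ q, weight X q.out ^ N * hsNormSq (A q) ≤ C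

/-- The operator `1 - (X₁² + ⋯ + Xₙ²)` on smooth functions. -/
def oneAddLaplacian (f : SmoothFn E G) : SmoothFn E G :=
  f - ∑ a, lieDeriv (X a) (lieDeriv (X a) f)

variable (hg : IsBiinvariant g) (hX : ∀ i j, g.inner 1 (X i) (X j) = if i = j then 1 else 0)
  [MeasurableSpace G] [BorelSpace G]
  (μ : Measure G) [μ.IsHaarMeasure] [IsProbabilityMeasure μ]

include hg hX

theorem fourierCoeff_oneAddLaplacian (f : SmoothFn E G) (ξ : Irrep G) :
    fourierCoeff μ (oneAddLaplacian X f) ξ = ((weight X ξ ^ 2 : ℝ) : ℂ) • fourierCoeff μ f ξ := by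
  rw [oneAddLaplacian, fourierCoeff_smoothFn_sub, fourierCoeff_smoothFn_sum]
  simp only [fourierCoeff_lieDeriv, ← Matrix.mul_assoc]
  rw [← Matrix.sum_mul]
  have h := (ξ.casimir X hg hX).2
  simp only [ξ.conjTranspose_deriv, Matrix.neg_mul, Finset.sum_neg_distrib] at h
  rw [neg_eq_iff_eq_neg] at h
  rw [h, weight_sq X hg hX, Matrix.neg_mul, Matrix.smul_mul, Matrix.one_mul]
  push_cast
  rw [add_smul, one_smul, sub_neg_eq_add]

theorem fourierCoeff_iterate_oneAddLaplacian (f : SmoothFn E G) (ξ : Irrep G) (N : ℕ) :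
    fourierCoeff μ ((oneAddLaplacian X)^[N] f) ξ =
      (((weight X ξ ^ 2) ^ N : ℝ) : ℂ) • fourierCoeff μ f ξ := by
  induction N with
  | zero => simp
  | succ N ih =>
    rw [Function.iterate_succ_apply', fourierCoeff_oneAddLaplacian X hg hX, ih, smul_smul]
    rw [pow_succ' _ N, Complex.ofReal_mul]

/-- The Fourier coefficients of a smooth function are rapidly decreasing. -/
theorem rapidDecay_fourierCoeff (f : SmoothFn E G) :
    RapidDecay X fun q : UnitaryDual G => fourierCoeff μ f q.out := by
  intro N
  -- Its Fourier coefficients are those of `f` times `w ^ (2 * N)`, and Parseval bounds each of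
  -- them.
  let h := (oneAddLaplacian X)^[N] f
  refine ⟨‖smoothL2 μ h‖ ^ 2, by positivity, fun q => ?_⟩
  have hp := hasSum_parseval μ (smoothL2 μ h)
  have h1 := le_hasSum hp q fun r _ => mul_nonneg (Nat.cast_nonneg _) (hsNormSq_nonneg _)
  refine le_trans ?_ h1
  have hw := one_le_weight X hg hX q.out
  have hd : (1 : ℝ) ≤ q.out.dim := by exact_mod_cast q.out.dim_pos
  simp only [h, fourierCoeff_smoothL2, fourierCoeff_iterate_oneAddLaplacian X hg hX, hsNormSq_smul]
  have h2 : weight X q.out ^ N ≤ ‖(((weight X q.out ^ 2) ^ N : ℝ) : ℂ)‖ ^ 2 := by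
    rw [Complex.norm_real, Real.norm_of_nonneg (by positivity), ← pow_mul, ← pow_mul]
    exact pow_le_pow_right₀ hw (by omega)
  have h3 := hsNormSq_nonneg (fourierCoeff μ f q.out)
  calc weight X q.out ^ N * hsNormSq (fourierCoeff μ f q.out)
      ≤ ‖(((weight X q.out ^ 2) ^ N : ℝ) : ℂ)‖ ^ 2 * hsNormSq (fourierCoeff μ f q.out) := by gcongr
    _ ≤ _ := le_mul_of_one_le_left (by positivity) hd

-- A summable family has countable support, and here every term is positive.
include μ in
theorem countable_unitaryDual : Countable (UnitaryDual G) := by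
  have h := (summable_dim_sq_div_weight_pow X hg hX μ).countable_support
  rw [← Set.countable_univ_iff]
  refine h.mono fun q _ => ?_
  exact (div_pos (zero_lt_one.trans_le (one_le_dim_sq q)) (pow_pos (weight_pos X hg hX _) _)).ne'

include μ in
/-- A rapidly decreasing family of matrices is the family of Fourier coefficients of a smooth
function. -/
theorem RapidDecay.exists_hasSum
    {A : ∀ q : UnitaryDual G, Matrix (Fin q.out.dim) (Fin q.out.dim) ℂ} (hA : RapidDecay X A) :
    ∃ F : SmoothFn E G, HasSum (fun q : UnitaryDual G => synth E q.out (A q)) F := by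
  have := countable_unitaryDual X hg hX μ
  refine exists_hasSum_of_summable _ fun w => ?_
  obtain ⟨C, hC, hw⟩ := norm_foldr_lieDeriv_entry_le X hg hX w
  obtain ⟨D, hD, hdim⟩ := exists_dim_sq_le X hg hX μ
  -- The exponent pays for the derivatives (`w.length`), for a factor `d ≤ D * weight ^ n` (`n`) and
  -- for summability over the dual (`n + 2`). It is doubled because decay is measured by the squared
  -- norm.
  obtain ⟨K, hK, hAK⟩ := hA (2 * (w.length + n + (n + 2)))
  have hs := summable_dim_sq_div_weight_pow X hg hX μ
  refine ⟨fun q => C * √K * D * ((q.out.dim : ℝ) ^ 2 / weight X q.out ^ (n + 2)),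
    hs.mul_left _, fun q x => ?_⟩
  have hw1 := one_le_weight X hg hX q.out
  have hw0 := weight_pos X hg hX q.out
  have hd : (1 : ℝ) ≤ q.out.dim := by exact_mod_cast q.out.dim_pos
  have hAq : √(hsNormSq (A q)) * weight X q.out ^ (w.length + n + (n + 2)) ≤ √K := by
    refine Real.le_sqrt_of_sq_le ?_
    rw [mul_pow, Real.sq_sqrt (hsNormSq_nonneg _), ← pow_mul, mul_comm, mul_comm _ 2]
    exact hAK q
  have hbound : ‖(w.foldr lieDeriv (synth E q.out (A q))) x‖ ≤
      (q.out.dim : ℝ) ^ 2 * (q.out.dim * √(hsNormSq (A q)) * (C * weight X q.out ^ w.length)) := by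
    rw [synth, ← lieDerivWord_apply, map_sum, smoothFn_sum_apply]
    refine (norm_sum_le _ _).trans ?_
    have : ∀ p ∈ (Finset.univ : Finset (Fin q.out.dim × Fin q.out.dim)),
        ‖lieDerivWord w ((q.out.dim * A q p.1 p.2 : ℂ) • q.out.entry E p.2 p.1) x‖ ≤
        q.out.dim * √(hsNormSq (A q)) * (C * weight X q.out ^ w.length) := by
      intro p _
      rw [map_smul, smoothFn_smul_apply, norm_mul, norm_mul, Complex.norm_natCast]
      gcongr
      · exact norm_apply_le_sqrt_hsNormSq _ _ _
      · exact hw _ _ _ _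
    refine (Finset.sum_le_sum this).trans_eq ?_
    simp [sq]
  refine hbound.trans ?_
  have hd2 : (q.out.dim : ℝ) ≤ D * weight X q.out ^ n := by nlinarith [hdim q]
  calc (q.out.dim : ℝ) ^ 2 * (q.out.dim * √(hsNormSq (A q)) * (C * weight X q.out ^ w.length))
      ≤ (q.out.dim : ℝ) ^ 2 * (D * weight X q.out ^ n * √(hsNormSq (A q)) *
        (C * weight X q.out ^ w.length)) := by gcongr
    _ = C * D * ((q.out.dim : ℝ) ^ 2 / weight X q.out ^ (n + 2)) *
        (√(hsNormSq (A q)) * weight X q.out ^ (w.length + n + (n + 2))) := by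
      rw [pow_add _ (w.length + n), pow_add _ w.length]; field_simp
    _ ≤ C * D * ((q.out.dim : ℝ) ^ 2 / weight X q.out ^ (n + 2)) * √K := by gcongr
    _ = _ := by ring

/-- The Fourier series of a smooth function converges to it in the topology of smooth
functions. -/
theorem hasSum_fourier (f : SmoothFn E G) :
    HasSum (fun q : UnitaryDual G => synth E q.out (fourierCoeff μ f q.out)) f := by
  obtain ⟨F, hF⟩ := (rapidDecay_fourierCoeff X hg hX μ f).exists_hasSum X hg hX μ
  have h := smoothFn_eq_of_fourierCoeff_eq μ fun q =>
    (fourierCoeff_of_hasSum_synth μ hF q : fourierCoeff μ F q.out = fourierCoeff μ f q.out)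
  rwa [h] at hF

/-- A continuous left-invariant operator acts on Fourier coefficients by its symbol. -/
theorem fourierCoeff_apply_of_isLeftInvariant (P : SmoothFn E G →L[ℂ] SmoothFn E G)
    (hP : IsLeftInvariant P) (f : SmoothFn E G) (q : UnitaryDual G) :
    fourierCoeff μ (P f) q.out = symbol P 1 q.out * fourierCoeff μ f q.out := by
  -- Continuity lets `P` act term by term on the Fourier series, where left-invariance determines
  -- it.
  have h := P.hasSum (hasSum_fourier X hg hX μ f)
  simp only [apply_synth_of_isLeftInvariant P hP] at h
  exact fourierCoeff_of_hasSum_synth μ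
    (A := fun q => symbol P 1 q.out * fourierCoeff μ f q.out) h q

end RapidDecay

/-! ### The smallest nonzero singular value. -/

section SingularValues

open Module

section Abstract

variable {V W : Type*} [NormedAddCommGroup V] [InnerProductSpace ℂ V] [FiniteDimensional ℂ V]
  [NormedAddCommGroup W] [InnerProductSpace ℂ W] [FiniteDimensional ℂ W] (T : V →ₗ[ℂ] W)

/-- `singularValues` is finitely supported, so its nonzero values form a finite set, nonempty as `T
≠ 0`; the infimum is attained. -/
theorem sInf_singularValues_mem (hT : T ≠ 0) :
    sInf (Set.range T.singularValues \ {0}) ∈ Set.range T.singularValues \ {0} := by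
  have hfin : (Set.range T.singularValues \ {0}).Finite := by
    refine (T.singularValues.support.finite_toSet.image T.singularValues).subset ?_
    rintro _ ⟨⟨i, rfl⟩, hi⟩
    exact ⟨i, Finsupp.mem_support_iff.2 hi, rfl⟩
  have hne : (Set.range T.singularValues \ {0}).Nonempty := by
    have h : T.singularValues ≠ 0 := fun h => hT (T.singularValues_eq_zero_iff.1 h)
    obtain ⟨i, hi⟩ := Finsupp.ne_iff.1 h
    exact ⟨_, ⟨i, rfl⟩, by simpa using hi⟩
  exact hne.csInf_mem hfin

/-- The vector is a unit eigenvector of `T^* T` with eigenvalue `s²`. Since `s ≠ 0`, it is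
orthogonal to the kernel. -/
theorem exists_norm_eq_sInf_singularValues (hT : T ≠ 0) :
    ∃ v : V, ‖v‖ = 1 ∧ (∀ u, T u = 0 → inner ℂ u v = 0) ∧
      ‖T v‖ = sInf (Set.range T.singularValues \ {0}) := by
  obtain ⟨⟨i, hi⟩, h0⟩ := sInf_singularValues_mem T hT
  have hin : i < finrank ℂ V := by
    by_contra h
    rw [T.singularValues_of_finrank_le (not_lt.1 h)] at hi
    exact h0 hi.symm
  set s := sInf (Set.range T.singularValues \ {0})
  have hs : s ≠ 0 := h0
  let v := T.isSymmetric_adjoint_comp_self.eigenvectorBasis rfl ⟨i, hin⟩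
  have hv : LinearMap.adjoint T (T v) = ((s ^ 2 : ℝ) : ℂ) • v := by
    have h1 := T.isSymmetric_adjoint_comp_self.apply_eigenvectorBasis rfl ⟨i, hin⟩
    rw [← T.sq_singularValues_of_lt rfl hin, hi] at h1
    exact h1
  have hv1 : ‖v‖ = 1 := (T.isSymmetric_adjoint_comp_self.eigenvectorBasis rfl).norm_eq_one _
  have hin : ∀ u, inner ℂ (T u) (T v) = ((s ^ 2 : ℝ) : ℂ) * inner ℂ u v := fun u => by
    rw [← LinearMap.adjoint_inner_right, hv, inner_smul_right]
  refine ⟨v, hv1, fun u hu => ?_, ?_⟩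
  · have h2 := hin u
    rw [hu, inner_zero_left] at h2
    refine (mul_eq_zero.1 h2.symm).resolve_left ?_
    exact_mod_cast pow_ne_zero 2 hs
  · have h2 := hin v
    rw [inner_self_eq_norm_sq_to_K, inner_self_eq_norm_sq_to_K, hv1] at h2
    have h3 : ‖T v‖ ^ 2 = s ^ 2 := by
      have : ((‖T v‖ ^ 2 : ℝ) : ℂ) = ((s ^ 2 : ℝ) : ℂ) := by
        push_cast
        simpa using h2
      exact_mod_cast this
    have hs0 : 0 ≤ s := hi ▸ T.singularValues_nonneg i
    exact (sq_eq_sq₀ (norm_nonneg _) hs0).1 h3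

/-- Expand `v` in an eigenbasis of `T^* T`. Eigenvectors with singular value zero lie in the kernel,
so `v` has no component along them, and the other singular values are at least the infimum. -/
theorem sInf_singularValues_mul_norm_le (v : V) (hv : ∀ u, T u = 0 → inner ℂ u v = 0) :
    sInf (Set.range T.singularValues \ {0}) * ‖v‖ ≤ ‖T v‖ := by
  by_cases hT : T = 0
  · have h1 := hv v (by simp [hT])
    rw [inner_self_eq_zero] at h1
    simp [h1]
  set s := sInf (Set.range T.singularValues \ {0}) with hs
  have hs0 : 0 ≤ s := by
    obtain ⟨⟨i, hi⟩, -⟩ := sInf_singularValues_mem T hT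
    exact (T.singularValues_nonneg i).trans_eq hi
  let b := T.isSymmetric_adjoint_comp_self.eigenvectorBasis rfl
  have hb : ∀ i, LinearMap.adjoint T (T (b i)) = ((T.singularValues i ^ 2 : ℝ) : ℂ) • b i := by
    intro i
    have h1 := T.isSymmetric_adjoint_comp_self.apply_eigenvectorBasis rfl i
    rw [← T.sq_singularValues_fin rfl] at h1
    exact h1
  have hbv : ∀ i, s ^ 2 * ‖inner ℂ (b i) v‖ ^ 2 ≤
      T.singularValues i ^ 2 * ‖inner ℂ (b i) v‖ ^ 2 := by
    intro i
    by_cases h0 : T.singularValues i = 0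
    · have h2 : T (b i) = 0 := by
        have h3 : inner ℂ (T (b i)) (T (b i)) = 0 := by
          rw [← LinearMap.adjoint_inner_right, hb, h0]
          simp
        exact inner_self_eq_zero.1 h3
      rw [hv _ h2]
      simp
    · have h2 : s ≤ T.singularValues i :=
        csInf_le ⟨0, by rintro _ ⟨⟨j, rfl⟩, -⟩; exact T.singularValues_nonneg j⟩
          ⟨⟨i, rfl⟩, h0⟩
      gcongr
  have hsum : ‖T v‖ ^ 2 = ∑ i : Fin (finrank ℂ V), T.singularValues i ^ 2 * ‖inner ℂ (b i) v‖ ^ 2 := by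
    have h1 : ((‖T v‖ ^ 2 : ℝ) : ℂ) =
        ((∑ i : Fin (finrank ℂ V), T.singularValues i ^ 2 * ‖inner ℂ (b i) v‖ ^ 2 : ℝ) : ℂ) := by
      have h2 := inner_self_eq_norm_sq_to_K (𝕜 := ℂ) (T v)
      rw [← LinearMap.adjoint_inner_right, ← b.sum_inner_mul_inner] at h2
      have h3 : ((‖T v‖ ^ 2 : ℝ) : ℂ) =
          ∑ i, inner ℂ v (b i) * inner ℂ (b i) (LinearMap.adjoint T (T v)) := by
        rw [h2]; push_cast; rfl
      rw [h3]
      push_cast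
      refine Finset.sum_congr rfl fun i _ => ?_
      rw [LinearMap.adjoint_inner_right, ← LinearMap.adjoint_inner_left, hb, inner_smul_left,
        Complex.conj_ofReal, ← inner_conj_symm v, mul_left_comm, Complex.conj_mul']
      push_cast
      rfl
    exact_mod_cast h1
  have hnorm : ‖v‖ ^ 2 = ∑ i, ‖inner ℂ (b i) v‖ ^ 2 := (b.sum_sq_norm_inner_right v).symm
  have h4 : (s * ‖v‖) ^ 2 ≤ ‖T v‖ ^ 2 := by
    rw [mul_pow, hnorm, hsum, Finset.mul_sum]
    exact Finset.sum_le_sum fun i _ => hbv i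
  exact (sq_le_sq₀ (by positivity) (norm_nonneg _)).1 h4

end Abstract

variable {m k : ℕ} {A : Matrix (Fin m) (Fin k) ℂ}

theorem toEuclideanLin_ne_zero (hA : A ≠ 0) : Matrix.toEuclideanLin A ≠ 0 := by
  intro h
  exact hA ((LinearEquiv.map_eq_zero_iff _).1 h)

theorem inner_toLp_eq_sum (u v : Fin k → ℂ) :
    inner ℂ (WithLp.toLp 2 u : EuclideanSpace ℂ (Fin k)) (WithLp.toLp 2 v) =
      ∑ i, conj (u i) * v i := by
  rw [PiLp.inner_apply]
  exact Finset.sum_congr rfl fun i _ => mul_comm _ _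

theorem minPosSingularValue_pos (hA : A ≠ 0) : 0 < minPosSingularValue A := by
  obtain ⟨⟨i, hi⟩, h0⟩ := sInf_singularValues_mem _ (toEuclideanLin_ne_zero hA)
  exact lt_of_le_of_ne ((LinearMap.singularValues_nonneg _ i).trans_eq hi) (Ne.symm h0)

/-- The smallest non-zero singular value is attained at a vector orthogonal to the kernel. -/
theorem exists_vecNorm_mulVec_eq (hA : A ≠ 0) : ∃ v : Fin k → ℂ, vecNorm v = 1 ∧
    (∀ u : Fin k → ℂ, A.mulVec u = 0 → ∑ i, conj (u i) * v i = 0) ∧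
    vecNorm (A.mulVec v) = minPosSingularValue A := by
  obtain ⟨v, h1, h2, h3⟩ := exists_norm_eq_sInf_singularValues _ (toEuclideanLin_ne_zero hA)
  refine ⟨WithLp.ofLp v, h1, fun u hu => ?_, h3⟩
  rw [← inner_toLp_eq_sum]
  refine h2 _ ?_
  change WithLp.toLp 2 (A.mulVec u) = 0
  rw [hu]
  rfl

theorem minPosSingularValue_mul_vecNorm_le (v : Fin k → ℂ)
    (hv : ∀ u : Fin k → ℂ, A.mulVec u = 0 → ∑ i, conj (u i) * v i = 0) :
    minPosSingularValue A * vecNorm v ≤ vecNorm (A.mulVec v) := by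
  refine sInf_singularValues_mul_norm_le (Matrix.toEuclideanLin A) (WithLp.toLp 2 v) fun u hu => ?_
  have := hv (WithLp.ofLp u) (by
    have h : WithLp.toLp 2 (A.mulVec (WithLp.ofLp u)) = (0 : EuclideanSpace ℂ (Fin m)) := hu
    exact congrArg WithLp.ofLp h)
  rw [← inner_toLp_eq_sum] at this
  exact this

theorem sum_conj_mulVec_mul {U : Matrix (Fin m) (Fin k) ℂ} (u : Fin k → ℂ) (v : Fin m → ℂ) :
    ∑ i, conj (U.mulVec u i) * v i = ∑ i, conj (u i) * U.conjTranspose.mulVec v i := by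
  have h : star (U.mulVec u) ⬝ᵥ v = star u ⬝ᵥ U.conjTranspose.mulVec v := by
    rw [Matrix.star_mulVec, ← Matrix.dotProduct_mulVec]
  exact h

/-- A minimal vector for the conjugated matrix is carried back by `U^*`. This one inequality
suffices to reduce bounds on all irreducible representations to representatives of the classes. -/
theorem minPosSingularValue_le_conj {B : Matrix (Fin k) (Fin k) ℂ} {U : Matrix (Fin m) (Fin k) ℂ}
    (h1 : U * U.conjTranspose = 1) (h2 : U.conjTranspose * U = 1)
    (hB : U * B * U.conjTranspose ≠ 0) :
    minPosSingularValue B ≤ minPosSingularValue (U * B * U.conjTranspose) := by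
  obtain ⟨v, hv1, hv2, hv3⟩ := exists_vecNorm_mulVec_eq hB
  have h3 := minPosSingularValue_mul_vecNorm_le (A := B) (U.conjTranspose.mulVec v) fun u hu => by
    rw [← sum_conj_mulVec_mul]
    refine hv2 _ ?_
    rw [Matrix.mulVec_mulVec, Matrix.mul_assoc, h2, Matrix.mul_one, ← Matrix.mulVec_mulVec, hu,
      Matrix.mulVec_zero]
  rw [vecNorm_mulVec_of_isometry (by simpa using h1), hv1, mul_one] at h3
  rw [← hv3, ← Matrix.mulVec_mulVec, ← Matrix.mulVec_mulVec, vecNorm_mulVec_of_isometry h2]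
  exact h3

/-- A vector in the range has a preimage orthogonal to the kernel. -/
theorem exists_mulVec_eq_of_mem_range {y : Fin m → ℂ} (hy : ∃ x, A.mulVec x = y) :
    ∃ v : Fin k → ℂ, A.mulVec v = y ∧
      ∀ u : Fin k → ℂ, A.mulVec u = 0 → ∑ i, conj (u i) * v i = 0 := by
  obtain ⟨x, rfl⟩ := hy
  let K := LinearMap.ker (Matrix.toEuclideanLin A)
  let x' : EuclideanSpace ℂ (Fin k) := WithLp.toLp 2 x
  have hdec := K.starProjection_add_starProjection_orthogonal x'
  have h1 : K.starProjection x' ∈ K := Submodule.starProjection_apply_mem _ _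
  have h2 : Kᗮ.starProjection x' ∈ Kᗮ := Submodule.starProjection_apply_mem _ _
  refine ⟨WithLp.ofLp (Kᗮ.starProjection x'), ?_, fun u hu => ?_⟩
  · have h3 : Matrix.toEuclideanLin A (Kᗮ.starProjection x') = Matrix.toEuclideanLin A x' := by
      conv_rhs => rw [← hdec, map_add, LinearMap.mem_ker.1 h1, zero_add]
    exact congrArg WithLp.ofLp h3
  · rw [← inner_toLp_eq_sum]
    refine (Submodule.mem_orthogonal _ _).1 h2 _ ?_
    change WithLp.toLp 2 (A.mulVec u) = 0
    rw [hu]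
    rfl

theorem hsNormSq_eq_sum_vecNorm_sq (B : Matrix (Fin m) (Fin k) ℂ) :
    hsNormSq B = ∑ j, vecNorm (fun i => B i j) ^ 2 := by
  simp only [hsNormSq, vecNorm_sq]
  exact Finset.sum_comm

end SingularValues

/-! ### Global solvability, closed range and the bound for the symbol. -/

section Solvability

open Set Filter Topology MeasureTheory

theorem exists_pos_le_of_finite {ι : Type*} {S : Set ι} (hS : S.Finite) {f : ι → ℝ}
    (hf : ∀ i ∈ S, 0 < f i) : ∃ c > 0, ∀ i ∈ S, c ≤ f i := by
  rcases S.eq_empty_or_nonempty with h | h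
  · exact ⟨1, one_pos, by simp [h]⟩
  · obtain ⟨i, hi, hmin⟩ := S.exists_min_image f hS h
    exact ⟨f i, hf i hi, hmin⟩

theorem hsNormSq_eq_sq_of_col {m k : ℕ} (B : Matrix (Fin m) (Fin k) ℂ) (o : Fin k)
    (hB : ∀ i j, j ≠ o → B i j = 0) : hsNormSq B = vecNorm (fun i => B i o) ^ 2 := by
  rw [hsNormSq_eq_sum_vecNorm_sq, Finset.sum_eq_single o]
  · intro j _ hj
    have : (fun i => B i j) = 0 := funext fun i => hB i j hj
    rw [this, vecNorm_zero]
    norm_num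
  · simp

theorem vecNorm_col_sq_le_hsNormSq {m k : ℕ} (B : Matrix (Fin m) (Fin k) ℂ) (o : Fin k) :
    vecNorm (fun i => B i o) ^ 2 ≤ hsNormSq B := by
  rw [hsNormSq_eq_sum_vecNorm_sq]
  exact Finset.single_le_sum (f := fun j => vecNorm (fun i => B i j) ^ 2)
    (fun j _ => by positivity) (Finset.mem_univ o)

/-- The matrix with a single non-zero column `v`. -/
def colMatrix {m k : ℕ} (v : Fin m → ℂ) (o : Fin k) : Matrix (Fin m) (Fin k) ℂ :=
  Matrix.of fun i j => if j = o then v i else 0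

theorem colMatrix_col {m k : ℕ} (v : Fin m → ℂ) (o : Fin k) :
    (fun i => colMatrix v o i o) = v := by
  ext i; simp [colMatrix]

theorem mul_colMatrix {l m k : ℕ} (B : Matrix (Fin l) (Fin m) ℂ) (v : Fin m → ℂ) (o : Fin k) :
    B * colMatrix v o = colMatrix (B.mulVec v) o := by
  ext i j
  rw [Matrix.mul_apply]
  by_cases h : j = o
  · simp [colMatrix, h, Matrix.mulVec, dotProduct]
  · simp [colMatrix, h]

theorem hsNormSq_colMatrix {m k : ℕ} (v : Fin m → ℂ) (o : Fin k) :
    hsNormSq (colMatrix v o) = vecNorm v ^ 2 := by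
  rw [hsNormSq_eq_sq_of_col _ o (fun i j hj => by simp [colMatrix, hj]), colMatrix_col]

variable {E : Type*} [NormedAddCommGroup E] [NormedSpace ℝ E]
  {G : Type*} [TopologicalSpace G] [ChartedSpace E G] [Group G] [LieGroup 𝓘(ℝ, E) ∞ G]

/-- Solvability identifies the range with the intersection of the kernels of the distributions
annihilating it. -/
theorem isClosed_range_of_globallySolvable {P : SmoothFn E G →L[ℂ] SmoothFn E G}
    (h : GloballySolvable P) : IsClosed (range P) := by
  have h1 : range P = ⋂ (u : SmoothFn E G →L[ℂ] ℂ) (_ : u.comp P = 0), {f | u f = 0} := by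
    ext f
    simp only [mem_iInter, Set.mem_ofPred_eq]
    constructor
    · rintro ⟨v, rfl⟩ u hu
      exact DFunLike.congr_fun hu v
    · exact fun hf => h f hf
  rw [h1]
  exact isClosed_iInter fun u => isClosed_iInter fun _ =>
    isClosed_eq u.continuous continuous_const

variable [CompactSpace G] [T2Space G] [FiniteDimensional ℝ E] [IsTopologicalGroup G]
  {n : ℕ} (X : Module.Basis (Fin n) ℝ (GroupLieAlgebra 𝓘(ℝ, E) G))
  {g : Bundle.ContMDiffRiemannianMetric 𝓘(ℝ, E) ∞ E (fun x : G => TangentSpace 𝓘(ℝ, E) x)}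

/-- The lower bound for the smallest non-zero singular values of the symbol. -/
def SymbolBound (P : SmoothFn E G →L[ℂ] SmoothFn E G) : Prop :=
  ∃ C > (0 : ℝ), ∃ k > (0 : ℝ), ∀ ξ : Irrep G, symbol P 1 ξ ≠ 0 →
    C * weight X ξ ^ (-k) ≤ minPosSingularValue (symbol P 1 ξ)

variable (hg : IsBiinvariant g) (hX : ∀ i j, g.inner 1 (X i) (X j) = if i = j then 1 else 0)
  [MeasurableSpace G] [BorelSpace G]
  (μ : Measure G) [μ.IsHaarMeasure] [IsProbabilityMeasure μ]
  (P : SmoothFn E G →L[ℂ] SmoothFn E G)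

include hg hX

/-- The bound for the symbol may be checked on representatives. -/
theorem exists_out_of_irrep (ξ : Irrep G) (hξ : symbol P 1 ξ ≠ 0) :
    ∃ q : UnitaryDual G, symbol P 1 q.out ≠ 0 ∧ weight X q.out = weight X ξ ∧
      minPosSingularValue (symbol P 1 q.out) ≤ minPosSingularValue (symbol P 1 ξ) := by
  let q : UnitaryDual G := ⟦ξ⟧
  have hq : ξ.Equivalent q.out := Setoid.symm (Quotient.mk_out ξ)
  have hw := (weight_eq_of_equivalent X hg hX hq).symm
  obtain ⟨U, hU1, hU2, hU⟩ := hq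
  have hσ := symbol_eq_conj hU1 hU P
  refine ⟨q, ?_, hw, ?_⟩
  · intro h0
    rw [h0, Matrix.mul_zero, Matrix.zero_mul] at hσ
    exact hξ hσ
  · rw [hσ] at hξ ⊢
    exact minPosSingularValue_le_conj hU1 hU2 hξ

/-- As weights are at least 1, the exponent may be rounded up to a positive integer, which suits
both rapid decay and the Hölder argument. -/
theorem SymbolBound.exists_nat (h : SymbolBound X P) : ∃ C > (0 : ℝ), ∃ N : ℕ, 0 < N ∧
    ∀ ξ : Irrep G, symbol P 1 ξ ≠ 0 →
      C ≤ weight X ξ ^ N * minPosSingularValue (symbol P 1 ξ) := by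
  obtain ⟨C, hC, k, hk, h⟩ := h
  refine ⟨C, hC, ⌈k⌉₊, Nat.ceil_pos.2 hk, fun ξ hξ => ?_⟩
  have hw := one_le_weight X hg hX ξ
  have hw0 := weight_pos X hg hX ξ
  have h1 := h ξ hξ
  rw [Real.rpow_neg hw0.le, ← div_eq_mul_inv, div_le_iff₀ (Real.rpow_pos_of_pos hw0 _)] at h1
  have h2 : weight X ξ ^ k ≤ weight X ξ ^ ⌈k⌉₊ := by
    rw [← Real.rpow_natCast]
    exact Real.rpow_le_rpow_of_exponent_le hw (Nat.le_ceil k)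
  have h3 := minPosSingularValue_pos hξ
  calc C ≤ minPosSingularValue (symbol P 1 ξ) * weight X ξ ^ k := h1
    _ ≤ minPosSingularValue (symbol P 1 ξ) * weight X ξ ^ ⌈k⌉₊ := by gcongr
    _ = _ := mul_comm _ _

variable (hP : IsLeftInvariant P)

include hP μ

/-- If the bound fails, unit singular vectors placed at bad classes have rapidly decreasing images
under the symbol. These images sum to an element of the closed range, but its preimage cannot have
rapidly decreasing coefficients. -/
theorem symbolBound_of_isClosed_range (hcl : IsClosed (range P)) : SymbolBound X P := by
  classical
  by_contra hcon
  -- The failure of the bound is used with `C = 1 / (j + 1)` and `k = j + 1`, so both the exponent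
  -- and the constant worsen with `j`.
  have hbad : ∀ j : ℕ, ∃ q : UnitaryDual G, symbol P 1 q.out ≠ 0 ∧
      minPosSingularValue (symbol P 1 q.out) * weight X q.out ^ (j + 1) < 1 / (j + 1) := by
    intro j
    by_contra hj
    refine hcon ⟨1 / (j + 1), by positivity, (j + 1 : ℕ), by positivity, fun ξ hξ => ?_⟩
    obtain ⟨q, hq1, hq2, hq3⟩ := exists_out_of_irrep X hg hX P ξ hξ
    push Not at hj
    refine le_trans ?_ hq3
    have hw0 := weight_pos X hg hX ξ
    rw [Real.rpow_neg hw0.le, Real.rpow_natCast, ← div_eq_mul_inv, div_le_iff₀ (by positivity),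
      ← hq2]
    exact hj q hq1
  choose s hs0 hs using hbad
  have hvec : ∀ q : UnitaryDual G, ∃ v : Fin q.out.dim → ℂ, symbol P 1 q.out ≠ 0 →
      vecNorm v = 1 ∧
      (∀ u, (symbol P 1 q.out).mulVec u = 0 → ∑ i, conj (u i) * v i = 0) ∧
      vecNorm ((symbol P 1 q.out).mulVec v) = minPosSingularValue (symbol P 1 q.out) := by
    intro q
    by_cases hq : symbol P 1 q.out = 0
    · exact ⟨0, fun h => absurd hq h⟩
    · obtain ⟨v, hv⟩ := exists_vecNorm_mulVec_eq hq
      exact ⟨v, fun _ => hv⟩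
  choose v hv using hvec
  let o : ∀ q : UnitaryDual G, Fin q.out.dim := fun q => ⟨0, q.out.dim_pos⟩
  -- The family is indexed by the range of `s`, not by `j`, because `s` may repeat classes.
  let B : ∀ q : UnitaryDual G, Matrix (Fin q.out.dim) (Fin q.out.dim) ℂ := fun q =>
    if q ∈ range s then colMatrix (v q) (o q) else 0
  let A : ∀ q : UnitaryDual G, Matrix (Fin q.out.dim) (Fin q.out.dim) ℂ := fun q =>
    symbol P 1 q.out * B q
  have hAs : ∀ j, hsNormSq (A (s j)) = minPosSingularValue (symbol P 1 (s j).out) ^ 2 := by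
    intro j
    simp only [A, B]
    rw [if_pos ⟨j, rfl⟩, mul_colMatrix, hsNormSq_colMatrix, (hv _ (hs0 j)).2.2]
  have hA : RapidDecay X A := by
    intro N
    have hsum : 0 ≤ ∑ j ∈ Finset.range N, weight X (s j).out ^ N * hsNormSq (A (s j)) :=
      Finset.sum_nonneg fun j _ => mul_nonneg (pow_nonneg (weight_pos X hg hX _).le _)
        (hsNormSq_nonneg _)
    refine ⟨1 + ∑ j ∈ Finset.range N, weight X (s j).out ^ N * hsNormSq (A (s j)), by positivity,
      fun q => ?_⟩
    by_cases hq : q ∈ range s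
    · obtain ⟨j, rfl⟩ := hq
      by_cases hj : j < N
      · have := Finset.single_le_sum
          (f := fun j => weight X (s j).out ^ N * hsNormSq (A (s j)))
          (fun j _ => mul_nonneg (pow_nonneg (weight_pos X hg hX _).le _) (hsNormSq_nonneg _))
          (Finset.mem_range.2 hj)
        linarith
      · have hw := one_le_weight X hg hX (s j).out
        have hl := minPosSingularValue_pos (hs0 j)
        have h1 : minPosSingularValue (symbol P 1 (s j).out) * weight X (s j).out ^ (j + 1) ≤ 1 :=
          (hs j).le.trans (by
            rw [div_le_one (by positivity)]
            linarith [(Nat.cast_nonneg j : (0 : ℝ) ≤ j)])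
        -- For `j ≥ N` the smallness of the singular value absorbs `weight ^ N`; the finitely many
        -- smaller `j` are covered by the sum in the constant.
        have h2 : weight X (s j).out ^ N ≤ weight X (s j).out ^ (2 * (j + 1)) :=
          pow_le_pow_right₀ hw (by omega)
        rw [hAs]
        have h3 : weight X (s j).out ^ N * minPosSingularValue (symbol P 1 (s j).out) ^ 2 ≤ 1 := by
          calc _ ≤ weight X (s j).out ^ (2 * (j + 1)) *
                minPosSingularValue (symbol P 1 (s j).out) ^ 2 := by gcongr
            _ = (minPosSingularValue (symbol P 1 (s j).out) * weight X (s j).out ^ (j + 1)) ^ 2 := by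
                ring
            _ ≤ 1 := pow_le_one₀ (by positivity) h1
        linarith
    · have : A q = 0 := by simp only [A, B]; rw [if_neg hq, Matrix.mul_zero]
      have h0 : hsNormSq (A q) = 0 := by rw [this]; simp [hsNormSq]
      rw [h0, mul_zero]
      linarith
  obtain ⟨F, hF⟩ := hA.exists_hasSum X hg hX μ
  have hFr : F ∈ range P := by
    rw [← hcl.closure_eq]
    refine mem_closure_of_tendsto hF (.of_forall fun t => ?_)
    refine ⟨∑ q ∈ t, synth E q.out (B q), ?_⟩
    rw [map_sum]
    exact Finset.sum_congr rfl fun q _ => apply_synth_of_isLeftInvariant P hP _ _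
  obtain ⟨f, rfl⟩ := hFr
  have hfs : ∀ j, 1 ≤ hsNormSq (fourierCoeff μ f (s j).out) := by
    intro j
    have h1 := fourierCoeff_of_hasSum_synth μ hF (s j)
    rw [fourierCoeff_apply_of_isLeftInvariant X hg hX μ P hP] at h1
    -- The column of the preimage differs from `v` by a vector in the kernel, to which `v` is
    -- orthogonal. Its inner product with the unit vector `v` is therefore 1, so its norm is at
    -- least 1.
    have h2 : (symbol P 1 (s j).out).mulVec
        ((fun i => fourierCoeff μ f (s j).out i (o (s j))) - v (s j)) = 0 := by
      rw [Matrix.mulVec_sub, sub_eq_zero]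
      ext i
      have h3 := congrFun (congrFun h1 i) (o (s j))
      simp only [A, B] at h3
      rw [if_pos ⟨j, rfl⟩, mul_colMatrix] at h3
      simpa [colMatrix, Matrix.mul_apply, Matrix.mulVec, dotProduct] using h3
    have h4 := (hv _ (hs0 j)).2.1 _ h2
    simp only [Pi.sub_apply, map_sub, sub_mul, Finset.sum_sub_distrib] at h4
    rw [sum_conj_mul_self, (hv _ (hs0 j)).1, sub_eq_zero] at h4
    have h5 := norm_sum_conj_mul_le (v (s j)) fun i => fourierCoeff μ f (s j).out i (o (s j))
    rw [h4, (hv _ (hs0 j)).1] at h5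
    refine le_trans ?_ (vecNorm_col_sq_le_hsNormSq _ (o (s j)))
    have h6 : 1 ≤ vecNorm fun i => fourierCoeff μ f (s j).out i (o (s j)) := by simpa using h5
    nlinarith
  -- Decay of order one already bounds the weights on the range of `s`, so this range is finite. The
  -- singular values there have a positive lower bound, against `hs` for large `j`.
  obtain ⟨C, hC, hdec⟩ := rapidDecay_fourierCoeff X hg hX μ f 1
  have hfin : (range s).Finite := (finite_weight_le X hg hX μ C).subset (by
    rintro _ ⟨j, rfl⟩
    have h1 := hdec (s j)
    have h2 := hfs j
    have h3 := weight_pos X hg hX (s j).out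
    simp only [pow_one] at h1
    change weight X (s j).out ≤ C
    nlinarith)
  obtain ⟨c, hc, hmin⟩ := exists_pos_le_of_finite hfin
    (f := fun q => minPosSingularValue (symbol P 1 q.out))
    (by rintro _ ⟨j, rfl⟩; exact minPosSingularValue_pos (hs0 j))
  obtain ⟨j, hj⟩ := exists_nat_one_div_lt hc
  have h1 := hmin (s j) ⟨j, rfl⟩
  have h2 := hs j
  have h3 : 1 ≤ weight X (s j).out ^ (j + 1) := one_le_pow₀ (one_le_weight X hg hX _)
  nlinarith

/-- A column outside the range of the symbol is separated from it by a linear form `φ`. Applying `φ`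
to the same column of Fourier coefficients defines a distribution that annihilates the range of `P`
but not `f`. -/
theorem fourierCoeff_col_mem_range {f : SmoothFn E G}
    (hf : ∀ u : SmoothFn E G →L[ℂ] ℂ, u.comp P = 0 → u f = 0) (q : UnitaryDual G)
    (j : Fin q.out.dim) :
    ∃ x, (symbol P 1 q.out).mulVec x = fun i => fourierCoeff μ f q.out i j := by
  by_contra hcon
  let R := LinearMap.range (Matrix.toLin' (symbol P 1 q.out))
  have hy : (fun i => fourierCoeff μ f q.out i j) ∉ R := by
    rintro ⟨x, hx⟩
    exact hcon ⟨x, hx⟩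
  obtain ⟨φ, hφ1, hφ2⟩ := Submodule.exists_le_ker_of_notMem hy
  have hφ : ∀ y : Fin q.out.dim → ℂ, φ y = ∑ i, φ (Pi.single i 1) * y i := by
    intro y
    conv_lhs => rw [← Finset.univ_sum_single y, map_sum]
    refine Finset.sum_congr rfl fun i _ => ?_
    have : (Pi.single i (y i) : Fin q.out.dim → ℂ) = y i • Pi.single i 1 := by
      rw [← Pi.single_smul, smul_eq_mul, mul_one]
    rw [this, map_smul, smul_eq_mul, mul_comm]
  let u : SmoothFn E G →L[ℂ] ℂ := ∑ i, φ (Pi.single i 1) • fourierCLM μ q.out i j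
  have hu : ∀ h, u h = φ fun i => fourierCoeff μ h q.out i j := by
    intro h
    rw [hφ]
    simp only [u, _root_.sum_apply, _root_.smul_apply, smul_eq_mul, fourierCLM_apply]
  refine hφ1 ?_
  rw [← hu]
  refine hf u ?_
  ext h
  change u (P h) = 0
  rw [hu, fourierCoeff_apply_of_isLeftInvariant X hg hX μ P hP]
  refine hφ2 ⟨fun i => fourierCoeff μ h q.out i j, ?_⟩
  rfl

/-- Solve `σ x = y` for each column of each Fourier coefficient with `x` orthogonal to the kernel.
The bound costs a factor `weight ^ N`, so the solutions still decrease rapidly and define a smooth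
function. -/
theorem globallySolvable_of_symbolBound (hb : SymbolBound X P) : GloballySolvable P := by
  obtain ⟨C, hC, N, -, hbound⟩ := hb.exists_nat X hg hX P
  intro f hf
  have hsol : ∀ (q : UnitaryDual G) (j : Fin q.out.dim), ∃ x,
      (symbol P 1 q.out).mulVec x = (fun i => fourierCoeff μ f q.out i j) ∧
      ∀ u, (symbol P 1 q.out).mulVec u = 0 → ∑ i, conj (u i) * x i = 0 := fun q j =>
    exists_mulVec_eq_of_mem_range (fourierCoeff_col_mem_range X hg hX μ P hP hf q j)
  choose x hx1 hx2 using hsol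
  let A : ∀ q : UnitaryDual G, Matrix (Fin q.out.dim) (Fin q.out.dim) ℂ := fun q =>
    Matrix.of fun i j => x q j i
  have hAf : ∀ q, symbol P 1 q.out * A q = fourierCoeff μ f q.out := by
    intro q
    ext i j
    exact congrFun (hx1 q j) i
  have hle : ∀ q, C ^ 2 * hsNormSq (A q) ≤
      weight X q.out ^ (2 * N) * hsNormSq (fourierCoeff μ f q.out) := by
    intro q
    rw [hsNormSq_eq_sum_vecNorm_sq, hsNormSq_eq_sum_vecNorm_sq, Finset.mul_sum, Finset.mul_sum]
    refine Finset.sum_le_sum fun j _ => ?_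
    change C ^ 2 * vecNorm (x q j) ^ 2 ≤ _
    have hw := weight_pos X hg hX q.out
    by_cases hq : symbol P 1 q.out = 0
    · have h1 := hx2 q j (x q j) (by rw [hq, Matrix.zero_mulVec])
      rw [sum_conj_mul_self] at h1
      have h2 : vecNorm (x q j) ^ 2 = 0 := by exact_mod_cast h1
      rw [h2, mul_zero]
      positivity
    · have h1 := minPosSingularValue_mul_vecNorm_le (x q j) (hx2 q j)
      rw [hx1 q j] at h1
      have h2 := hbound q.out hq
      have h3 := vecNorm_nonneg (x q j)
      have h4 : C * vecNorm (x q j) ≤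
          weight X q.out ^ N * vecNorm (fun i => fourierCoeff μ f q.out i j) := by
        calc C * vecNorm (x q j) ≤
            weight X q.out ^ N * minPosSingularValue (symbol P 1 q.out) * vecNorm (x q j) := by
              gcongr
          _ = weight X q.out ^ N * (minPosSingularValue (symbol P 1 q.out) * vecNorm (x q j)) := by
              ring
          _ ≤ _ := by gcongr
      calc C ^ 2 * vecNorm (x q j) ^ 2 = (C * vecNorm (x q j)) ^ 2 := by ring
        _ ≤ (weight X q.out ^ N * vecNorm (fun i => fourierCoeff μ f q.out i j)) ^ 2 := by gcongr
        _ = _ := by ring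
  have hA : RapidDecay X A := by
    intro M
    obtain ⟨K, hK, hKf⟩ := rapidDecay_fourierCoeff X hg hX μ f (M + 2 * N)
    refine ⟨K / C ^ 2, by positivity, fun q => ?_⟩
    have hw := weight_pos X hg hX q.out
    rw [le_div_iff₀ (by positivity)]
    calc weight X q.out ^ M * hsNormSq (A q) * C ^ 2
        = weight X q.out ^ M * (C ^ 2 * hsNormSq (A q)) := by ring
      _ ≤ weight X q.out ^ M *
          (weight X q.out ^ (2 * N) * hsNormSq (fourierCoeff μ f q.out)) := by
          exact mul_le_mul_of_nonneg_left (hle q) (by positivity)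
      _ = weight X q.out ^ (M + 2 * N) * hsNormSq (fourierCoeff μ f q.out) := by ring
      _ ≤ K := hKf q
  obtain ⟨v, hv⟩ := hA.exists_hasSum X hg hX μ
  refine ⟨v, smoothFn_eq_of_fourierCoeff_eq μ fun q => ?_⟩
  rw [fourierCoeff_apply_of_isLeftInvariant X hg hX μ P hP, fourierCoeff_of_hasSum_synth μ hv, hAf]

end Solvability

/-! ### Hölder's inequality, extensions to `L²` and the orthogonal complement of the kernel. -/

section Extensions

open Set Filter Topology MeasureTheory

/-- Hölder's inequality for sums in interpolation form. -/
theorem tsum_pow_le_of_pow_le {ι : Type*} {N : ℕ} (hN : 0 < N) {a b c : ι → ℝ≥0∞}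
    (h : ∀ i, a i ^ (N + 1) ≤ b i ^ N * c i) :
    (∑' i, a i) ^ (N + 1) ≤ (∑' i, b i) ^ N * ∑' i, c i := by
  let _ : MeasurableSpace ι := ⊤
  have hN0 : (0 : ℝ) < N := by exact_mod_cast hN
  have hN1 : (0 : ℝ) < (N : ℝ) + 1 := by positivity
  -- The conjugate exponents are `(N + 1) / N` and `N + 1`; the first requires `N > 0`.
  let p : ℝ := (N + 1) / N
  let r : ℝ := N + 1
  have hpr : p.HolderConjugate r := by
    rw [Real.holderConjugate_iff]
    refine ⟨by simp only [p]; rw [lt_div_iff₀ hN0]; linarith, ?_⟩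
    simp only [p, r]
    field_simp
  have hroot : ∀ x : ℝ≥0∞, (x ^ (N + 1)) ^ (1 / r) = x := fun x => by
    rw [← ENNReal.rpow_natCast, ← ENNReal.rpow_mul]
    have : ((N + 1 : ℕ) : ℝ) * (1 / r) = 1 := by simp only [r]; push_cast; field_simp
    rw [this, ENNReal.rpow_one]
  have hpow : ∀ x : ℝ≥0∞, (x ^ N) ^ (1 / r) = x ^ (1 / p) := fun x => by
    rw [← ENNReal.rpow_natCast, ← ENNReal.rpow_mul]
    congr 1
    simp only [p, r]
    field_simp
  have hr0 : (0 : ℝ) ≤ 1 / r := by positivity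
  have h1 : ∀ i, a i ≤ b i ^ (1 / p) * c i ^ (1 / r) := fun i => by
    rw [← hroot (a i), ← hpow, ← ENNReal.mul_rpow_of_nonneg _ _ hr0]
    exact ENNReal.rpow_le_rpow (h i) hr0
  have h2 := ENNReal.lintegral_mul_le_Lp_mul_Lq (Measure.count : Measure ι) hpr
    (f := fun i => b i ^ (1 / p)) (g := fun i => c i ^ (1 / r))
    measurable_from_top.aemeasurable measurable_from_top.aemeasurable
  simp only [lintegral_count, Pi.mul_apply] at h2
  have hp0 : p ≠ 0 := hpr.ne_zero
  have hr0' : r ≠ 0 := hpr.symm.ne_zero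
  simp only [← ENNReal.rpow_mul, one_div_mul_cancel hp0, one_div_mul_cancel hr0',
    ENNReal.rpow_one] at h2
  have h3 : ∑' i, a i ≤ (∑' i, b i) ^ (1 / p) * (∑' i, c i) ^ (1 / r) :=
    (ENNReal.tsum_le_tsum h1).trans h2
  rw [← hpow, ← ENNReal.mul_rpow_of_nonneg _ _ hr0] at h3
  calc (∑' i, a i) ^ (N + 1) ≤ (((∑' i, b i) ^ N * ∑' i, c i) ^ (1 / r)) ^ (N + 1) := by gcongr
    _ = _ := by
      rw [← ENNReal.rpow_natCast, ← ENNReal.rpow_mul]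
      have : 1 / r * ((N + 1 : ℕ) : ℝ) = 1 := by simp only [r]; push_cast; field_simp
      rw [this, ENNReal.rpow_one]

theorem enorm_sq_rpow_half (x : ℝ≥0∞) : (x ^ 2) ^ (1 / 2 : ℝ) = x := by
  rw [← ENNReal.rpow_natCast, ← ENNReal.rpow_mul]
  norm_num

theorem rpow_half_sq (x : ℝ≥0∞) : (x ^ (1 / 2 : ℝ)) ^ 2 = x := by
  rw [← ENNReal.rpow_natCast, ← ENNReal.rpow_mul]
  norm_num

variable {E : Type*} [NormedAddCommGroup E] [NormedSpace ℝ E]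
  {G : Type*} [TopologicalSpace G] [ChartedSpace E G] [Group G] [LieGroup 𝓘(ℝ, E) ∞ G]
  [CompactSpace G] [T2Space G] [FiniteDimensional ℝ E] [IsTopologicalGroup G]
  [MeasurableSpace G] [BorelSpace G]
  (μ : Measure G) [μ.IsHaarMeasure] [IsProbabilityMeasure μ]

theorem integrable_mul_conj_entry (f : Lp ℂ 2 μ) (ξ : Irrep G) (i j) :
    Integrable (fun x => f x * conj (ξ.mat x i j)) μ := by
  have h1 : Integrable f μ := (Lp.memLp f).integrable (by norm_num)
  refine h1.mul_bdd (c := 1) (ξ.continuous_entry i j).star.aestronglyMeasurable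
    (.of_forall fun x => ?_)
  exact (RCLike.norm_conj _).trans_le (ξ.norm_entry_le_one x i j)

/-- The extension to `L²` of an operator acting on Fourier coefficients by a matrix acts by the
same matrix. -/
theorem IsExtension.fourierCoeff_eq {Q : SmoothFn E G → SmoothFn E G} {ξ : Irrep G}
    {M : Matrix (Fin ξ.dim) (Fin ξ.dim) ℂ}
    (hM : ∀ u : SmoothFn E G, fourierCoeff μ (Q u) ξ = M * fourierCoeff μ u ξ)
    {f h : Lp ℂ 2 μ} (hf : IsExtension μ Q f h) :
    fourierCoeff μ h ξ = M * fourierCoeff μ f ξ := by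
  ext i j
  -- The test function is the conjugate of `ξ_{ji}`, and `ψ` is its image under the transpose, as
  -- dictated by the matrix `M`.
  let ψ : SmoothFn E G := ∑ k, M i k • conjFn (ξ.entry E j k)
  have hψ : ∀ x, ψ x = ∑ k, M i k * conj (ξ.mat x j k) := fun x => by
    simp only [ψ, smoothFn_sum_apply]; rfl
  have hInt : ∀ u : G → ℂ, (∀ k, Integrable (fun x => u x * conj (ξ.mat x j k)) μ) →
      ∫ x, u x * ψ x ∂μ = (M * fourierCoeff μ u ξ) i j := by
    intro u hu
    have h1 : ∀ x, u x * ψ x = ∑ k, M i k * (u x * conj (ξ.mat x j k)) := fun x => by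
      rw [hψ, Finset.mul_sum]
      exact Finset.sum_congr rfl fun k _ => by ring
    simp only [h1]
    rw [integral_finsetSum _ fun k _ => (hu k).const_mul _, Matrix.mul_apply]
    refine Finset.sum_congr rfl fun k _ => ?_
    rw [integral_const_mul, fourierCoeff_apply]
  have h2 := hf (conjFn (ξ.entry E j i)) ψ fun u => by
    rw [hInt u fun k => integrable_of_continuous μ (u.continuous.mul (ξ.continuous_entry j k).star),
      ← hM]
    rfl
  rw [hInt f fun k => integrable_mul_conj_entry μ f ξ j k] at h2
  exact h2

theorem isExtension_smoothL2 (Q : SmoothFn E G → SmoothFn E G) (f : SmoothFn E G) :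
    IsExtension μ Q (smoothL2 μ f) (smoothL2 μ (Q f)) := by
  intro φ ψ h
  have h1 : ∀ (u : SmoothFn E G) (θ : SmoothFn E G),
      ∫ x, smoothL2 μ u x * θ x ∂μ = ∫ x, u x * θ x ∂μ := fun u θ => by
    refine integral_congr_ae ?_
    filter_upwards [coeFn_smoothL2 μ u] with x hx
    rw [hx]
  rw [h1, h1]
  exact h f

/-- Every `L²` value of the extension has the Fourier coefficients prescribed by `M`, so Parseval
computes its norm. If there is no such value the right side is infinite. -/
theorem tsum_le_extensionNorm_sq {Q : SmoothFn E G → SmoothFn E G}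
    {M : ∀ q : UnitaryDual G, Matrix (Fin q.out.dim) (Fin q.out.dim) ℂ}
    (hM : ∀ (q : UnitaryDual G) (u : SmoothFn E G),
      fourierCoeff μ (Q u) q.out = M q * fourierCoeff μ u q.out) (f : Lp ℂ 2 μ) :
    ∑' q : UnitaryDual G, ENNReal.ofReal (q.out.dim * hsNormSq (M q * fourierCoeff μ f q.out)) ≤
      extensionNorm μ Q f ^ 2 := by
  rw [← rpow_half_sq (∑' _, _)]
  gcongr
  refine le_iInf₂ fun h hh => ?_
  rw [← enorm_sq_rpow_half ‖h‖ₑ, ← tsum_ofReal_parseval]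
  simp only [hh.fourierCoeff_eq μ (hM _)]
  exact le_rfl

theorem tsum_ofReal_synth (q : UnitaryDual G) (A : Matrix (Fin q.out.dim) (Fin q.out.dim) ℂ) :
    ‖smoothL2 μ (synth E q.out A)‖ₑ ^ 2 = ENNReal.ofReal (q.out.dim * hsNormSq A) := by
  rw [← tsum_ofReal_parseval, tsum_eq_single q]
  · rw [fourierCoeff_smoothL2, fourierCoeff_synth_self]
  · intro r hr
    rw [fourierCoeff_smoothL2,
      fourierCoeff_synth_of_not_equivalent μ (not_equivalent_out hr.symm)]
    simp [hsNormSq]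

theorem extensionNorm_smoothL2_le (Q : SmoothFn E G → SmoothFn E G) (f : SmoothFn E G) :
    extensionNorm μ Q (smoothL2 μ f) ≤ ‖smoothL2 μ (Q f)‖ₑ :=
  iInf₂_le _ (isExtension_smoothL2 μ Q f)

include μ in
theorem lieDeriv_synth (v : GroupLieAlgebra 𝓘(ℝ, E) G) (q : UnitaryDual G)
    (A : Matrix (Fin q.out.dim) (Fin q.out.dim) ℂ) :
    lieDeriv v (synth E q.out A) = synth E q.out (q.out.deriv v * A) := by
  refine smoothFn_eq_of_fourierCoeff_eq μ fun r => ?_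
  rw [fourierCoeff_lieDeriv]
  by_cases h : q = r
  · subst h
    rw [fourierCoeff_synth_self, fourierCoeff_synth_self]
  · rw [fourierCoeff_synth_of_not_equivalent μ (not_equivalent_out h),
      fourierCoeff_synth_of_not_equivalent μ (not_equivalent_out h), Matrix.mul_zero]

variable {n : ℕ} (X : Module.Basis (Fin n) ℝ (GroupLieAlgebra 𝓘(ℝ, E) G))
  {g : Bundle.ContMDiffRiemannianMetric 𝓘(ℝ, E) ∞ E (fun x : G => TangentSpace 𝓘(ℝ, E) x)}
  (hg : IsBiinvariant g) (hX : ∀ i j, g.inner 1 (X i) (X j) = if i = j then 1 else 0)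

theorem memSobolev_smoothL2_synth (q : UnitaryDual G)
    (A : Matrix (Fin q.out.dim) (Fin q.out.dim) ℂ) :
    MemSobolev μ X 1 (smoothL2 μ (synth E q.out A)) := by
  rw [MemSobolev, sobolevNormSq, tsum_eq_single q]
  · exact ENNReal.ofReal_lt_top
  · intro r hr
    rw [fourierCoeff_smoothL2,
      fourierCoeff_synth_of_not_equivalent μ (not_equivalent_out hr.symm)]
    simp [hsNormSq]

theorem trace_mul_conjTranspose_eq_sum {m : ℕ} (A B : Matrix (Fin m) (Fin m) ℂ) :
    (A * B.conjTranspose).trace = ∑ j, ∑ i, conj (B i j) * A i j := by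
  rw [Finset.sum_comm, Matrix.trace]
  refine Finset.sum_congr rfl fun i _ => ?_
  rw [Matrix.diag_apply, Matrix.mul_apply]
  exact Finset.sum_congr rfl fun j _ => mul_comm _ _

include hg hX

theorem sum_hsNormSq_deriv_mul (ξ : Irrep G) (A : Matrix (Fin ξ.dim) (Fin ξ.dim) ℂ) :
    ∑ a, hsNormSq (ξ.deriv (X a) * A) = laplaceEigenvalue X ξ * hsNormSq A := by
  simp only [hsNormSq_eq_sum_vecNorm_sq]
  rw [Finset.sum_comm, Finset.mul_sum]
  refine Finset.sum_congr rfl fun j _ => ?_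
  rw [← ξ.sum_vecNorm_deriv_sq X hg hX]
  rfl

theorem tsum_le_gradNorm_sq (f : Lp ℂ 2 μ) :
    ∑' q : UnitaryDual G, ENNReal.ofReal
      (laplaceEigenvalue X q.out * (q.out.dim * hsNormSq (fourierCoeff μ f q.out))) ≤
      gradNorm μ X f ^ 2 := by
  rw [gradNorm, rpow_half_sq]
  refine le_trans (le_of_eq ?_) (Finset.sum_le_sum fun a _ =>
    tsum_le_extensionNorm_sq μ (fun q u => fourierCoeff_lieDeriv μ (X a) u q.out) f)
  rw [← Summable.tsum_finsetSum fun _ _ => ENNReal.summable]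
  refine tsum_congr fun q => ?_
  rw [← ENNReal.ofReal_sum_of_nonneg fun a _ => mul_nonneg (Nat.cast_nonneg _) (hsNormSq_nonneg _),
    ← Finset.mul_sum, sum_hsNormSq_deriv_mul X hg hX]
  congr 1
  ring

theorem gradNorm_synth_sq_le (q : UnitaryDual G) (A : Matrix (Fin q.out.dim) (Fin q.out.dim) ℂ) :
    gradNorm μ X (smoothL2 μ (synth E q.out A)) ^ 2 ≤
      ENNReal.ofReal (laplaceEigenvalue X q.out * (q.out.dim * hsNormSq A)) := by
  rw [gradNorm, rpow_half_sq]
  have h1 : ∀ a ∈ Finset.univ,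
      extensionNorm μ (lieDeriv (X a)) (smoothL2 μ (synth E q.out A)) ^ 2 ≤
      ENNReal.ofReal (q.out.dim * hsNormSq (q.out.deriv (X a) * A)) := fun a _ => by
    rw [← tsum_ofReal_synth (E := E) μ, ← lieDeriv_synth μ]
    gcongr
    exact extensionNorm_smoothL2_le μ _ _
  refine (Finset.sum_le_sum h1).trans_eq ?_
  rw [← ENNReal.ofReal_sum_of_nonneg fun a _ => mul_nonneg (Nat.cast_nonneg _) (hsNormSq_nonneg _),
    ← Finset.mul_sum, sum_hsNormSq_deriv_mul X hg hX]
  congr 1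
  ring

/-- The function is an eigenfunction of `1 - ∑ X_a²` with eigenvalue `1 + ν`, while integrals of
derivatives vanish. Hence `ν` times its integral is zero. -/
theorem integral_synth_eq_zero (q : UnitaryDual G) (A : Matrix (Fin q.out.dim) (Fin q.out.dim) ℂ)
    (hq : laplaceEigenvalue X q.out ≠ 0) : ∫ x, synth E q.out A x ∂μ = 0 := by
  let f := synth E q.out A
  have h1 : oneAddLaplacian X f = ((weight X q.out ^ 2 : ℝ) : ℂ) • f := by
    refine smoothFn_eq_of_fourierCoeff_eq μ fun r => ?_
    rw [fourierCoeff_oneAddLaplacian X hg hX, fourierCoeff_smoothFn_smul]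
    by_cases h : q = r
    · subst h; rfl
    · simp only [f]
      rw [fourierCoeff_synth_of_not_equivalent μ (not_equivalent_out h), smul_zero, smul_zero]
  have h2 : ∫ x, oneAddLaplacian X f x ∂μ = ∫ x, f x ∂μ := by
    have h3 : ∀ x, oneAddLaplacian X f x = f x - ∑ a, lieDeriv (X a) (lieDeriv (X a) f) x := by
      intro x
      rw [oneAddLaplacian, ← smoothFn_sum_apply]
      rfl
    simp only [h3]
    have hInt : ∀ a, Integrable (fun x => lieDeriv (X a) (lieDeriv (X a) f) x) μ := fun a =>
      integrable_of_continuous μ (SmoothFn.continuous _)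
    rw [integral_sub (integrable_of_continuous μ f.continuous)
      (integrable_finsetSum _ fun a _ => hInt a), integral_finsetSum _ fun a _ => hInt a]
    simp only [integral_lieDeriv, Finset.sum_const_zero, sub_zero]
  rw [h1] at h2
  have h4 : ∫ x, (((weight X q.out ^ 2 : ℝ) : ℂ) • f) x ∂μ =
      ((weight X q.out ^ 2 : ℝ) : ℂ) * ∫ x, f x ∂μ := integral_const_mul _ _
  rw [h4, weight_sq X hg hX] at h2
  push_cast at h2
  have h5 : (laplaceEigenvalue X q.out : ℂ) * ∫ x, f x ∂μ = 0 := by linear_combination h2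
  exact (mul_eq_zero.1 h5).resolve_left (by exact_mod_cast hq)

variable (P : SmoothFn E G →L[ℂ] SmoothFn E G) (hP : IsLeftInvariant P)

include hP

/-- The Fourier coefficients of elements of `(ker P)^⊥` have columns orthogonal to the kernel of
the symbol. -/
theorem sum_conj_mul_fourierCoeff_of_mem_kerPerp {f : Lp ℂ 2 μ} (hf : f ∈ kerPerp μ X P)
    (q : UnitaryDual G) (u : Fin q.out.dim → ℂ) (hu : (symbol P 1 q.out).mulVec u = 0)
    (j : Fin q.out.dim) : ∑ i, conj (u i) * fourierCoeff μ f q.out i j = 0 := by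
  -- The kernel vector `u`, placed in column `j`, gives a smooth function in the kernel of `P`. Its
  -- Sobolev product with `f` is a positive multiple of the required sum.
  let h : SmoothFn E G := synth E q.out (colMatrix u j)
  have hPh : P h = 0 := by
    simp only [h]
    rw [apply_synth_of_isLeftInvariant P hP, mul_colMatrix, hu]
    ext x
    rw [synth_apply]
    have : colMatrix (0 : Fin q.out.dim → ℂ) j = 0 := by
      ext i k; simp [colMatrix]
    rw [this, Matrix.zero_mul, Matrix.trace_zero, mul_zero]
    rfl
  have hext : IsExtension μ P (smoothL2 μ h) 0 := by
    have := isExtension_smoothL2 μ P h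
    rw [hPh] at this
    have h0 : smoothL2 μ (0 : SmoothFn E G) = 0 := (l2 μ).map_zero
    rwa [h0] at this
  have h1 := hf.2 _ (memSobolev_smoothL2_synth μ X q _) hext
  have hq : fourierCoeff μ (smoothL2 μ h) q.out = colMatrix u j := by
    rw [fourierCoeff_smoothL2]
    exact fourierCoeff_synth_self μ _ _
  have hr : ∀ r : UnitaryDual G, r ≠ q → fourierCoeff μ (smoothL2 μ h) r.out = 0 := fun r hr => by
    rw [fourierCoeff_smoothL2]
    exact fourierCoeff_synth_of_not_equivalent μ (not_equivalent_out hr.symm) _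
  rw [sobolevInner, tsum_eq_single q] at h1
  · rw [hq, trace_mul_conjTranspose_eq_sum,
      Finset.sum_eq_single j] at h1
    · have h2 : (((q.out.dim : ℝ) * weight X q.out ^ (2 * 1 : ℝ) : ℝ) : ℂ) ≠ 0 := by
        have := weight_pos X hg hX q.out
        have hd : (0 : ℝ) < q.out.dim := by exact_mod_cast q.out.dim_pos
        exact_mod_cast (by positivity :
          (0 : ℝ) < (q.out.dim : ℝ) * weight X q.out ^ (2 * 1 : ℝ)).ne'
      have h3 := (mul_eq_zero.1 h1).resolve_left h2
      simpa [colMatrix] using h3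
    · intro k _ hk
      simp [colMatrix, hk]
    · simp
  · intro r hrq
    rw [hr r hrq]
    simp

/-- The Fourier columns at `q` of an element of the kernel of `P` lie in the kernel of the symbol,
hence are orthogonal to `v`; no other class contributes. -/
theorem smoothL2_synth_mem_kerPerp (q : UnitaryDual G) (v : Fin q.out.dim → ℂ)
    (hv : ∀ u, (symbol P 1 q.out).mulVec u = 0 → ∑ i, conj (u i) * v i = 0) (o : Fin q.out.dim) :
    smoothL2 μ (synth E q.out (colMatrix v o)) ∈ kerPerp μ X P := by
  refine ⟨memSobolev_smoothL2_synth μ X q _, fun u _ hu => ?_⟩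
  have hcoef := hu.fourierCoeff_eq μ
    (fun w => fourierCoeff_apply_of_isLeftInvariant X hg hX μ P hP w q)
  have h0 : fourierCoeff μ (0 : Lp ℂ 2 μ) q.out = 0 := by
    rw [fourierCoeff_congr μ (Lp.coeFn_zero ℂ 2 μ)]
    ext i j
    rw [fourierCoeff_apply]
    simp
  rw [h0] at hcoef
  rw [sobolevInner, tsum_eq_single q]
  · rw [fourierCoeff_smoothL2, fourierCoeff_synth_self, trace_mul_conjTranspose_eq_sum,
      Finset.sum_eq_single o]
    · have h1 := hv (fun i => fourierCoeff μ u q.out i o) (by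
        ext i
        exact (congrFun (congrFun hcoef i) o).symm)
      have h2 : ∑ i, conj (fourierCoeff μ u q.out i o) * colMatrix v o i o = 0 := by
        simpa [colMatrix] using h1
      rw [h2, mul_zero]
    · intro k _ hk
      simp [colMatrix, hk]
    · simp
  · intro r hr
    rw [fourierCoeff_smoothL2,
      fourierCoeff_synth_of_not_equivalent μ (not_equivalent_out hr.symm)]
    simp

end Extensions

/-! ### The directional Poincaré inequality and the bound for the symbol. -/

section Poincare

open Set Filter Topology MeasureTheory

variable {E : Type*} [NormedAddCommGroup E] [NormedSpace ℝ E]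
  {G : Type*} [TopologicalSpace G] [ChartedSpace E G] [Group G] [LieGroup 𝓘(ℝ, E) ∞ G]
  [CompactSpace G] [T2Space G] [FiniteDimensional ℝ E] [IsTopologicalGroup G]
  [MeasurableSpace G] [BorelSpace G]
  (μ : Measure G) [μ.IsHaarMeasure] [IsProbabilityMeasure μ]
  {n : ℕ} (X : Module.Basis (Fin n) ℝ (GroupLieAlgebra 𝓘(ℝ, E) G))
  {g : Bundle.ContMDiffRiemannianMetric 𝓘(ℝ, E) ∞ E (fun x : G => TangentSpace 𝓘(ℝ, E) x)}
  (hg : IsBiinvariant g) (hX : ∀ i j, g.inner 1 (X i) (X j) = if i = j then 1 else 0)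

include hg hX

/-- On a connected group a vanishing eigenvalue forces `ξ(x) = 1`, so the coefficient consists of
multiples of the mean value. -/
theorem fourierCoeff_eq_zero_of_integral_eq_zero [ConnectedSpace G] {f : Lp ℂ 2 μ}
    (hf : ∫ x, f x ∂μ = 0) (q : UnitaryDual G) (hq : laplaceEigenvalue X q.out = 0) :
    fourierCoeff μ f q.out = 0 := by
  ext i j
  simp only [fourierCoeff_apply, q.out.mat_eq_one_of_eigenvalue_eq_zero X hg hX hq]
  rw [integral_mul_const, hf, zero_mul]
  rfl

variable (P : SmoothFn E G →L[ℂ] SmoothFn E G) (hP : IsLeftInvariant P)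

include hP

/-- Orthogonality to the kernel gives `C ‖f̂‖ ≤ w ^ N ‖σ f̂‖`, and the spectral gap replaces `w²` by
a multiple of `ν`. Thus `d ‖f̂‖²` to the power `N + 1` is at most `(ν d ‖f̂‖²) ^ N` times a multiple
of `d ‖σ f̂‖²`, and Hölder's inequality sums this over the dual with `δ = N + 1`. -/
theorem directionalPoincare_of_symbolBound (hb : SymbolBound X P) {S : Set (Lp ℂ 2 μ)}
    (hS : S ⊆ kerPerp μ X P)
    (hS0 : ∀ f ∈ S, ∀ q : UnitaryDual G, laplaceEigenvalue X q.out = 0 →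
      fourierCoeff μ f q.out = 0) :
    ∃ δ : ℝ, 1 ≤ δ ∧ DirectionalPoincare μ X P δ S := by
  obtain ⟨C, hC, N, hN, hbound⟩ := hb.exists_nat X hg hX P
  obtain ⟨ν₀, hν₀, hgap⟩ := exists_spectral_gap X hg hX μ
  -- Chosen so that `w² = 1 + ν ≤ κ * ν` whenever `ν ≥ ν₀`.
  let κ : ℝ := 1 + 1 / ν₀
  have hκ : 1 ≤ κ := by simp only [κ]; linarith [one_div_pos.2 hν₀]
  -- The estimate needs `κ ^ N / C ^ 2`; since `κ ≥ 1`, the square of this `K` majorizes it without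
  -- half-integer powers.
  let K : ℝ := κ ^ N / C
  have hK : 0 < K := by positivity
  refine ⟨N + 1, by linarith [(Nat.cast_nonneg N : (0 : ℝ) ≤ N)], Real.toNNReal K⁻¹,
    Real.toNNReal_pos.2 (inv_pos.2 hK), fun f hf => ?_⟩
  have hterm : ∀ q : UnitaryDual G, ENNReal.ofReal (q.out.dim * hsNormSq (fourierCoeff μ f q.out)) ^
      (N + 1) ≤ ENNReal.ofReal (laplaceEigenvalue X q.out *
        (q.out.dim * hsNormSq (fourierCoeff μ f q.out))) ^ N *
      (ENNReal.ofReal (K ^ 2) * ENNReal.ofReal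
        (q.out.dim * hsNormSq (symbol P 1 q.out * fourierCoeff μ f q.out))) := by
    intro q
    set A := fourierCoeff μ f q.out with hA
    set ν := laplaceEigenvalue X q.out with hν
    have hA0 := hsNormSq_nonneg A
    have hν0 : 0 ≤ ν := (q.out.casimir X hg hX).1
    by_cases hz : ν = 0
    · have : A = 0 := hS0 f hf q hz
      have h0 : hsNormSq A = 0 := by rw [this]; simp [hsNormSq]
      rw [h0]
      simp
    have hνg : ν₀ ≤ ν := hgap q hz
    have hw := weight_pos X hg hX q.out
    have hwκ : weight X q.out ^ 2 ≤ κ * ν := by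
      rw [weight_sq X hg hX, ← hν]
      have : 1 ≤ 1 / ν₀ * ν := by
        rw [one_div, inv_mul_eq_div, le_div_iff₀ hν₀]; linarith
      simp only [κ]
      linarith
    have hcol : C ^ 2 * hsNormSq A ≤ weight X q.out ^ (2 * N) * hsNormSq (symbol P 1 q.out * A) := by
      rw [hsNormSq_eq_sum_vecNorm_sq, hsNormSq_eq_sum_vecNorm_sq, Finset.mul_sum, Finset.mul_sum]
      refine Finset.sum_le_sum fun j _ => ?_
      have horth := fun u hu =>
        sum_conj_mul_fourierCoeff_of_mem_kerPerp μ X hg hX P hP (hS hf) q u hu j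
      set a : Fin q.out.dim → ℂ := fun i => A i j with ha
      change C ^ 2 * vecNorm a ^ 2 ≤
        weight X q.out ^ (2 * N) * vecNorm ((symbol P 1 q.out).mulVec a) ^ 2
      by_cases hq : symbol P 1 q.out = 0
      · have h1 := horth a (by rw [hq, Matrix.zero_mulVec])
        have h2 : ((vecNorm a ^ 2 : ℝ) : ℂ) = 0 := by rw [← sum_conj_mul_self]; exact h1
        have h3 : vecNorm a ^ 2 = 0 := by exact_mod_cast h2
        rw [h3, mul_zero]
        positivity
      · have h1 := minPosSingularValue_mul_vecNorm_le (A := symbol P 1 q.out) a horth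
        have h2 := hbound q.out hq
        have h3 := vecNorm_nonneg a
        have h4 : C * vecNorm a ≤ weight X q.out ^ N * vecNorm ((symbol P 1 q.out).mulVec a) := by
          calc C * vecNorm a ≤
              weight X q.out ^ N * minPosSingularValue (symbol P 1 q.out) * vecNorm a := by gcongr
            _ = weight X q.out ^ N * (minPosSingularValue (symbol P 1 q.out) * vecNorm a) := by ring
            _ ≤ _ := by gcongr
        calc C ^ 2 * vecNorm a ^ 2 = (C * vecNorm a) ^ 2 := by ring
          _ ≤ (weight X q.out ^ N * vecNorm ((symbol P 1 q.out).mulVec a)) ^ 2 := by gcongr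
          _ = _ := by ring
    have hB0 := hsNormSq_nonneg (symbol P 1 q.out * A)
    have hkey : hsNormSq A ≤ ν ^ N * (K ^ 2 * hsNormSq (symbol P 1 q.out * A)) := by
      have h1 : weight X q.out ^ (2 * N) ≤ κ ^ (2 * N) * ν ^ N := by
        calc weight X q.out ^ (2 * N) = (weight X q.out ^ 2) ^ N := by rw [pow_mul]
          _ ≤ (κ * ν) ^ N := by gcongr
          _ = κ ^ N * ν ^ N := mul_pow _ _ _
          _ ≤ κ ^ (2 * N) * ν ^ N := by gcongr; omega
      have h2 : C ^ 2 * hsNormSq A ≤ κ ^ (2 * N) * ν ^ N * hsNormSq (symbol P 1 q.out * A) :=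
        hcol.trans (by gcongr)
      have h3 : ν ^ N * (K ^ 2 * hsNormSq (symbol P 1 q.out * A)) =
          κ ^ (2 * N) * ν ^ N * hsNormSq (symbol P 1 q.out * A) / C ^ 2 := by
        simp only [K]
        rw [div_pow, ← pow_mul, mul_comm N 2]
        field_simp
      rw [h3, le_div_iff₀ (by positivity)]
      linarith
    rw [← ENNReal.ofReal_pow (by positivity), ← ENNReal.ofReal_pow (by positivity),
      ← ENNReal.ofReal_mul (by positivity), ← ENNReal.ofReal_mul (by positivity)]
    refine ENNReal.ofReal_le_ofReal ?_
    set d : ℝ := (q.out.dim : ℝ)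
    have hd : 0 ≤ d := Nat.cast_nonneg _
    calc (d * hsNormSq A) ^ (N + 1) = (d * hsNormSq A) ^ N * (d * hsNormSq A) := pow_succ _ _
      _ ≤ (d * hsNormSq A) ^ N *
          (d * (ν ^ N * (K ^ 2 * hsNormSq (symbol P 1 q.out * A)))) := by gcongr
      _ = _ := by rw [mul_pow ν]; ring
  have h1 := tsum_pow_le_of_pow_le hN hterm
  rw [tsum_ofReal_parseval, ENNReal.tsum_mul_left] at h1
  have h2 := tsum_le_gradNorm_sq μ X hg hX f
  have h3 := tsum_le_extensionNorm_sq μ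
    (fun q u => fourierCoeff_apply_of_isLeftInvariant X hg hX μ P hP u q) f
  have h4 : (‖f‖ₑ ^ (N + 1)) ^ 2 ≤
      (ENNReal.ofReal K * (gradNorm μ X f ^ N * extensionNorm μ P f)) ^ 2 := by
    calc (‖f‖ₑ ^ (N + 1)) ^ 2 = (‖f‖ₑ ^ 2) ^ (N + 1) := by rw [← pow_mul, ← pow_mul, mul_comm]
      _ ≤ _ := h1
      _ ≤ (gradNorm μ X f ^ 2) ^ N * (ENNReal.ofReal (K ^ 2) * extensionNorm μ P f ^ 2) := by
          gcongr
      _ = _ := by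
          rw [ENNReal.ofReal_pow hK.le, mul_pow, mul_pow, ← pow_mul, ← pow_mul, mul_comm 2 N]
          ring
  have h5 : ‖f‖ₑ ^ (N + 1) ≤ ENNReal.ofReal K * (gradNorm μ X f ^ N * extensionNorm μ P f) := by
    have := ENNReal.rpow_le_rpow h4 (by norm_num : (0 : ℝ) ≤ 1 / 2)
    rwa [enorm_sq_rpow_half, enorm_sq_rpow_half] at this
  have h6 : ‖f‖ₑ ^ ((N : ℝ) + 1) = ‖f‖ₑ ^ (N + 1) := by
    rw [← ENNReal.rpow_natCast]; push_cast; rfl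
  have h7 : gradNorm μ X f ^ ((N : ℝ) + 1 - 1) = gradNorm μ X f ^ N := by
    rw [add_sub_cancel_right, ENNReal.rpow_natCast]
  rw [h6, h7]
  calc (Real.toNNReal K⁻¹ : ℝ≥0∞) * ‖f‖ₑ ^ (N + 1) ≤
      ENNReal.ofReal K⁻¹ * (ENNReal.ofReal K * (gradNorm μ X f ^ N * extensionNorm μ P f)) := by
        gcongr
        exact le_rfl
    _ = _ := by
        rw [← mul_assoc, ← ENNReal.ofReal_mul (inv_pos.2 hK).le, inv_mul_cancel₀ hK.ne',
          ENNReal.ofReal_one, one_mul]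

/-- Test with a function concentrated at one class whose coefficient has a minimal unit singular
vector as its only nonzero column. The norms of `f`, `∇f` and `P f` are then `√d`, at most `√d w`
and at most `√d λ`; homogeneity cancels `√d` and leaves `c ≤ w ^ (δ - 1) λ`. -/
theorem symbolBound_of_directionalPoincare {δ : ℝ} (hδ : 1 ≤ δ)
    (h : DirectionalPoincare μ X P δ {f | f ∈ kerPerp μ X P ∧ ∫ x, f x ∂μ = 0}) :
    SymbolBound X P := by
  obtain ⟨c, hc, h⟩ := h
  -- Classes with eigenvalue zero cannot be tested by functions of mean zero. They have weight 1, so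
  -- there are finitely many and a constant bounds their singular values.
  obtain ⟨c₀, hc₀, hmin⟩ := exists_pos_le_of_finite
    (((finite_weight_le X hg hX μ 1).subset (fun q (hq : q ∈ {q : UnitaryDual G |
      weight X q.out ≤ 1 ∧ symbol P 1 q.out ≠ 0}) => hq.1)))
    (f := fun q => minPosSingularValue (symbol P 1 q.out))
    (fun q hq => minPosSingularValue_pos hq.2)
  have hc' : (0 : ℝ) < c := hc
  -- The exponent `δ` is used instead of `δ - 1`, which may be zero while `k` has to be positive.
  refine ⟨min c c₀, lt_min hc' hc₀, δ, by linarith, fun ξ hξ => ?_⟩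
  obtain ⟨q, hq0, hqw, hql⟩ := exists_out_of_irrep X hg hX P ξ hξ
  refine le_trans ?_ hql
  rw [← hqw]
  have hw1 := one_le_weight X hg hX q.out
  have hw := weight_pos X hg hX q.out
  set w := weight X q.out with hwdef
  set l := minPosSingularValue (symbol P 1 q.out) with hl
  have hl0 : 0 < l := minPosSingularValue_pos hq0
  by_cases hν : laplaceEigenvalue X q.out = 0
  · have hwle : w ≤ 1 := by
      have := weight_sq X hg hX q.out
      rw [hν, add_zero] at this
      nlinarith
    have h1 : c₀ ≤ l := hmin q ⟨hwle, hq0⟩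
    have h2 : w ^ (-δ) ≤ 1 := Real.rpow_le_one_of_one_le_of_nonpos hw1 (by linarith)
    calc min (c : ℝ) c₀ * w ^ (-δ) ≤ c₀ * 1 := by
          gcongr
          exact min_le_right _ _
      _ ≤ l := by linarith
  · obtain ⟨v, hv1, hv2, hv3⟩ := exists_vecNorm_mulVec_eq hq0
    let o : Fin q.out.dim := ⟨0, q.out.dim_pos⟩
    let f : SmoothFn E G := synth E q.out (colMatrix v o)
    set d : ℝ := (q.out.dim : ℝ) with hd
    have hd0 : 0 < d := by simp only [hd]; exact_mod_cast q.out.dim_pos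
    have hmem := smoothL2_synth_mem_kerPerp μ X hg hX P hP q v hv2 o
    have hInt : ∫ x, smoothL2 μ f x ∂μ = 0 := by
      rw [integral_congr_ae (coeFn_smoothL2 μ f)]
      exact integral_synth_eq_zero μ X hg hX q _ hν
    have h1 := h (smoothL2 μ f) ⟨hmem, hInt⟩
    have hroot : ∀ {x : ℝ≥0∞} {t : ℝ}, 0 ≤ t → x ^ 2 ≤ ENNReal.ofReal (t ^ 2) →
        x ≤ ENNReal.ofReal t := by
      intro x t ht hx
      rw [ENNReal.ofReal_pow ht] at hx
      have := ENNReal.rpow_le_rpow hx (by norm_num : (0 : ℝ) ≤ 1 / 2)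
      rwa [enorm_sq_rpow_half, enorm_sq_rpow_half] at this
    have hsd : 0 < √d := Real.sqrt_pos.2 hd0
    have hsd2 : √d ^ 2 = d := Real.sq_sqrt hd0.le
    have hnorm : ‖smoothL2 μ f‖ₑ = ENNReal.ofReal √d := by
      have h2 := tsum_ofReal_synth (E := E) μ q (colMatrix v o)
      rw [hsNormSq_colMatrix, hv1, one_pow, mul_one, ← hd, ← hsd2,
        ENNReal.ofReal_pow hsd.le] at h2
      rw [← enorm_sq_rpow_half ‖smoothL2 μ f‖ₑ, h2, enorm_sq_rpow_half]
    have hgrad : gradNorm μ X (smoothL2 μ f) ≤ ENNReal.ofReal (√d * w) := by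
      refine hroot (by positivity) ((gradNorm_synth_sq_le μ X hg hX q _).trans
        (ENNReal.ofReal_le_ofReal ?_))
      rw [hsNormSq_colMatrix, hv1, one_pow, mul_one, ← hd, mul_pow, hsd2, hwdef,
        weight_sq X hg hX]
      nlinarith
    have hext : extensionNorm μ P (smoothL2 μ f) ≤ ENNReal.ofReal (√d * l) := by
      refine (extensionNorm_smoothL2_le μ _ _).trans (hroot (by positivity) ?_)
      simp only [f]
      rw [apply_synth_of_isLeftInvariant P hP, tsum_ofReal_synth, mul_colMatrix,
        hsNormSq_colMatrix, hv3, mul_pow, hsd2]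
    have h2 : (c : ℝ≥0∞) * ENNReal.ofReal √d ^ δ ≤
        ENNReal.ofReal (√d * w) ^ (δ - 1) * ENNReal.ofReal (√d * l) := by
      rw [← hnorm]
      refine h1.trans ?_
      gcongr
    rw [ENNReal.ofReal_rpow_of_pos hsd, ENNReal.ofReal_rpow_of_pos (by positivity),
      ← ENNReal.ofReal_mul (by positivity), ← ENNReal.ofReal_coe_nnreal,
      ← ENNReal.ofReal_mul hc'.le, ENNReal.ofReal_le_ofReal_iff (by positivity)] at h2
    have h3 : (√d * w) ^ (δ - 1) * (√d * l) = √d ^ δ * (w ^ (δ - 1) * l) := by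
      rw [Real.mul_rpow hsd.le hw.le, Real.rpow_sub_one hsd.ne']
      field_simp
    rw [h3, mul_comm (c : ℝ)] at h2
    have h4 : (c : ℝ) ≤ w ^ (δ - 1) * l := le_of_mul_le_mul_left h2 (by positivity)
    have h5 : w ^ (δ - 1) ≤ w ^ δ := Real.rpow_le_rpow_of_exponent_le hw1 (by linarith)
    rw [Real.rpow_neg hw.le, ← div_eq_mul_inv, div_le_iff₀ (by positivity)]
    calc min (c : ℝ) c₀ ≤ c := min_le_left _ _
      _ ≤ w ^ (δ - 1) * l := h4
      _ ≤ w ^ δ * l := by gcongr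
      _ = l * w ^ δ := mul_comm _ _

/-- Where the eigenvalue is zero the entries of `ξ` are constants, so `P 1 = 0` makes the symbol
vanish. Its kernel is then the whole space, and orthogonality to it leaves only zero. -/
theorem fourierCoeff_eq_zero_of_apply_one_eq_zero [ConnectedSpace G] (h1 : P 1 = 0)
    {f : Lp ℂ 2 μ} (hf : f ∈ kerPerp μ X P) (q : UnitaryDual G)
    (hq : laplaceEigenvalue X q.out = 0) : fourierCoeff μ f q.out = 0 := by
  have hσ : symbol P 1 q.out = 0 := by
    rw [symbol_one]
    ext i j
    have : q.out.entry E i j = (1 : Matrix (Fin q.out.dim) (Fin q.out.dim) ℂ) i j •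
        (1 : SmoothFn E G) := by
      ext x
      rw [Irrep.entry_apply, q.out.mat_eq_one_of_eigenvalue_eq_zero X hg hX hq,
        smoothFn_smul_apply]
      exact (mul_one _).symm
    rw [Matrix.of_apply, this, map_smul, h1, smul_zero]
    rfl
  ext i j
  have h2 := sum_conj_mul_fourierCoeff_of_mem_kerPerp μ X hg hX P hP hf q (Pi.single i 1)
    (by rw [hσ, Matrix.zero_mulVec]) j
  rw [Finset.sum_eq_single i] at h2
  · simpa using h2
  · intro k _ hk
    simp [Pi.single_eq_of_ne hk]
  · simp

end Poincare

end CompactLie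

end

/-! ### Assembly of the equivalences. -/

open CompactLie MeasureTheory in
theorem mainTheorem4 {E : Type*} [NormedAddCommGroup E] [NormedSpace ℝ E] [FiniteDimensional ℝ E]
    {G : Type*} [TopologicalSpace G] [ChartedSpace E G] [Group G] [LieGroup 𝓘(ℝ, E) ∞ G]
    [T2Space G] [CompactSpace G] [ConnectedSpace G] [MeasurableSpace G] [BorelSpace G]
    (μ : Measure G) [μ.IsHaarMeasure] [IsProbabilityMeasure μ]
    (g : Bundle.ContMDiffRiemannianMetric 𝓘(ℝ, E) ∞ E (fun x : G => TangentSpace 𝓘(ℝ, E) x))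
    (hg : IsBiinvariant g)
    {n : ℕ} (X : Module.Basis (Fin n) ℝ (GroupLieAlgebra 𝓘(ℝ, E) G))
    (hX : ∀ i j, g.inner 1 (X i) (X j) = if i = j then 1 else 0)
    (P : SmoothFn E G →L[ℂ] SmoothFn E G) (hP : IsLeftInvariant P) :
    List.TFAE
      [GloballySolvable P,
       IsClosed (Set.range P),
       ∃ C > (0 : ℝ), ∃ k > (0 : ℝ), ∀ ξ : Irrep G, symbol P 1 ξ ≠ 0 →
         C * weight X ξ ^ (-k) ≤ minPosSingularValue (symbol P 1 ξ),
       ∃ δ : ℝ, 1 ≤ δ ∧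
         DirectionalPoincare μ X P δ {f | f ∈ kerPerp μ X P ∧ ∫ x, f x ∂μ = 0}] ∧
    ((∃ δ : ℝ, 1 ≤ δ ∧ DirectionalPoincare μ X P δ (kerPerp μ X P)) → GloballySolvable P) ∧
    (P 1 = 0 →
      (GloballySolvable P ↔ ∃ δ : ℝ, 1 ≤ δ ∧ DirectionalPoincare μ X P δ (kerPerp μ X P))) := by
  have : IsTopologicalGroup G := topologicalGroup_of_lieGroup 𝓘(ℝ, E) ∞
  have h23 := symbolBound_of_isClosed_range X hg hX μ P hP
  have h31 := globallySolvable_of_symbolBound X hg hX μ P hP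
  have h43 : (∃ δ : ℝ, 1 ≤ δ ∧
      DirectionalPoincare μ X P δ {f | f ∈ kerPerp μ X P ∧ ∫ x, f x ∂μ = 0}) → SymbolBound X P :=
    fun ⟨_, hδ, h⟩ => symbolBound_of_directionalPoincare μ X hg hX P hP hδ h
  have hfull : (∃ δ : ℝ, 1 ≤ δ ∧ DirectionalPoincare μ X P δ (kerPerp μ X P)) →
      GloballySolvable P := by
    rintro ⟨δ, hδ, c, hc, h⟩
    exact h31 (h43 ⟨δ, hδ, c, hc, fun f hf => h f hf.1⟩)
  refine ⟨?_, hfull, fun hP1 => ⟨fun hs => ?_, hfull⟩⟩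
  · tfae_have 1 → 2 := isClosed_range_of_globallySolvable
    tfae_have 2 → 3 := h23
    tfae_have 3 → 1 := h31
    tfae_have 3 → 4 := fun h => directionalPoincare_of_symbolBound μ X hg hX P hP h
      (fun f hf => hf.1)
      (fun f hf => fourierCoeff_eq_zero_of_integral_eq_zero μ X hg hX hf.2)
    tfae_have 4 → 3 := h43
    tfae_finish
  · exact directionalPoincare_of_symbolBound μ X hg hX P hP
      (h23 (isClosed_range_of_globallySolvable hs)) subset_rfl
      (fun f hf => fourierCoeff_eq_zero_of_apply_one_eq_zero μ X hg hX P hP hP1 hf)
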